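/- A \emph{parameterized problem} is a pair $(L,\kappa)$ with a language $L\subseteq\{0,1\}^*$ and an arbitrary function $\kappa:\{0,1\}^*\to\mathbb N$. It is in $\mathrm{EPNL}$ if there are a polynomial $p:\mathbb N\to\mathbb N$ and a deterministic Turing machine $M:\{0,1\}^*\times\{0,1\}^*\to\{0,1\}$ with four binary tapes, namely a read-only input tape, a read-only read-once certificate tape (its head never moves left) and two read/write working tapes (all cells initially $0$) called the $k$-bit tape and the logspace tape, such that - for every $x\in\{0,1\}^*$: $x\in L$ if and only if there is $y\in\{0,1\}^{p(|x|)}$ with $M(x,y)=1$; - for all $x\in\{0,1\}^*$ and $y\in\{0,1\}^{p(|x|)}$, the machine $M$ halts within a number of steps polynomial in $|x|$, and uses at most $\kappa(x)$ cells of the $k$-bit tape and $O(\log|x|)$ cells of the logspace tape. A parameterized problem $B=(L_B,\kappa_B)$ is \emph{$\mathrm{EPNL}$-hard} if for every $A=(L_A,\kappa_A)$ in $\mathrm{EPNL}$ there is a logspace computable function $\phi:\{0,1\}^*\to\{0,1\}^*$ such that, for all $x$, $x\in L_A\iff\phi(x)\in L_B$ and $\kappa_B(\phi(x))\le\kappa_A(x)+O(\log|x|)$.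 For a real number $c\ge 1$, a parameterized problem $(L,\kappa)$ can be solved in $O^*(c^k)$ time if there are a polynomial $r$ and a deterministic multitape Turing machine that decides, for every $x\in\{0,1\}^*$, whether $x\in L$ in at most $c^{\kappa(x)}\,r(|x|)$ steps. \textbf{Proposition.} Every problem in $\mathrm{EPNL}$ can be solved in $O^*(2^k)$ time. Moreover, for every real number $c\ge1$, if some $\mathrm{EPNL}$-hard problem can be solved in $O^*(c^k)$ time, then every problem in $\mathrm{EPNL}$ can be solved in $O^*(c^k)$ time. -/

import Mathlib

namespace EPNL

/-- A parameterized problem: a language over `{0,1}` together with an arbitrary parameterization. -/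
structure ParamProblem where
  L : Language Bool
  κ : List Bool → ℕ

/-- Moves of a tape head. -/
inductive Move where
  | left
  | stay
  | right

/-- The new position of a head on a one-sided tape with cells `0, 1, 2, …`; a head on cell `0`
that is told to move left stays where it is. -/
def Move.shift : Move → ℕ → ℕ
  | .left, h => h - 1
  | .stay, h => h
  | .right, h => h + 1

/-- A one-sided read/write tape over the binary alphabet. -/
structure WorkTape where
  head : ℕ
  cells : ℕ → Bool

namespace WorkTape

/-- The initial tape: all cells are `0`, the head is on the first cell. -/
def blank : WorkTape := ⟨0, fun _ => false⟩

def read (T : WorkTape) : Bool := T.cells T.head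

/-- Write `b` into the scanned cell, then move the head. -/
def act (T : WorkTape) (b : Bool) (d : Move) : WorkTape :=
  ⟨d.shift T.head, Function.update T.cells T.head b⟩

/-- The head is on one of the first `s` cells, or the tape is in its initial state.
If this holds at all times of a computation then the computation uses at most `s` cells: for
`s ≥ 1` the second alternative is contained in the first one, and for `s = 0` it says that
the tape is never touched (no `1` is written on it and the head does not move). -/
def Within (T : WorkTape) (s : ℕ) : Prop := T.head < s ∨ T = blank

end WorkTape

/-- The position of the head of a read-only input tape that holds the word `x` after a move. The
head ranges over the cells `0, …, |x| - 1` of the word and the end marker in position `|x|`. -/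
def inputShift (x : List Bool) (d : Move) (h : ℕ) : ℕ := min (d.shift h) x.length

/-- What a verifying machine does in one step: the new state, the symbols written on the
`k`-bit tape and the logspace tape, the moves of the input head and of the two working heads, and
whether the head of the certificate tape advances by one cell (it can never move back). -/
structure VerifierAction (Q : Type) where
  next : Q
  kWrite : Bool
  lWrite : Bool
  inMove : Move
  kMove : Move
  lMove : Move
  certAdvance : Bool

/-- A deterministic machine with a read-only input tape, a read-only read-once certificate tape and
two binary read/write tapes, the `k`-bit tape and the logspace tape. A state `q` with
`output q = some b` is a halting state with output `b`. The transition function sees, in this order,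
the state, the scanned symbols of the input tape and the certificate tape (`none` is the end marker)
and the scanned bits of the `k`-bit tape and the logspace tape. -/
structure Verifier where
  Q : Type
  finite : Finite Q
  start : Q
  output : Q → Option Bool
  δ : Q → Option Bool → Option Bool → Bool → Bool → VerifierAction Q

namespace Verifier

/-- Configurations; `cert` is the part of the certificate from the scanned cell on. -/
structure Cfg (M : Verifier) where
  state : M.Q
  inHead : ℕ
  kTape : WorkTape
  lTape : WorkTape
  cert : List Bool

def init (M : Verifier) (y : List Bool) : M.Cfg := ⟨M.start, 0, .blank, .blank, y⟩

/-- The configuration that results when an action is carried out. -/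
def perform (M : Verifier) (x : List Bool) (c : M.Cfg) (a : VerifierAction M.Q) : M.Cfg where
  state := a.next
  inHead := inputShift x a.inMove c.inHead
  kTape := c.kTape.act a.kWrite a.kMove
  lTape := c.lTape.act a.lWrite a.lMove
  cert := if a.certAdvance then c.cert.tail else c.cert

/-- One step on input `x`; a halted configuration does not change any more. -/
def step (M : Verifier) (x : List Bool) (c : M.Cfg) : M.Cfg :=
  match M.output c.state with
  | some _ => c
  | none => M.perform x c (M.δ c.state x[c.inHead]? c.cert.head? c.kTape.read c.lTape.read)

/-- The configuration after `t` steps on input `x` and certificate `y`. -/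
def cfgAt (M : Verifier) (x y : List Bool) (t : ℕ) : M.Cfg := (M.step x)^[t] (M.init y)

/-- On input `x` and certificate `y` the machine halts with output `b` within `t` steps. -/
def OutputsWithin (M : Verifier) (x y : List Bool) (b : Bool) (t : ℕ) : Prop :=
  M.output (M.cfgAt x y t).state = some b

/-- `M(x, y) = 1`. -/
def Accepts (M : Verifier) (x y : List Bool) : Prop := ∃ t, M.OutputsWithin x y true t

end Verifier

/-- The function that stands for the logarithm in `O(log n)` bounds; the summand `1` makes the
bounds meaningful for `n = 0` and `n = 1`. -/
def logBound (n : ℕ) : ℕ := Nat.log 2 n + 1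

/-- The class EPNL. -/
def InEPNL (A : ParamProblem) : Prop :=
  ∃ (p : Polynomial ℕ) (M : Verifier),
    (∀ x, x ∈ A.L ↔ ∃ y : List Bool, y.length = p.eval x.length ∧ M.Accepts x y) ∧
    (∃ q : Polynomial ℕ, ∀ x y : List Bool, y.length = p.eval x.length →
      ∃ b, M.OutputsWithin x y b (q.eval x.length)) ∧
    (∀ x y : List Bool, y.length = p.eval x.length →
      ∀ t, (M.cfgAt x y t).kTape.Within (A.κ x)) ∧
    (∃ C : ℕ, ∀ x y : List Bool, y.length = p.eval x.length →
      ∀ t, (M.cfgAt x y t).lTape.Within (C * logBound x.length))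

/-- What a transducer does in one step: the new state, the symbol written on the working tape, the
moves of the input head and the working head, and the bit (if any) that it appends to the output. -/
structure TransducerAction (Q : Type) where
  next : Q
  write : Bool
  inMove : Move
  workMove : Move
  emit : Option Bool

/-- A deterministic machine with a read-only input tape, a binary read/write working tape and a
write-only output tape. -/
structure Transducer where
  Q : Type
  finite : Finite Q
  start : Q
  halting : Set Q
  δ : Q → Option Bool → Bool → TransducerAction Q

namespace Transducer

structure Cfg (T : Transducer) where
  state : T.Q
  inHead : ℕ
  work : WorkTape
  out : List Bool

def init (T : Transducer) : T.Cfg := ⟨T.start, 0, .blank, []⟩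

/-- The configuration that results when an action is carried out. -/
def perform (T : Transducer) (x : List Bool) (c : T.Cfg) (a : TransducerAction T.Q) : T.Cfg where
  state := a.next
  inHead := inputShift x a.inMove c.inHead
  work := c.work.act a.write a.workMove
  out := c.out ++ a.emit.toList

open Classical in
/-- One step on input `x`; a halted configuration does not change any more. -/
noncomputable def step (T : Transducer) (x : List Bool) (c : T.Cfg) : T.Cfg :=
  if c.state ∈ T.halting then c
  else T.perform x c (T.δ c.state x[c.inHead]? c.work.read)

/-- The configuration after `t` steps on input `x`. -/
noncomputable def cfgAt (T : Transducer) (x : List Bool) (t : ℕ) : T.Cfg :=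
  (T.step x)^[t] T.init

end Transducer

/-- `φ` is computed by a deterministic machine that halts on every input and uses `O(log n)` cells
of its working tape on inputs of length `n`. -/
def LogspaceComputable (φ : List Bool → List Bool) : Prop :=
  ∃ T : Transducer,
    (∀ x, ∃ t, (T.cfgAt x t).state ∈ T.halting ∧ (T.cfgAt x t).out = φ x) ∧
    (∃ C : ℕ, ∀ x t, (T.cfgAt x t).work.Within (C * logBound x.length))

/-- Logspace parameter-preserving reducibility of `A` to `B`. -/
def Reducible (A B : ParamProblem) : Prop :=
  ∃ φ : List Bool → List Bool, LogspaceComputable φ ∧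
    (∀ x, x ∈ A.L ↔ φ x ∈ B.L) ∧
    (∃ C : ℕ, ∀ x, B.κ (φ x) ≤ A.κ x + C * logBound x.length)

/-- `A` is EPNL-hard. -/
def IsHard (A : ParamProblem) : Prop := ∀ B, InEPNL B → Reducible B A

open Classical in
/-- `A` can be solved in `O*(c ^ k)` time: a deterministic machine (Mathlib's Turing machines with
finitely many stacks, two of which make up a tape) decides, for every word `x`, whether `x ∈ A.L`
in at most `c ^ κ(x) * poly(|x|)` steps. -/
def SolvableInOStar (A : ParamProblem) (c : ℝ) : Prop :=
  ∃ (D : Turing.TM2ComputableAux Bool Bool) (r : Polynomial ℕ), ∀ x : List Bool, ∃ m : ℕ,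
    (m : ℝ) ≤ c ^ A.κ x * (r.eval x.length : ℕ) ∧
    Nonempty (Turing.TM2OutputsInTime D.tm (x.map D.inputAlphabet.symm)
      (some [D.outputAlphabet.symm (decide (x ∈ A.L))]) m)

end EPNL

/-! For the first claim, the certificate is guessed bit by bit while the verifier is simulated.
Because the certificate is read once, a bit that has been passed never matters again, so a
configuration only has to carry the scanned bit, and both values may be tried whenever the head
advances: every sequence of guesses is realised by an actual certificate
(`Guessed.exists_certificate`). Such a configuration consists of a state, a guessed bit, head
positions, `κ x` bits of the `k`-bit tape and `O(log |x|)` bits of the logspace tape. Hence at most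
`2 ^ κ x * poly |x|` of them are reachable (`exists_records`), and `x` belongs to the language iff
some configuration reached after `q |x|` steps is accepting, where `q` bounds the running time
(`any_layer`).

The search goes layer by layer, a layer being the list of configurations after `t` steps. Its time
has to be linear in the number of configurations, up to polynomial factors; comparing all pairs
would already give `4 ^ k`. Each configuration is therefore written as a record of polynomial length
whose `i`-th letter describes cell `i` of all tapes. A step of the verifier becomes three passes
over the record (`image_record`). Repetitions are removed by a radix sort that only uses stacks,
followed by a comparison of each record with its predecessor (`nodup_dropRepeated_sortList`). So a
layer never has more than twice as many records as there are distinct configurations in the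
preceding one (`length_layerList_le`), and each record costs polynomial time.

For the second claim, a logspace transducer halts in polynomial time, since its configuration
without the output cannot repeat before halting (`exists_halting_le`). Running it before the solver
of the hard problem costs `c ^ (κ x + O(log |x|)) * poly |x|`, and `c ^ O(log |x|)` is polynomial
(`SolvableInOStar.of_reducible`).

Both algorithms are written as structured stack programs with explicit step counts; `exists_glue`
compiles such a program, followed by a given machine, into one machine. -/

namespace EPNL

/-- An elementary operation of a program with stacks indexed by `K`, stack alphabet `Γ` and a finite
memory `σ`. -/
inductive Op (K Γ σ : Type) where
  | pop (k : K) (f : σ → Option Γ → σ)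
  | push (k : K) (f : σ → Option Γ)
  | load (f : σ → σ)

/-- Structured stack programs. `loop b c p` executes `b`, stops if `c` is false, and otherwise
executes `p` and starts again. -/
inductive Prog (K Γ σ : Type) where
  | blk (b : List (Op K Γ σ))
  | seq (p q : Prog K Γ σ)
  | loop (b : List (Op K Γ σ)) (c : σ → Bool) (p : Prog K Γ σ)

/-! ### Semantics and running time of stack programs -/

section Semantics

variable {K Γ σ : Type} [DecidableEq K]

def Op.eval : Op K Γ σ → σ × (K → List Γ) → σ × (K → List Γ)
  | .pop k f, s => (f s.1 (s.2 k).head?, Function.update s.2 k (s.2 k).tail)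
  | .push k f, s => (s.1, Function.update s.2 k ((f s.1).toList ++ s.2 k))
  | .load f, s => (f s.1, s.2)

def evalOps : List (Op K Γ σ) → σ × (K → List Γ) → σ × (K → List Γ)
  | [], s => s
  | o :: b, s => evalOps b (o.eval s)

/-- `Runs p s s' t`: the program `p`, started in `s`, ends in `s'` after `t` steps. -/
inductive Runs : Prog K Γ σ → σ × (K → List Γ) → σ × (K → List Γ) → ℕ → Prop
  | blk (b s) : Runs (.blk b) s (evalOps b s) 1
  | seq {p q s s₁ s₂ t₁ t₂} : Runs p s s₁ t₁ → Runs q s₁ s₂ t₂ → Runs (.seq p q) s s₂ (t₁ + t₂)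
  | loop_exit {b c p s} : c (evalOps b s).1 = false → Runs (.loop b c p) s (evalOps b s) 1
  | loop_step {b c p s s₁ s₂ t₁ t₂} : c (evalOps b s).1 = true → Runs p (evalOps b s) s₁ t₁ →
      Runs (.loop b c p) s₁ s₂ t₂ → Runs (.loop b c p) s s₂ (1 + t₁ + t₂)

/-- `p` leads from `s` to `s'` in at most `T` steps. -/
def RunsIn (p : Prog K Γ σ) (s s' : σ × (K → List Γ)) (T : ℕ) : Prop := ∃ t ≤ T, Runs p s s' t

theorem RunsIn.mono {p : Prog K Γ σ} {s s' : σ × (K → List Γ)} {T T' : ℕ} (h : RunsIn p s s' T)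
    (hT : T ≤ T') : RunsIn p s s' T' :=
  let ⟨t, ht, hr⟩ := h
  ⟨t, ht.trans hT, hr⟩

theorem RunsIn.blk {b : List (Op K Γ σ)} {s s' : σ × (K → List Γ)} (h : evalOps b s = s') :
    RunsIn (.blk b) s s' 1 := ⟨1, le_rfl, h ▸ .blk b s⟩

theorem RunsIn.seq {p q : Prog K Γ σ} {s s₁ s₂ : σ × (K → List Γ)} {T₁ T₂ : ℕ}
    (h₁ : RunsIn p s s₁ T₁) (h₂ : RunsIn q s₁ s₂ T₂) : RunsIn (.seq p q) s s₂ (T₁ + T₂) :=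
  let ⟨t₁, ht₁, hr₁⟩ := h₁
  let ⟨t₂, ht₂, hr₂⟩ := h₂
  ⟨t₁ + t₂, add_le_add ht₁ ht₂, .seq hr₁ hr₂⟩

theorem RunsIn.loop_exit {b : List (Op K Γ σ)} {c : σ → Bool} {p : Prog K Γ σ}
    {s s' : σ × (K → List Γ)} (h : evalOps b s = s') (hc : c s'.1 = false) :
    RunsIn (.loop b c p) s s' 1 := ⟨1, le_rfl, h ▸ .loop_exit (h ▸ hc)⟩

theorem RunsIn.loop_step {b : List (Op K Γ σ)} {c : σ → Bool} {p : Prog K Γ σ}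
    {s s' s₁ s₂ : σ × (K → List Γ)} {T₁ T₂ : ℕ} (h : evalOps b s = s') (hc : c s'.1 = true)
    (h₁ : RunsIn p s' s₁ T₁) (h₂ : RunsIn (.loop b c p) s₁ s₂ T₂) :
    RunsIn (.loop b c p) s s₂ (1 + T₁ + T₂) := by
  obtain ⟨t₁, ht₁, hr₁⟩ := h₁
  obtain ⟨t₂, ht₂, hr₂⟩ := h₂
  subst h
  exact ⟨1 + t₁ + t₂, by omega, .loop_step hc hr₁ hr₂⟩

end Semantics

/-! ### Compilation of stack programs into machines -/

section Compile

variable {K Γ σ : Type}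

/-- The control points of a program. -/
def Lab : Prog K Γ σ → Type
  | .blk _ => Unit
  | .seq p q => Lab p ⊕ Lab q
  | .loop _ _ p => Option (Lab p)

instance labFinite : ∀ p : Prog K Γ σ, Finite (Lab p)
  | .blk _ => inferInstanceAs (Finite Unit)
  | .seq p q =>
    have := labFinite p
    have := labFinite q
    inferInstanceAs (Finite (Lab p ⊕ Lab q))
  | .loop _ _ p =>
    have := labFinite p
    inferInstanceAs (Finite (Option (Lab p)))

def entry : ∀ p : Prog K Γ σ, Lab p
  | .blk _ => ()
  | .seq p _ => Sum.inl (entry p)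
  | .loop _ _ _ => none

variable (D : Turing.FinTM2)

/-- The stacks of the compiled machine: an input stack, the stacks of the program and those of `D`. -/
abbrev glueΓ (K Γ : Type) : Option (K ⊕ D.K) → Type
  | none => Bool
  | some (.inl _) => Γ
  | some (.inr k) => D.Γ k

/-- The memory of the compiled machine. -/
abbrev glueσ (Γ σ : Type) : Type := (σ × D.σ) × Option Γ

variable {D}

/-- Assemble the stacks of the compiled machine. -/
def glueStk (i : List Bool) (S : K → List Γ) (S' : ∀ k, List (D.Γ k)) :
    ∀ k, List (glueΓ D K Γ k)
  | none => i
  | some (.inl k) => S k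
  | some (.inr k) => S' k

theorem glueStk_update_io [DecidableEq K] (i i' : List Bool) (S : K → List Γ) (S' : ∀ k, List (D.Γ k)) :
    Function.update (glueStk i S S') none i' = glueStk i' S S' := by
  funext k
  rcases k with _ | k | k <;> simp [Function.update, glueStk]

theorem glueStk_update_prog [DecidableEq K] (i : List Bool) (S : K → List Γ) (S' : ∀ k, List (D.Γ k)) (k : K)
    (l : List Γ) : Function.update (glueStk i S S') (some (.inl k)) l =
      glueStk i (Function.update S k l) S' := by
  funext k'
  rcases k' with _ | k' | k'
  · simp [Function.update, glueStk]
  · by_cases h : k' = k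
    · subst h; simp [Function.update, glueStk]
    · simp [Function.update, glueStk, h]
  · simp [Function.update, glueStk]

theorem glueStk_update_sub [DecidableEq K] (i : List Bool) (S : K → List Γ) (S' : ∀ k, List (D.Γ k)) (k : D.K)
    (l : List (D.Γ k)) : Function.update (glueStk i S S') (some (.inr k)) l =
      glueStk i S (Function.update S' k l) := by
  funext k'
  rcases k' with _ | k' | k'
  · simp [Function.update, glueStk]
  · simp [Function.update, glueStk]
  · by_cases h : k' = k
    · subst h; simp [Function.update, glueStk]
    · simp [Function.update, glueStk, h]

variable [Inhabited Γ]

/-- A machine push is unconditional, so an optional push becomes a branch; the `default` is never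
pushed. -/
def Op.toStmt {Λ : Type} (n : Turing.TM2.Stmt (glueΓ D K Γ) Λ (glueσ D Γ σ)) :
    Op K Γ σ → Turing.TM2.Stmt (glueΓ D K Γ) Λ (glueσ D Γ σ)
  | .pop k f => .pop (some (.inl k)) (fun s g => ((f s.1.1 g, s.1.2), s.2)) n
  | .push k f => .branch (fun s => (f s.1.1).isSome)
      (.push (some (.inl k)) (fun s => (f s.1.1).getD default) n) n
  | .load f => .load (fun s => ((f s.1.1, s.1.2), s.2)) n

def opsToStmt {Λ : Type} (n : Turing.TM2.Stmt (glueΓ D K Γ) Λ (glueσ D Γ σ)) :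
    List (Op K Γ σ) → Turing.TM2.Stmt (glueΓ D K Γ) Λ (glueσ D Γ σ)
  | [] => n
  | o :: b => o.toStmt (opsToStmt n b)

/-- The statements of the control points of a program, if its control points are embedded into a
set of labels and the program ends at the label `ex`. -/
def code {Λ : Type} : ∀ (p : Prog K Γ σ) (_ : Lab p → Λ) (_ : Λ),
    Lab p → Turing.TM2.Stmt (glueΓ D K Γ) Λ (glueσ D Γ σ)
  | .blk b, _, ex => fun _ => opsToStmt (.goto fun _ => ex) b
  | .seq p q, emb, ex => Sum.elim
      (code p (fun l => emb (Sum.inl l)) (emb (Sum.inr (entry q))))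
      (code q (fun l => emb (Sum.inr l)) ex)
  | .loop b c p, emb, ex => fun l => Option.elim l
      (opsToStmt (.branch (fun s => c s.1.1) (.goto fun _ => emb (some (entry p)))
        (.goto fun _ => ex)) b)
      (code p (fun l => emb (some l)) (emb none))

variable [DecidableEq K]

theorem stepAux_opsToStmt {Λ : Type} (n : Turing.TM2.Stmt (glueΓ D K Γ) Λ (glueσ D Γ σ))
    (d : D.σ) (r : Option Γ) (i : List Bool) (S' : ∀ k, List (D.Γ k)) :
    ∀ (b : List (Op K Γ σ)) (s : σ × (K → List Γ)),
      Turing.TM2.stepAux (opsToStmt n b) ((s.1, d), r) (glueStk i s.2 S') =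
        Turing.TM2.stepAux n (((evalOps b s).1, d), r) (glueStk i (evalOps b s).2 S')
  | [], s => rfl
  | o :: b, s => by
    rw [evalOps, ← stepAux_opsToStmt n d r i S' b (o.eval s)]
    cases o with
    | pop k f => simp [opsToStmt, Op.toStmt, Op.eval, glueStk_update_prog]; rfl
    | push k f =>
      rcases h : f s.1 with _ | g
      · simp [opsToStmt, Op.toStmt, Op.eval, h]
      · simp [opsToStmt, Op.toStmt, Op.eval, h, glueStk_update_prog]; rfl
    | load f => simp [opsToStmt, Op.toStmt, Op.eval]

theorem iterate_bind_trans {C : Type} {f : C → Option C} {a b : C} {c : Option C} {m n : ℕ}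
    (h₁ : (flip bind f)^[m] (some a) = some b) (h₂ : (flip bind f)^[n] (some b) = c) :
    (flip bind f)^[m + n] (some a) = c := by
  rw [add_comm, Function.iterate_add_apply, h₁, h₂]

/-- The step counts of `Runs` are exact because one machine step executes a whole statement up to
its `goto`, so a block costs one step however many operations it contains. The embedding of the
labels and the exit label are arbitrary so that the induction passes to subprograms. -/
theorem iterate_code {Λ : Type} (prog : Λ → Turing.TM2.Stmt (glueΓ D K Γ) Λ (glueσ D Γ σ))
    (d : D.σ) (r : Option Γ) (i : List Bool) (S' : ∀ k, List (D.Γ k))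
    {p : Prog K Γ σ} {s s' : σ × (K → List Γ)} {t : ℕ} (hr : Runs p s s' t) :
    ∀ (emb : Lab p → Λ) (ex : Λ), (∀ l, prog (emb l) = code p emb ex l) →
      (flip bind (Turing.TM2.step prog))^[t]
        (some ⟨some (emb (entry p)), ((s.1, d), r), glueStk i s.2 S'⟩) =
        some ⟨some ex, ((s'.1, d), r), glueStk i s'.2 S'⟩ := by
  induction hr with
  | blk b s =>
    intro emb ex h
    simp [flip, h, code, stepAux_opsToStmt]
  | @seq p q s s₁ s₂ t₁ t₂ _ _ ih₁ ih₂ =>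
    intro emb ex h
    exact iterate_bind_trans
      (ih₁ (fun l => emb (Sum.inl l)) (emb (Sum.inr (entry q))) fun l => h (Sum.inl l))
      (ih₂ (fun l => emb (Sum.inr l)) ex fun l => h (Sum.inr l))
  | loop_exit hc =>
    intro emb ex h
    have h₀ := h none
    simp only [code, Option.elim] at h₀
    simp [flip, entry, h₀, stepAux_opsToStmt, hc]
  | @loop_step b c p s s₁ s₂ t₁ t₂ hc _ _ ih₁ ih₂ =>
    intro emb ex h
    refine iterate_bind_trans (iterate_bind_trans (b := ⟨some (emb (some (entry p))),
      (((evalOps b s).1, d), r), glueStk i (evalOps b s).2 S'⟩) ?_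
      (ih₁ (fun l => emb (some l)) (emb none) fun l => h (some l))) (ih₂ emb ex h)
    have h₀ := h none
    simp only [code, Option.elim] at h₀
    simp [flip, entry, h₀, stepAux_opsToStmt, hc]

end Compile

/-! ### Running a program and then a machine -/

section Glue

variable {K Γ σ : Type} {D : Turing.FinTM2}

/-- Statements of `D` as statements of the compiled machine. -/
def liftStmt {Λ : Type} (emb : D.Λ → Λ) : Turing.TM2.Stmt D.Γ D.Λ D.σ →
    Turing.TM2.Stmt (glueΓ D K Γ) Λ (glueσ D Γ σ)
  | .push k f q => .push (some (.inr k)) (fun s => f s.1.2) (liftStmt emb q)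
  | .peek k f q => .peek (some (.inr k)) (fun s g => ((s.1.1, f s.1.2 g), s.2)) (liftStmt emb q)
  | .pop k f q => .pop (some (.inr k)) (fun s g => ((s.1.1, f s.1.2 g), s.2)) (liftStmt emb q)
  | .load f q => .load (fun s => ((s.1.1, f s.1.2), s.2)) (liftStmt emb q)
  | .branch f q q' => .branch (fun s => f s.1.2) (liftStmt emb q) (liftStmt emb q')
  | .goto f => .goto (fun s => emb (f s.1.2))
  | .halt => .halt

/-- Configurations of `D` as configurations of the compiled machine. -/
def liftCfg {Λ : Type} (emb : D.Λ → Λ) (v : σ) (c : Turing.TM2.Cfg D.Γ D.Λ D.σ) :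
    Turing.TM2.Cfg (glueΓ D K Γ) Λ (glueσ D Γ σ) :=
  ⟨c.l.map emb, ((v, c.var), none), glueStk [] (fun _ => []) c.stk⟩

variable [DecidableEq K]

theorem stepAux_liftStmt {Λ : Type} (emb : D.Λ → Λ) (v : σ) :
    ∀ (q : Turing.TM2.Stmt D.Γ D.Λ D.σ) (d : D.σ) (S' : ∀ k, List (D.Γ k)),
      Turing.TM2.stepAux (liftStmt (K := K) (Γ := Γ) emb q) ((v, d), none)
        (glueStk [] (fun _ => []) S') = liftCfg emb v (Turing.TM2.stepAux q d S')
  | .push k f q, d, S' => by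
    simp only [liftStmt, Turing.TM2.stepAux]
    rw [glueStk_update_sub]; exact stepAux_liftStmt emb v q _ _
  | .peek k f q, d, S' => by
    simp only [liftStmt, Turing.TM2.stepAux]; exact stepAux_liftStmt emb v q _ _
  | .pop k f q, d, S' => by
    simp only [liftStmt, Turing.TM2.stepAux]
    rw [glueStk_update_sub]; exact stepAux_liftStmt emb v q _ _
  | .load f q, d, S' => by
    simp only [liftStmt, Turing.TM2.stepAux]; exact stepAux_liftStmt emb v q _ _
  | .branch f q q', d, S' => by
    simp only [liftStmt, Turing.TM2.stepAux]
    cases f d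
    · exact stepAux_liftStmt emb v q' _ _
    · exact stepAux_liftStmt emb v q _ _
  | .goto f, d, S' => rfl
  | .halt, d, S' => rfl

/-- Lifting configurations commutes with one step, hence with iteration. The statement is about
optional configurations so that it also covers the step after halting. -/
theorem iterate_liftStmt {Λ : Type} (prog : Λ → Turing.TM2.Stmt (glueΓ D K Γ) Λ (glueσ D Γ σ))
    (emb : D.Λ → Λ) (h : ∀ l, prog (emb l) = liftStmt emb (D.m l)) (v : σ) (n : ℕ)
    (c : Option (Turing.TM2.Cfg D.Γ D.Λ D.σ)) :
    (flip bind (Turing.TM2.step prog))^[n] (c.map (liftCfg emb v)) =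
      ((flip bind (Turing.TM2.step D.m))^[n] c).map (liftCfg emb v) := by
  refine ((Function.Semiconj.iterate_right (f := Option.map (liftCfg emb v))
    (ga := flip bind (Turing.TM2.step D.m)) ?_ n) c).symm
  rintro (_ | ⟨_ | l, d, S'⟩)
  · rfl
  · rfl
  · simp only [flip, Option.bind_eq_bind, Option.bind_some, Turing.TM2.step, Option.map_some,
      liftCfg, h]
    exact congrArg some (stepAux_liftStmt emb v _ _ _).symm

variable [Inhabited Γ]

/-- The statements of the machine that loads its input, runs the program `p`, passes the word on
the stack `kout` to `D` and runs `D`. -/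
def glueCode (D : Turing.TM2ComputableAux Bool Bool) (p : Prog K Γ σ) (kin kout : K)
    (embed : Bool → Γ) (decode : Γ → Bool) (v₀ : σ) : Bool ⊕ (Lab p ⊕ D.tm.Λ) →
      Turing.TM2.Stmt (glueΓ D.tm K Γ) (Bool ⊕ (Lab p ⊕ D.tm.Λ)) (glueσ D.tm Γ σ)
  | .inl false => .pop none (fun s b => (s.1, b.map embed)) <|
      .branch (fun s => s.2.isSome)
        (.push (some (.inl kin)) (fun s => s.2.getD default) <| .load (fun s => (s.1, none)) <|
          .goto fun _ => .inl false)
        (.goto fun _ => .inr (.inl (entry p)))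
  | .inl true => .pop (some (.inl kout)) (fun s g => (s.1, g)) <|
      .branch (fun s => s.2.isSome)
        (.push (some (.inr D.tm.k₀))
            (fun s => D.inputAlphabet.symm (decode (s.2.getD default))) <|
          .load (fun s => (s.1, none)) <| .goto fun _ => .inl true)
        -- A halting configuration must have the initial memory and no stack contents but the
        -- output. The memory is reset here; the programs have to empty their own stacks.
        (.load (fun s => ((v₀, s.1.2), none)) <| .goto fun _ => .inr (.inr D.tm.main))
  | .inr (.inl l) => code p (fun l => .inr (.inl l)) (.inl true) l
  | .inr (.inr l) => liftStmt (fun l => .inr (.inr l)) (D.tm.m l)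

theorem iterate_load (D : Turing.TM2ComputableAux Bool Bool) (p : Prog K Γ σ) (kin kout : K)
    (embed : Bool → Γ) (decode : Γ → Bool) (v₀ : σ) (d : D.tm.σ)
    (S' : ∀ k, List (D.tm.Γ k)) : ∀ (x : List Bool) (S : K → List Γ),
      (flip bind (Turing.TM2.step (glueCode D p kin kout embed decode v₀)))^[x.length + 1]
        (some ⟨some (.inl false), ((v₀, d), none), glueStk x S S'⟩) =
        some ⟨some (.inr (.inl (entry p))), ((v₀, d), none),
          glueStk [] (Function.update S kin ((x.map embed).reverse ++ S kin)) S'⟩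
  | [], S => by simp [flip, glueCode, glueStk_update_io, glueStk]
  | b :: x, S => by
    have ih := iterate_load D p kin kout embed decode v₀ d S' x
      (Function.update S kin (embed b :: S kin))
    rw [List.length_cons, Function.iterate_succ_apply]
    simp only [Function.update_idem, Function.update_self] at ih
    simp [flip, glueCode, glueStk, glueStk_update_io, glueStk_update_prog] at ih ⊢
    exact ih

theorem iterate_unload (D : Turing.TM2ComputableAux Bool Bool) (p : Prog K Γ σ) (kin kout : K)
    (embed : Bool → Γ) (decode : Γ → Bool) (v₀ v : σ) (d : D.tm.σ) :
    ∀ (w : List Γ) (S : K → List Γ) (S' : ∀ k, List (D.tm.Γ k)), S kout = w →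
      (flip bind (Turing.TM2.step (glueCode D p kin kout embed decode v₀)))^[w.length + 1]
        (some ⟨some (.inl true), ((v, d), none), glueStk [] S S'⟩) =
        some ⟨some (.inr (.inr D.tm.main)), ((v₀, d), none),
          glueStk [] (Function.update S kout []) (Function.update S' D.tm.k₀
            (((w.map decode).map D.inputAlphabet.symm).reverse ++ S' D.tm.k₀))⟩
  | [], S, S', h => by simp [flip, glueCode, glueStk_update_prog, glueStk, h]
  | b :: w, S, S', h => by
    have ih := iterate_unload D p kin kout embed decode v₀ v d w (Function.update S kout w)
      (Function.update S' D.tm.k₀ (D.inputAlphabet.symm (decode b) :: S' D.tm.k₀)) (by simp)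
    rw [List.length_cons, Function.iterate_succ_apply]
    simp only [Function.update_idem, Function.update_self] at ih
    simp [flip, glueCode, glueStk, glueStk_update_sub, glueStk_update_prog, h] at ih ⊢
    exact ih

/-- A program followed by a machine can be carried out by a single machine. -/
theorem exists_glue [Finite K] [Finite Γ] [Finite σ] (D : Turing.TM2ComputableAux Bool Bool)
    (p : Prog K Γ σ) (kin kout : K) (embed : Bool → Γ) (decode : Γ → Bool) (v₀ : σ) :
    ∃ E : Turing.TM2ComputableAux Bool Bool, ∀ (x : List Bool) (w : List Γ) (b : Bool) (v : σ)
      (t m : ℕ),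
      RunsIn p (v₀, Function.update (fun _ => []) kin (x.map embed).reverse)
        (v, Function.update (fun _ => []) kout w) t →
      Nonempty (Turing.TM2OutputsInTime D.tm
        (((w.map decode).reverse).map D.inputAlphabet.symm) (some [D.outputAlphabet.symm b]) m) →
      Nonempty (Turing.TM2OutputsInTime E.tm (x.map E.inputAlphabet.symm)
        (some [E.outputAlphabet.symm b]) (x.length + t + w.length + m + 2)) := by
  have := Fintype.ofFinite K
  have := Fintype.ofFinite σ
  have := Fintype.ofFinite Γ
  have := Fintype.ofFinite (Lab p)
  have := D.tm.kFin
  have := D.tm.ΛFin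
  have := D.tm.σFin
  let tm : Turing.FinTM2 :=
    { K := Option (K ⊕ D.tm.K)
      k₀ := none
      k₁ := some (.inr D.tm.k₁)
      Γ := glueΓ D.tm K Γ
      Λ := Bool ⊕ (Lab p ⊕ D.tm.Λ)
      main := .inl false
      σ := glueσ D.tm Γ σ
      initialState := ((v₀, D.tm.initialState), none)
      Γk₀Fin := inferInstanceAs (Fintype Bool)
      m := glueCode D p kin kout embed decode v₀ }
  refine ⟨⟨tm, Equiv.refl Bool, D.outputAlphabet⟩, ?_⟩
  rintro x w b v t m ⟨t', ht, hr⟩ ⟨⟨⟨n, hn⟩, hnm⟩⟩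
  have h₁ := iterate_load D p kin kout embed decode v₀ D.tm.initialState (fun _ => []) x
    (fun _ => [])
  have h₂ := iterate_code (glueCode D p kin kout embed decode v₀) D.tm.initialState none []
    (fun _ => []) hr (fun l => .inr (.inl l)) (.inl true) fun _ => rfl
  have h₃ := iterate_unload D p kin kout embed decode v₀ v D.tm.initialState w
    (Function.update (fun _ => []) kout w) (fun _ => []) (by simp)
  have h₄ := iterate_liftStmt (glueCode D p kin kout embed decode v₀)
    (fun l => .inr (.inr l)) (fun _ => rfl) v₀ n
    (some (Turing.initList D.tm (((w.map decode).reverse).map D.inputAlphabet.symm)))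
  have hn' : (flip bind (Turing.TM2.step D.tm.m))^[n] (some (Turing.initList D.tm
    (((w.map decode).reverse).map D.inputAlphabet.symm))) =
    some (Turing.haltList D.tm [D.outputAlphabet.symm b]) := hn
  rw [hn'] at h₄
  -- Loading and unloading take one step per symbol and one more to find the stack empty. Each of
  -- them reverses the word, hence the reversals in the statement.
  have hle : (x.length + 1 + t') + (w.length + 1) + n ≤ x.length + t + w.length + m + 2 := by
    dsimp only at hnm
    omega
  refine ⟨⟨⟨(x.length + 1 + t') + (w.length + 1) + n, ?_⟩, hle⟩⟩
  have h₁₂ := iterate_bind_trans (iterate_bind_trans (iterate_bind_trans h₁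
    (by simpa using h₂)) h₃) (c := _) (n := n) (by
      refine Eq.trans ?_ h₄
      congr 2
      simp only [Option.map_some, liftCfg, Turing.initList]
      congr 2
      · simp
      · funext k
        by_cases h : k = D.tm.k₀
        · subst h; simp
        · simp [h])
  refine Eq.trans (Eq.trans ?_ h₁₂) ?_
  · show (flip bind (Turing.TM2.step (glueCode D p kin kout embed decode v₀)))^[_] _ = _
    congr 2
    simp only [Turing.initList, tm]
    congr 1
    funext k
    rcases k with _ | k | k <;> simp [glueStk]
  · refine congrArg some ?_
    refine (Turing.TM2.Cfg.mk.injEq _ _ _ _ _ _).mpr ⟨rfl, rfl, ?_⟩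
    funext k
    rcases k with _ | k | k
    · simp [glueStk, tm]
    · simp [glueStk, tm]
    · by_cases h : k = D.tm.k₁
      · subst h; simp [glueStk, Turing.haltList, tm]
      · simp [glueStk, Turing.haltList, tm, h]

end Glue

end EPNL

/-! ### Polynomial bounds, numbers of tape contents, and tapes as stacks -/

namespace EPNL

/-! ### Polynomially bounded functions -/

/-- `f n` is at most a polynomial in `n`. -/
def PolyBdd (f : ℕ → ℕ) : Prop := ∃ r : Polynomial ℕ, ∀ n, f n ≤ r.eval n

theorem PolyBdd.mono {f g : ℕ → ℕ} (hg : PolyBdd g) (h : ∀ n, f n ≤ g n) : PolyBdd f :=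
  let ⟨r, hr⟩ := hg
  ⟨r, fun n => (h n).trans (hr n)⟩

theorem PolyBdd.eval (p : Polynomial ℕ) : PolyBdd fun n => p.eval n := ⟨p, fun _ => le_rfl⟩

theorem PolyBdd.const (c : ℕ) : PolyBdd fun _ => c := ⟨.C c, fun _ => by simp⟩

theorem PolyBdd.id : PolyBdd fun n => n := ⟨.X, fun _ => by simp⟩

theorem PolyBdd.add {f g : ℕ → ℕ} (hf : PolyBdd f) (hg : PolyBdd g) : PolyBdd fun n => f n + g n :=
  let ⟨r, hr⟩ := hf
  let ⟨s, hs⟩ := hg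
  ⟨r + s, fun n => by simpa using add_le_add (hr n) (hs n)⟩

theorem PolyBdd.mul {f g : ℕ → ℕ} (hf : PolyBdd f) (hg : PolyBdd g) : PolyBdd fun n => f n * g n :=
  let ⟨r, hr⟩ := hf
  let ⟨s, hs⟩ := hg
  ⟨r * s, fun n => by simpa using Nat.mul_le_mul (hr n) (hs n)⟩

theorem PolyBdd.pow {f : ℕ → ℕ} (hf : PolyBdd f) (k : ℕ) : PolyBdd fun n => f n ^ k :=
  let ⟨r, hr⟩ := hf
  ⟨r ^ k, fun n => by simpa using Nat.pow_le_pow_left (hr n) k⟩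

theorem eval_mono (r : Polynomial ℕ) {m n : ℕ} (h : m ≤ n) : r.eval m ≤ r.eval n := by
  rw [Polynomial.eval_eq_sum, Polynomial.eval_eq_sum]
  exact Finset.sum_le_sum fun i _ => Nat.mul_le_mul_left _ (Nat.pow_le_pow_left h i)

theorem PolyBdd.comp (r : Polynomial ℕ) {g : ℕ → ℕ} (hg : PolyBdd g) :
    PolyBdd fun n => r.eval (g n) :=
  let ⟨s, hs⟩ := hg
  ⟨r.comp s, fun n => by simpa using eval_mono r (hs n)⟩

theorem two_pow_logBound_le (n : ℕ) : 2 ^ logBound n ≤ 2 * n + 2 := by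
  rcases Nat.eq_zero_or_pos n with rfl | h
  · simp [logBound]
  · have := Nat.pow_log_le_self 2 h.ne'
    rw [logBound, pow_succ]
    omega

theorem logBound_le (n : ℕ) : logBound n ≤ n + 1 := by
  have := Nat.log_le_self 2 n
  rw [logBound]
  omega

theorem PolyBdd.logBound : PolyBdd EPNL.logBound :=
  (PolyBdd.id.add (.const 1)).mono logBound_le

/-- The reason why logarithmic space, and a logarithmic increase of the parameter, only cost a
polynomial factor. -/
theorem PolyBdd.two_pow_mul_logBound (C : ℕ) : PolyBdd fun n => 2 ^ (C * EPNL.logBound n) := by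
  refine ((((PolyBdd.const 2).mul .id).add (.const 2)).pow C).mono fun n => ?_
  rw [mul_comm, pow_mul]
  exact Nat.pow_le_pow_left (two_pow_logBound_le n) C

/-! ### Counting tape contents -/

/-- A step writes only under the head, which is among the first `s` cells or on a blank tape. If the
tape is still blank after the step there is nothing to show; otherwise `0 < s`, so the old head was
among the first `s` cells in either case. -/
theorem WorkTape.cells_eq_false {T : ℕ → WorkTape} {s : ℕ} (h₀ : T 0 = .blank)
    (hT : ∀ t, T (t + 1) = T t ∨ ∃ b d, T (t + 1) = (T t).act b d)
    (hw : ∀ t, (T t).Within s) (t i : ℕ) (hi : s ≤ i) : (T t).cells i = false := by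
  induction t with
  | zero => rw [h₀]; rfl
  | succ t ih =>
    rcases hw (t + 1) with h | h
    · rcases hT t with h' | ⟨b, d, h'⟩
      · rw [h', ih]
      · have : (T t).head < s := by
          rcases hw t with h'' | h''
          · exact h''
          · rw [h'']
            exact lt_of_le_of_lt (Nat.zero_le _) h
        rw [h']
        simp only [WorkTape.act]
        rw [Function.update_of_ne (by omega), ih]
    · rw [h]; rfl

open Classical in
/-- The tapes with head in one of the first `H` cells and only zeros after the first `s` cells. -/
noncomputable def tapes (H s : ℕ) : Finset WorkTape :=
  (Finset.range H ×ˢ (Finset.univ : Finset (Fin s → Bool))).image fun a =>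
    ⟨a.1, fun i => if h : i < s then a.2 ⟨i, h⟩ else false⟩

open Classical in
theorem card_tapes_le (H s : ℕ) : (tapes H s).card ≤ H * 2 ^ s := by
  refine Finset.card_image_le.trans ?_
  simp

open Classical in
theorem mem_tapes {T : WorkTape} {H s : ℕ} (h : T.head < H)
    (hc : ∀ i, s ≤ i → T.cells i = false) : T ∈ tapes H s := by
  rw [tapes, Finset.mem_image]
  refine ⟨(T.head, fun i => T.cells i), by simp [h], ?_⟩
  cases T with
  | mk hd cells =>
    congr 1
    funext i
    by_cases hi : i < s
    · simp [hi]
    · simpa [hi] using (hc i (by omega)).symm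

theorem WorkTape.Within.head_lt {T : WorkTape} {s : ℕ} (h : T.Within s) : T.head < s + 1 := by
  rcases h with h | h
  · omega
  · rw [h]; exact Nat.succ_pos s

/-! ### Tapes as pairs of stacks -/

/-- The stacks `l`, `r` hold the cells to the left of the head and those from the head on. -/
def WorkTape.Rep (T : WorkTape) (l r : List Bool) : Prop :=
  T.head = l.length ∧ ∀ i, T.cells i = (l.reverse ++ r)[i]?.getD false

theorem WorkTape.Rep.blank : WorkTape.Rep .blank [] [] := ⟨rfl, fun _ => rfl⟩

theorem WorkTape.Rep.read {T : WorkTape} {l r : List Bool} (h : T.Rep l r) :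
    r.head?.getD false = T.read := by
  rw [WorkTape.read, h.2, h.1]
  cases r <;> simp

namespace Move

/-- `o` if the move is to the left, and `none` otherwise. -/
def ifLeft {α : Type} : Move → Option α → Option α
  | .left, o => o
  | _, _ => none

def unlessLeft {α : Type} : Move → Option α → Option α
  | .left, _ => none
  | _, o => o

def ifRight {α : Type} : Move → Option α → Option α
  | .right, o => o
  | _, _ => none

def unlessRight {α : Type} : Move → Option α → Option α
  | .right, _ => none
  | _, o => o

end Move

/-- After the write the tape reads `l.reverse ++ b :: r.tail`, and a move only shifts the boundary
between the two stacks. On a left move from cell `0` the stack `l` is empty, nothing is carried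
over, and the head stays, as it should. -/
theorem WorkTape.Rep.act {T : WorkTape} {l r : List Bool} (h : T.Rep l r) (b : Bool) (d : Move) :
    (T.act b d).Rep
      ((d.ifRight (some b)).toList ++ ((d.unlessLeft l.head?).toList ++ l.tail))
      ((d.ifLeft l.head?).toList ++ ((d.unlessRight (some b)).toList ++ r.tail)) := by
  have key : ∀ i, Function.update T.cells T.head b i =
      (l.reverse ++ b :: r.tail)[i]?.getD false := by
    intro i
    rw [Function.update_apply, h.2, h.1]
    rcases lt_trichotomy i l.length with hi | hi | hi
    · rw [if_neg hi.ne, List.getElem?_append_left (by simpa using hi),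
        List.getElem?_append_left (by simpa using hi)]
    · simp [hi]
    · rw [if_neg hi.ne', List.getElem?_append_right (by simpa using hi.le),
        List.getElem?_append_right (by simpa using hi.le)]
      obtain ⟨j, rfl⟩ := Nat.exists_eq_add_of_lt hi
      have : l.length + j + 1 - l.reverse.length = j + 1 := by simp; omega
      rw [this]
      cases r <;> simp
  cases d with
  | left =>
    cases l with
    | nil => exact ⟨by simp [WorkTape.act, Move.shift, h.1, Move.ifRight, Move.unlessLeft],
        fun i => by simpa [WorkTape.act, Move.ifRight, Move.unlessLeft, Move.ifLeft,
          Move.unlessRight] using key i⟩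
    | cons a l => exact ⟨by simp [WorkTape.act, Move.shift, h.1, Move.ifRight, Move.unlessLeft],
        fun i => by simpa [WorkTape.act, Move.ifRight, Move.unlessLeft, Move.ifLeft,
          Move.unlessRight] using key i⟩
  | stay =>
    have hl : l.head?.toList ++ l.tail = l := by cases l <;> simp
    exact ⟨by simp [WorkTape.act, Move.shift, h.1, Move.ifRight, Move.unlessLeft, hl],
        fun i => by simpa [WorkTape.act, Move.ifRight, Move.unlessLeft, Move.ifLeft,
          Move.unlessRight, hl] using key i⟩
  | right =>
    have hl : l.head?.toList ++ l.tail = l := by cases l <;> simp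
    exact ⟨by simp [WorkTape.act, Move.shift, h.1, Move.ifRight, Move.unlessLeft, hl],
        fun i => by simpa [WorkTape.act, Move.ifRight, Move.unlessLeft, Move.ifLeft,
          Move.unlessRight, hl] using key i⟩

/-- The same stack operations, with the scanned symbol in place of a written one, move a head on a
read-only tape. At the end marker `r` is empty, so a right move carries nothing over; this is the
truncation in `inputShift`. -/
theorem inputShift_rep (l r : List Bool) (d : Move) :
    ((d.ifRight r.head?).toList ++ ((d.unlessLeft l.head?).toList ++ l.tail)).reverse ++
      ((d.ifLeft l.head?).toList ++ ((d.unlessRight r.head?).toList ++ r.tail)) =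
        l.reverse ++ r ∧
    ((d.ifRight r.head?).toList ++ ((d.unlessLeft l.head?).toList ++ l.tail)).length =
      inputShift (l.reverse ++ r) d l.length := by
  cases d <;> cases l <;> cases r <;>
    simp [Move.ifRight, Move.unlessLeft, Move.ifLeft, Move.unlessRight, inputShift, Move.shift]

end EPNL

/-! ### Simulation of logspace transducers and transfer along reductions -/

namespace EPNL

/-! ### Loops over a stack -/

section Loops

variable {K Γ ρ : Type}

/-- Pop the top of the stack `k` into the first component of the memory. -/
def popTo (k : K) : Op K Γ (Option Γ × ρ) := .pop k fun s g => (g, s.2)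

/-- Pop the stack `k` until it is empty, and execute `p` after each pop. -/
def forEach (k : K) (p : Prog K Γ (Option Γ × ρ)) : Prog K Γ (Option Γ × ρ) :=
  .loop [popTo k] (fun s => s.1.isSome) p

def drain (k : K) : Prog K Γ (Option Γ × ρ) := forEach k (.blk [])

/-- Move the content of the stack `k` to the stack `k'`. -/
def transfer (k k' : K) : Prog K Γ (Option Γ × ρ) := forEach k (.blk [.push k' fun s => s.1])

variable [DecidableEq K]

theorem runsIn_drain (k : K) (S : K → List Γ) (c : Option Γ) (r : ρ) :
    RunsIn (drain k) ((c, r), S) ((none, r), Function.update S k []) (2 * (S k).length + 1) := by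
  induction h : S k generalizing S c with
  | nil => exact RunsIn.loop_exit (by simp [evalOps, popTo, Op.eval, h]) rfl
  | cons a l ih =>
    have := ih (Function.update S k l) (some a) (by simp)
    rw [Function.update_idem] at this
    refine (RunsIn.loop_step (s' := ((some a, r), Function.update S k l))
      (by simp [evalOps, popTo, Op.eval, h]) rfl (.blk rfl) this).mono ?_
    simp only [List.length_cons]
    omega

theorem runsIn_transfer {k k' : K} (hk : k ≠ k') (S : K → List Γ) (c : Option Γ) (r : ρ) :
    RunsIn (transfer k k') ((c, r), S)
      ((none, r), Function.update (Function.update S k []) k' ((S k).reverse ++ S k'))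
      (2 * (S k).length + 1) := by
  induction h : S k generalizing S c with
  | nil =>
    refine RunsIn.loop_exit ?_ rfl
    have : Function.update S k [] k' = S k' := Function.update_of_ne hk.symm _ _
    simp [evalOps, popTo, Op.eval, h, ← this]
  | cons a l ih =>
    have := ih (Function.update (Function.update S k l) k' (a :: S k')) (some a)
      (by rw [Function.update_of_ne hk, Function.update_self])
    rw [Function.update_self, Function.update_comm hk.symm, Function.update_idem,
      Function.update_idem] at this
    rw [List.reverse_cons, List.append_assoc, List.singleton_append]
    refine (RunsIn.loop_step (s' := ((some a, r), Function.update S k l))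
      (s₁ := ((some a, r), Function.update (Function.update S k l) k' (a :: S k')))
      (by simp [evalOps, popTo, Op.eval, h]) rfl (.blk ?_) this).mono ?_
    · simp [evalOps, Op.eval, Function.update_of_ne hk.symm]
    · simp only [List.length_cons]
      omega

end Loops

/-! ### Simulation of transducers -/

inductive TransducerStack where
  | il | ir | wl | wr | out
  deriving DecidableEq

instance : Finite TransducerStack :=
  Finite.of_surjective (fun i : Fin 5 => match i with
    | 0 => TransducerStack.il | 1 => .ir | 2 => .wl | 3 => .wr | 4 => .out) (by
      rintro (_ | _ | _ | _ | _)
      exacts [⟨0, rfl⟩, ⟨1, rfl⟩, ⟨2, rfl⟩, ⟨3, rfl⟩, ⟨4, rfl⟩])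

/-- The contents of the stacks in the simulation of a transducer. -/
structure TransducerStacks where
  il : List Bool
  ir : List Bool
  wl : List Bool
  wr : List Bool
  out : List Bool

namespace TransducerStacks

def toFun (s : TransducerStacks) : TransducerStack → List Bool
  | .il => s.il
  | .ir => s.ir
  | .wl => s.wl
  | .wr => s.wr
  | .out => s.out

variable (s : TransducerStacks) (l : List Bool)

@[simp] theorem update_il : Function.update s.toFun .il l = { s with il := l }.toFun := by
  funext k; cases k <;> rfl

@[simp] theorem update_ir : Function.update s.toFun .ir l = { s with ir := l }.toFun := by
  funext k; cases k <;> rfl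

@[simp] theorem update_wl : Function.update s.toFun .wl l = { s with wl := l }.toFun := by
  funext k; cases k <;> rfl

@[simp] theorem update_wr : Function.update s.toFun .wr l = { s with wr := l }.toFun := by
  funext k; cases k <;> rfl

@[simp] theorem update_out : Function.update s.toFun .out l = { s with out := l }.toFun := by
  funext k; cases k <;> rfl

end TransducerStacks

namespace Transducer

variable (T : Transducer)

/-- The memory of the simulation: the state and the symbols popped from `il`, `wl` and `wr`. -/
abbrev Mem : Type := Option Bool × T.Q × Option Bool × Option Bool × Option Bool

/-- The action in the current state on the popped symbols. -/
def memAction (s : T.Mem) : TransducerAction T.Q := T.δ s.2.1 s.1 (s.2.2.2.2.getD false)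

def simStep : List (Op TransducerStack Bool T.Mem) :=
  [ .pop .ir fun s g => (g, s.2),
    .pop .il fun s g => (s.1, s.2.1, g, s.2.2.2),
    .pop .wl fun s g => (s.1, s.2.1, s.2.2.1, g, s.2.2.2.2),
    .pop .wr fun s g => (s.1, s.2.1, s.2.2.1, s.2.2.2.1, g),
    .push .il fun s => (T.memAction s).inMove.unlessLeft s.2.2.1,
    .push .il fun s => (T.memAction s).inMove.ifRight s.1,
    .push .ir fun s => (T.memAction s).inMove.unlessRight s.1,
    .push .ir fun s => (T.memAction s).inMove.ifLeft s.2.2.1,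
    .push .wl fun s => (T.memAction s).workMove.unlessLeft s.2.2.2.1,
    .push .wl fun s => (T.memAction s).workMove.ifRight (some (T.memAction s).write),
    .push .wr fun s => (T.memAction s).workMove.unlessRight (some (T.memAction s).write),
    .push .wr fun s => (T.memAction s).workMove.ifLeft s.2.2.2.1,
    .push .out fun s => (T.memAction s).emit,
    .load fun s => (s.1, (T.memAction s).next, s.2.2) ]

open Classical in
/-- Run the transducer until it halts. -/
noncomputable def simLoop : Prog TransducerStack Bool T.Mem :=
  .loop [] (fun s => decide (s.2.1 ∉ T.halting)) (.blk T.simStep)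

/-- The program that computes the function computed by the transducer, from the reversed input
on the stack `il` to the reversed output on the stack `out`. -/
noncomputable def simProg : Prog TransducerStack Bool T.Mem :=
  .seq (transfer .il .ir) <| .seq T.simLoop <| .seq (drain .il) <| .seq (drain .ir) <|
    .seq (drain .wl) (drain .wr)

/-- The stacks represent the configuration `c` on input `x`. -/
structure Rep (x : List Bool) (c : T.Cfg) (s : TransducerStacks) : Prop where
  inp : s.il.reverse ++ s.ir = x
  inHead : c.inHead = s.il.length
  work : c.work.Rep s.wl s.wr
  out : s.out = c.out.reverse

variable {T}

theorem Rep.step {x : List Bool} {c : T.Cfg} {s : TransducerStacks} (h : T.Rep x c s)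
    (hc : c.state ∉ T.halting) (m : T.Mem) (hm : m.2.1 = c.state) :
    ∃ (m' : T.Mem) (s' : TransducerStacks), evalOps T.simStep (m, s.toFun) = (m', s'.toFun) ∧
      T.Rep x (T.step x c) s' ∧ m'.2.1 = (T.step x c).state ∧
      s'.wl.length + s'.wr.length ≤ s.wl.length + s.wr.length + 1 := by
  obtain ⟨il, ir, wl, wr, out⟩ := s
  obtain ⟨h₁, h₂, h₃, h₄⟩ := h
  simp only at h₁ h₂ h₃ h₄
  have hr : x[c.inHead]? = ir.head? := by
    rw [h₂, ← h₁]
    cases ir <;> simp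
  simp only [simStep, evalOps, Op.eval, TransducerStacks.update_il, TransducerStacks.update_ir,
    TransducerStacks.update_wl, TransducerStacks.update_wr, TransducerStacks.update_out,
    TransducerStacks.toFun, memAction, hm, h₃.read]
  rw [Transducer.step, if_neg hc, hr]
  generalize ha : T.δ c.state ir.head? c.work.read = a
  refine ⟨_, _, rfl, ⟨?_, ?_, ?_, ?_⟩, rfl, ?_⟩
  · rw [← h₁]; exact (inputShift_rep il ir a.inMove).1
  · rw [perform, h₂, ← h₁]; exact (inputShift_rep il ir a.inMove).2.symm
  · exact h₃.act a.write a.workMove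
  · simp only [perform, h₄, List.reverse_append]
    cases a.emit <;> simp
  · cases a.workMove <;> cases wl <;> cases wr <;>
      simp [Move.ifLeft, Move.ifRight, Move.unlessLeft, Move.unlessRight] <;> omega

theorem step_of_mem {x : List Bool} {c : T.Cfg} (h : c.state ∈ T.halting) : T.step x c = c := by
  rw [Transducer.step, if_pos h]

/-- The bound on the size of the working stacks is needed for the time of emptying them afterwards.
-/
theorem runsIn_simLoop (x : List Bool) : ∀ (t : ℕ) (c : T.Cfg) (s : TransducerStacks) (m : T.Mem),
    T.Rep x c s → m.2.1 = c.state → ((T.step x)^[t] c).state ∈ T.halting →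
    ∃ (m' : T.Mem) (s' : TransducerStacks),
      RunsIn T.simLoop (m, s.toFun) (m', s'.toFun) (2 * t + 1) ∧
      T.Rep x ((T.step x)^[t] c) s' ∧
      s'.wl.length + s'.wr.length ≤ s.wl.length + s.wr.length + t := by
  intro t
  induction t with
  | zero =>
    intro c s m h hm hh
    refine ⟨m, s, RunsIn.loop_exit (s' := (m, s.toFun)) rfl ?_, h, le_rfl⟩
    simpa [hm] using hh
  | succ t ih =>
    intro c s m h hm hh
    -- The time `t` need not be the first halting time: a halted configuration is a fixed point, so
    -- the loop may stop early.
    by_cases hc : c.state ∈ T.halting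
    · rw [Function.iterate_fixed (step_of_mem hc)]
      exact ⟨m, s, (RunsIn.loop_exit (s' := (m, s.toFun)) rfl (by simpa [hm] using hc)).mono (by omega), h, by omega⟩
    · obtain ⟨m₁, s₁, he, hr, hm₁, hl⟩ := h.step hc m hm
      obtain ⟨m₂, s₂, hrun, hr₂, hl₂⟩ := ih _ s₁ m₁ hr hm₁ hh
      refine ⟨m₂, s₂, (RunsIn.loop_step (s' := (m, s.toFun)) rfl (by simpa [hm] using hc)
        (.blk he) hrun).mono (by omega), hr₂, by omega⟩

theorem runsIn_simProg (x : List Bool) (t : ℕ) (ht : (T.cfgAt x t).state ∈ T.halting) :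
    ∃ m : T.Mem, RunsIn T.simProg
      ((none, T.start, none, none, none), Function.update (fun _ => []) .il x.reverse)
      (m, Function.update (fun _ => []) .out (T.cfgAt x t).out.reverse)
      (6 * x.length + 4 * t + 6) := by
  have h₀ : (fun _ => [] : TransducerStack → List Bool) = (⟨[], [], [], [], []⟩ :
    TransducerStacks).toFun := by funext k; cases k <;> rfl
  have h₁ := runsIn_transfer (k := TransducerStack.il) (k' := .ir) (by decide)
    (⟨x.reverse, [], [], [], []⟩ : TransducerStacks).toFun none
    ((T.start, none, none, none) : T.Q × Option Bool × Option Bool × Option Bool)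
  obtain ⟨m, ⟨il, ir, wl, wr, out⟩, h₂, hr, hl⟩ := runsIn_simLoop x t T.init ⟨[], x, [], [], []⟩
    (none, T.start, none, none, none) ⟨rfl, rfl, .blank, rfl⟩ rfl ht
  have hx := congrArg List.length hr.inp
  have ho := hr.out
  simp only [List.length_append, List.length_reverse, List.length_nil] at hx hl ho
  subst ho
  rw [h₀]
  simp only [TransducerStacks.update_il, TransducerStacks.update_ir, TransducerStacks.update_out,
    TransducerStacks.toFun, List.reverse_reverse, List.append_nil, List.length_reverse] at h₁ ⊢
  have h₃ := runsIn_drain TransducerStack.il (TransducerStacks.toFun ⟨il, ir, wl, wr, (T.cfgAt x t).out.reverse⟩) m.1 m.2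
  have h₄ := runsIn_drain TransducerStack.ir (TransducerStacks.toFun ⟨[], ir, wl, wr, (T.cfgAt x t).out.reverse⟩) none m.2
  have h₅ := runsIn_drain TransducerStack.wl (TransducerStacks.toFun ⟨[], [], wl, wr, (T.cfgAt x t).out.reverse⟩) none m.2
  have h₆ := runsIn_drain TransducerStack.wr (TransducerStacks.toFun ⟨[], [], [], wr, (T.cfgAt x t).out.reverse⟩) none m.2
  simp only [TransducerStacks.update_il, TransducerStacks.update_ir, TransducerStacks.update_wl,
    TransducerStacks.update_wr, TransducerStacks.toFun] at h₃ h₄ h₅ h₆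
  exact ⟨_, (h₁.seq (h₂.seq (h₃.seq (h₄.seq (h₅.seq h₆))))).mono (by omega)⟩

/-! ### The running time of transducers -/

/-- Before the first time `n` at which `P` holds no value repeats: if the values at `i < j < n`
agreed, then `P` would already hold at time `n - j + i`. So the first `n` values are distinct
elements of `F`. -/
theorem exists_halting_le_card {α : Type} [DecidableEq α] (f : α → α) (a : α) (P : α → Prop)
    (F : Finset α) (hF : ∀ t, f^[t] a ∈ F) (hP : ∃ t, P (f^[t] a)) :
    ∃ t ≤ F.card, P (f^[t] a) := by
  classical
  refine ⟨Nat.find hP, ?_, Nat.find_spec hP⟩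
  have hinj : Set.InjOn (fun t => f^[t] a) (Finset.range (Nat.find hP)) := by
    have key : ∀ i j, i < j → j < Nat.find hP → f^[i] a ≠ f^[j] a := by
      intro i j hij hj h
      refine Nat.find_min hP (m := Nat.find hP - j + i) (by omega) ?_
      rw [Function.iterate_add_apply, h, ← Function.iterate_add_apply, Nat.sub_add_cancel hj.le]
      exact Nat.find_spec hP
    intro i hi j hj h
    simp only [Finset.coe_range, Set.mem_Iio] at hi hj
    rcases lt_trichotomy i j with hij | hij | hij
    · exact absurd h (key i j hij hj)
    · exact hij
    · exact absurd h.symm (key j i hij hi)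
  have := Finset.card_le_card_of_injOn (fun t => f^[t] a) (s := Finset.range (Nat.find hP)) (t := F)
    (fun t _ => hF t) hinj
  simpa using this

/-- A configuration without its output. -/
def core (c : T.Cfg) : T.Q × ℕ × WorkTape := (c.state, c.inHead, c.work)

open Classical in
/-- The step function on configurations without output. -/
noncomputable def coreStep (T : Transducer) (x : List Bool) (c : T.Q × ℕ × WorkTape) :
    T.Q × ℕ × WorkTape :=
  core (T.step x ⟨c.1, c.2.1, c.2.2, []⟩)

/-- The output is never read, so the rest of the configuration evolves on its own. The output has to
be left out of the counting because its length is not bounded by the working space. -/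
theorem core_step (x : List Bool) (c : T.Cfg) : core (T.step x c) = T.coreStep x (core c) := by
  by_cases h : c.state ∈ T.halting
  · simp [coreStep, Transducer.step, core, h]
  · simp [coreStep, Transducer.step, core, h, perform]

theorem core_cfgAt (x : List Bool) (t : ℕ) :
    core (T.cfgAt x t) = (T.coreStep x)^[t] (core T.init) :=
  (Function.Semiconj.iterate_right (core_step x) t) T.init

theorem cfgAt_succ (x : List Bool) (t : ℕ) : T.cfgAt x (t + 1) = T.step x (T.cfgAt x t) :=
  Function.iterate_succ_apply' _ _ _

theorem inHead_le (x : List Bool) (t : ℕ) : (T.cfgAt x t).inHead ≤ x.length := by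
  induction t with
  | zero => exact Nat.zero_le _
  | succ t ih =>
    rw [cfgAt_succ, Transducer.step]
    split_ifs
    · exact ih
    · exact min_le_right _ _

theorem length_out_le (x : List Bool) (t : ℕ) : (T.cfgAt x t).out.length ≤ t := by
  induction t with
  | zero => exact Nat.zero_le _
  | succ t ih =>
    rw [cfgAt_succ, Transducer.step]
    split_ifs
    · omega
    · simp only [perform, List.length_append]
      cases (T.δ (T.cfgAt x t).state x[(T.cfgAt x t).inHead]? (T.cfgAt x t).work.read).emit <;>
        simp <;> omega

theorem exists_halting_le (x : List Bool) (s : ℕ) (hs : ∀ t, (T.cfgAt x t).work.Within s)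
    (hh : ∃ t, (T.cfgAt x t).state ∈ T.halting) :
    ∃ t ≤ Nat.card T.Q * ((x.length + 1) * ((s + 1) * 2 ^ s)),
      (T.cfgAt x t).state ∈ T.halting := by
  classical
  have := T.finite
  have := Fintype.ofFinite T.Q
  have hcells := WorkTape.cells_eq_false (T := fun t => (T.cfgAt x t).work) (s := s) rfl (by
    intro t
    simp only [cfgAt_succ, Transducer.step]
    split_ifs
    · exact Or.inl rfl
    · exact Or.inr ⟨_, _, rfl⟩) hs
  let F : Finset (T.Q × ℕ × WorkTape) :=
    Finset.univ ×ˢ Finset.range (x.length + 1) ×ˢ tapes (s + 1) s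
  obtain ⟨t, ht, hP⟩ := exists_halting_le_card (T.coreStep x) (core T.init)
    (fun c => c.1 ∈ T.halting) F (by
      intro t
      rw [← core_cfgAt]
      simp only [F, Finset.mem_product, Finset.mem_univ, Finset.mem_range, true_and, core]
      exact ⟨Nat.lt_succ_of_le (inHead_le x t), mem_tapes (hs t).head_lt (hcells t)⟩) (by
      obtain ⟨t, ht⟩ := hh
      exact ⟨t, by rw [← core_cfgAt]; exact ht⟩)
  refine ⟨t, ht.trans ?_, by rw [← core_cfgAt] at hP; exact hP⟩
  simp only [F, Finset.card_product, Finset.card_univ, Finset.card_range, Nat.card_eq_fintype_card]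
  exact Nat.mul_le_mul_left _ (Nat.mul_le_mul_left _ (card_tapes_le _ _))

end Transducer

/-- A logspace computable function is computed by a program in polynomial time. -/
theorem LogspaceComputable.exists_prog {φ : List Bool → List Bool} (h : LogspaceComputable φ) :
    ∃ (T : Transducer) (τ : ℕ → ℕ), PolyBdd τ ∧ ∀ x, (φ x).length ≤ τ x.length ∧
      ∃ m : T.Mem, RunsIn T.simProg
        ((none, T.start, none, none, none), Function.update (fun _ => []) .il x.reverse)
        (m, Function.update (fun _ => []) .out (φ x).reverse) (τ x.length) := by
  obtain ⟨T, hT, C, hC⟩ := h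
  let t₀ : ℕ → ℕ := fun n =>
    Nat.card T.Q * ((n + 1) * ((C * logBound n + 1) * 2 ^ (C * logBound n)))
  have ht₀ : PolyBdd t₀ := (PolyBdd.const _).mul ((PolyBdd.id.add (.const 1)).mul
    ((((PolyBdd.const C).mul .logBound).add (.const 1)).mul (.two_pow_mul_logBound C)))
  refine ⟨T, fun n => 6 * n + 4 * t₀ n + 6,
    (((PolyBdd.const 6).mul .id).add ((PolyBdd.const 4).mul ht₀)).add (.const 6), fun x => ?_⟩
  obtain ⟨t₁, h₁, hout⟩ := hT x
  obtain ⟨t, ht, hh⟩ := Transducer.exists_halting_le x (C * logBound x.length) (hC x) ⟨t₁, h₁⟩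
  have hφ : (T.cfgAt x t).out = φ x := by
    rw [← hout]
    -- The halting time found by counting may differ from the one at which the output is known to be
    -- `φ x`; after halting nothing changes, so the outputs agree.
    have key : ∀ i j, (T.cfgAt x i).state ∈ T.halting → T.cfgAt x (i + j) = T.cfgAt x i := by
      intro i j hi
      rw [Transducer.cfgAt, add_comm, Function.iterate_add_apply]
      exact Function.iterate_fixed (Transducer.step_of_mem hi) j
    rcases le_total t t₁ with h | h
    · obtain ⟨j, rfl⟩ := Nat.exists_eq_add_of_le h
      rw [key t j hh]
    · obtain ⟨j, rfl⟩ := Nat.exists_eq_add_of_le h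
      rw [key t₁ j h₁]
  obtain ⟨m, hm⟩ := Transducer.runsIn_simProg x t hh
  rw [hφ] at hm
  have hlen := Transducer.length_out_le x t (T := T)
  rw [hφ] at hlen
  change t ≤ t₀ x.length at ht
  have hle : 6 * x.length + 4 * t + 6 ≤ 6 * x.length + 4 * t₀ x.length + 6 := by omega
  exact ⟨le_trans (by omega) hle, m, hm.mono hle⟩

/-- The machine computes `φ x` and runs the solver of `B` on it. The additive logarithmic term in
the parameter becomes a polynomial factor, and the solver's polynomial is evaluated at the
polynomial length of `φ x`. -/
theorem SolvableInOStar.of_reducible {A B : ParamProblem} {c : ℝ} (hc : 1 ≤ c)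
    (hAB : Reducible A B) (hB : SolvableInOStar B c) : SolvableInOStar A c := by
  classical
  obtain ⟨φ, hφ, hL, C, hκ⟩ := hAB
  obtain ⟨D, r, hD⟩ := hB
  obtain ⟨T, τ, hτ, hT⟩ := hφ.exists_prog
  have := T.finite
  obtain ⟨E, hE⟩ := exists_glue D T.simProg .il .out id id (none, T.start, none, none, none)
  -- With `c < 2 ^ j`, the factor `c ^ (C * logBound n)` is at most `2 ^ (j * C * logBound n)`,
  -- which is polynomial.
  obtain ⟨j, hj⟩ := pow_unbounded_of_one_lt c (one_lt_two (α := ℝ))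
  obtain ⟨rτ, hrτ⟩ := hτ
  obtain ⟨R, hR⟩ : PolyBdd fun n =>
      n + rτ.eval n + rτ.eval n + 2 ^ (j * C * logBound n) * r.eval (rτ.eval n) + 2 :=
    (((PolyBdd.id.add (.eval rτ)).add (.eval rτ)).add
      ((PolyBdd.two_pow_mul_logBound (j * C)).mul (.comp r (.eval rτ)))).add (.const 2)
  refine ⟨E, R, fun x => ?_⟩
  obtain ⟨hlen, mm, hrun⟩ := hT x
  obtain ⟨m, hm, hDm⟩ := hD (φ x)
  have hdec : decide (φ x ∈ B.L) = decide (x ∈ A.L) := by simp only [hL x]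
  rw [hdec] at hDm
  refine ⟨x.length + τ x.length + (φ x).reverse.length + m + 2, ?_,
    hE x (φ x).reverse (decide (x ∈ A.L)) mm (τ x.length) m (by simpa using hrun)
      (by simpa using hDm)⟩
  have hck : (1 : ℝ) ≤ c ^ A.κ x := one_le_pow₀ hc
  have h₁ : (m : ℝ) ≤ c ^ A.κ x *
      ((2 ^ (j * C * logBound x.length) * r.eval (rτ.eval x.length) : ℕ) : ℝ) := by
    refine hm.trans ?_
    have e₁ : c ^ B.κ (φ x) ≤ c ^ A.κ x * 2 ^ (j * C * logBound x.length) := by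
      calc c ^ B.κ (φ x) ≤ c ^ (A.κ x + C * logBound x.length) := pow_le_pow_right₀ hc (hκ x)
        _ = c ^ A.κ x * c ^ (C * logBound x.length) := pow_add _ _ _
        _ ≤ c ^ A.κ x * (2 ^ j) ^ (C * logBound x.length) := by gcongr
        _ = c ^ A.κ x * 2 ^ (j * C * logBound x.length) := by rw [← pow_mul, mul_assoc]
    have e₂ : r.eval (φ x).length ≤ r.eval (rτ.eval x.length) :=
      eval_mono r (hlen.trans (hrτ _))
    push_cast
    rw [← mul_assoc]
    gcongr
  -- Since `1 ≤ c ^ A.κ x`, the time of the reduction itself is absorbed into the product.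
  have h₂ : ((x.length + rτ.eval x.length + rτ.eval x.length + 2 : ℕ) : ℝ) ≤ c ^ A.κ x *
      ((x.length + rτ.eval x.length + rτ.eval x.length + 2 : ℕ) : ℝ) :=
    le_mul_of_one_le_left (Nat.cast_nonneg _) hck
  have h₃ : ((x.length + τ x.length + (φ x).reverse.length + m + 2 : ℕ) : ℝ) ≤
      ((x.length + rτ.eval x.length + rτ.eval x.length + 2 : ℕ) : ℝ) + m := by
    have := hrτ x.length
    rw [List.length_reverse]
    norm_cast
    omega
  have h₄ : c ^ A.κ x * ((x.length + rτ.eval x.length + rτ.eval x.length +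
      2 ^ (j * C * logBound x.length) * r.eval (rτ.eval x.length) + 2 : ℕ) : ℝ) ≤
      c ^ A.κ x * ((R.eval x.length : ℕ) : ℝ) := by
    gcongr
    exact hR x.length
  refine h₃.trans ((add_le_add h₂ h₁).trans (le_trans (le_of_eq ?_) h₄))
  push_cast
  ring

end EPNL

/-! ### Stack programs on lists of records: loops and distribution -/

namespace EPNL

/-! ### Programs that work on lists of records -/

/-- Symbols on the stacks: separators, bits and the letters of records. -/
inductive Sym (G : Type) where
  | sep
  | bit (b : Bool)
  | tok (g : G)

namespace Sym

variable {G : Type}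

instance : Inhabited (Sym G) := ⟨sep⟩

instance [Finite G] : Finite (Sym G) :=
  Finite.of_surjective (fun i : Option (Bool ⊕ G) => match i with
    | none => sep | some (.inl b) => bit b | some (.inr g) => tok g) (by
      rintro (_ | b | g)
      exacts [⟨none, rfl⟩, ⟨some (.inl b), rfl⟩, ⟨some (.inr g), rfl⟩])

def asTok : Option (Sym G) → Option G
  | some (tok g) => some g
  | _ => none

def asBit : Option (Sym G) → Option Bool
  | some (bit b) => some b
  | _ => none

@[simp] theorem asTok_tok (g : G) : asTok (some (tok g)) = some g := rfl

@[simp] theorem asTok_sep : asTok (some (sep : Sym G)) = none := rfl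

end Sym

/-- The data of a machine that transforms records (words over `G`) by one pass from left to right
that collects information, a pass from right to left, and a pass from left to right. -/
structure Scanner where
  G : Type
  A : Type
  finiteG : Finite G
  finiteA : Finite A
  /-- the information at the start of the first pass -/
  acc : A
  collect : A → G → A
  /-- the second pass; the second argument is the next letter of the record -/
  back : A → Option G → G → G
  /-- the third pass; the third argument is the previous letter of the result of the second pass -/
  forth : A → Bool → Option G → G → G
  /-- the letters of the initial records -/
  ini : Bool → Bool → Option Bool → Bool → G
  good : G → Bool

inductive ScannerStack where
  | inp | tmp | cert | cnt | cnt' | rounds | a | b₀ | b₁ | t | u | prev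
  deriving DecidableEq

instance : Finite ScannerStack :=
  Finite.of_surjective (fun i : Fin 12 => match i with
    | 0 => ScannerStack.inp | 1 => .tmp | 2 => .cert | 3 => .cnt | 4 => .cnt' | 5 => .rounds
    | 6 => .a | 7 => .b₀ | 8 => .b₁ | 9 => .t | 10 => .u | 11 => .prev) (by
      rintro (_ | _ | _ | _ | _ | _ | _ | _ | _ | _ | _ | _)
      exacts [⟨0, rfl⟩, ⟨1, rfl⟩, ⟨2, rfl⟩, ⟨3, rfl⟩, ⟨4, rfl⟩, ⟨5, rfl⟩, ⟨6, rfl⟩, ⟨7, rfl⟩,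
        ⟨8, rfl⟩, ⟨9, rfl⟩, ⟨10, rfl⟩, ⟨11, rfl⟩])

structure ScannerStacks (Γ : Type) where
  inp : List Γ := []
  tmp : List Γ := []
  cert : List Γ := []
  cnt : List Γ := []
  cnt' : List Γ := []
  rounds : List Γ := []
  a : List Γ := []
  b₀ : List Γ := []
  b₁ : List Γ := []
  t : List Γ := []
  u : List Γ := []
  prev : List Γ := []

namespace ScannerStacks

variable {Γ : Type}

def toFun (s : ScannerStacks Γ) : ScannerStack → List Γ
  | .inp => s.inp
  | .tmp => s.tmp
  | .cert => s.cert
  | .cnt => s.cnt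
  | .cnt' => s.cnt'
  | .rounds => s.rounds
  | .a => s.a
  | .b₀ => s.b₀
  | .b₁ => s.b₁
  | .t => s.t
  | .u => s.u
  | .prev => s.prev

variable (s : ScannerStacks Γ) (l : List Γ)

@[simp] theorem update_inp : Function.update s.toFun .inp l = { s with inp := l }.toFun := by
  funext k; cases k <;> rfl

@[simp] theorem update_tmp : Function.update s.toFun .tmp l = { s with tmp := l }.toFun := by
  funext k; cases k <;> rfl

@[simp] theorem update_cert : Function.update s.toFun .cert l = { s with cert := l }.toFun := by
  funext k; cases k <;> rfl

@[simp] theorem update_cnt : Function.update s.toFun .cnt l = { s with cnt := l }.toFun := by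
  funext k; cases k <;> rfl

@[simp] theorem update_cnt' : Function.update s.toFun .cnt' l = { s with cnt' := l }.toFun := by
  funext k; cases k <;> rfl

@[simp] theorem update_rounds :
    Function.update s.toFun .rounds l = { s with rounds := l }.toFun := by
  funext k; cases k <;> rfl

@[simp] theorem update_a : Function.update s.toFun .a l = { s with a := l }.toFun := by
  funext k; cases k <;> rfl

@[simp] theorem update_b₀ : Function.update s.toFun .b₀ l = { s with b₀ := l }.toFun := by
  funext k; cases k <;> rfl

@[simp] theorem update_b₁ : Function.update s.toFun .b₁ l = { s with b₁ := l }.toFun := by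
  funext k; cases k <;> rfl

@[simp] theorem update_t : Function.update s.toFun .t l = { s with t := l }.toFun := by
  funext k; cases k <;> rfl

@[simp] theorem update_u : Function.update s.toFun .u l = { s with u := l }.toFun := by
  funext k; cases k <;> rfl

@[simp] theorem update_prev : Function.update s.toFun .prev l = { s with prev := l }.toFun := by
  funext k; cases k <;> rfl

end ScannerStacks

/-- The memory of the programs of a scanner, apart from the last popped symbol. -/
structure ScannerMem (S : Scanner) where
  acc : S.A
  prev : Option S.G
  flag : Bool
  c₁ : Option (Sym S.G)
  c₂ : Option (Sym S.G)

instance (S : Scanner) : Finite (ScannerMem S) :=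
  have := S.finiteG
  have := S.finiteA
  Finite.of_injective (fun m : ScannerMem S => (m.acc, m.prev, m.flag, m.c₁, m.c₂)) (by
    rintro ⟨⟩ ⟨⟩ h
    simp only [Prod.mk.injEq] at h
    obtain ⟨rfl, rfl, rfl, rfl, rfl⟩ := h
    rfl)

namespace Scanner

variable (S : Scanner)

abbrev P : Type := Prog ScannerStack (Sym S.G) (Option (Sym S.G) × ScannerMem S)

abbrev O : Type := Op ScannerStack (Sym S.G) (Option (Sym S.G) × ScannerMem S)

variable {S}

/-- Whatever the memory is, `p` transforms the stacks `s` into `s'` in at most `T` steps. -/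
def Does (p : S.P) (s s' : ScannerStack → List (Sym S.G)) (T : ℕ) : Prop :=
  ∀ m, ∃ m', RunsIn p (m, s) (m', s') T

theorem Does.mono {p : S.P} {s s' : ScannerStack → List (Sym S.G)} {T T' : ℕ}
    (h : S.Does p s s' T) (hT : T ≤ T') : S.Does p s s' T' := fun m =>
  let ⟨m', h'⟩ := h m
  ⟨m', h'.mono hT⟩

theorem Does.seq {p q : S.P} {s s₁ s₂ : ScannerStack → List (Sym S.G)} {T₁ T₂ : ℕ}
    (h₁ : S.Does p s s₁ T₁) (h₂ : S.Does q s₁ s₂ T₂) : S.Does (.seq p q) s s₂ (T₁ + T₂) := fun m =>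
  let ⟨m₁, hm₁⟩ := h₁ m
  let ⟨m₂, hm₂⟩ := h₂ m₁
  ⟨m₂, hm₁.seq hm₂⟩

theorem does_drain (k : ScannerStack) (s : ScannerStack → List (Sym S.G)) :
    S.Does (drain k) s (Function.update s k []) (2 * (s k).length + 1) := fun m =>
  ⟨_, runsIn_drain k s m.1 m.2⟩

theorem does_transfer {k k' : ScannerStack} (hk : k ≠ k') (s : ScannerStack → List (Sym S.G)) :
    S.Does (transfer k k') s (Function.update (Function.update s k []) k' ((s k).reverse ++ s k'))
      (2 * (s k).length + 1) := fun m =>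
  ⟨_, runsIn_transfer hk s m.1 m.2⟩

/-- A loop controlled by a unary counter. -/
theorem does_forEach {k : ScannerStack} {p : S.P} {T : ℕ} : ∀ (N : ℕ) (c : Sym S.G)
    (st : ℕ → ScannerStack → List (Sym S.G)),
    (∀ i ≤ N, st i k = List.replicate (N - i) c) →
    (∀ i < N, S.Does p (Function.update (st i) k (List.replicate (N - i - 1) c)) (st (i + 1)) T) →
    S.Does (forEach k p) (st 0) (st N) (N * (T + 1) + 1)
  | 0, c, st, hk, _ => fun m => by
    refine ⟨_, (RunsIn.loop_exit (s' := ((none, m.2), st 0)) ?_ rfl).mono (by omega)⟩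
    have h := hk 0 le_rfl
    have h' : Function.update (st 0) k [] = st 0 := by
      rw [Function.update_eq_self_iff, h]
      simp
    simp [evalOps, popTo, Op.eval, h, h']
  | N + 1, c, st, hk, hp => fun m => by
    obtain ⟨m₁, h₁⟩ := hp 0 (Nat.succ_pos N) (some c, m.2)
    obtain ⟨m₂, h₂⟩ := does_forEach N c (fun i => st (i + 1))
      (fun i hi => by rw [hk (i + 1) (by omega)]; congr 1; omega)
      (fun i hi => by
        have := hp (i + 1) (by omega)
        rwa [show N + 1 - (i + 1) - 1 = N - i - 1 by omega] at this) m₁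
    refine ⟨m₂, (RunsIn.loop_step ?_ rfl h₁ h₂).mono ?_⟩
    · have h := hk 0 (Nat.zero_le _)
      simp [evalOps, popTo, Op.eval, h, List.replicate_succ]
    · rw [Nat.succ_mul]
      omega

theorem _root_.EPNL.RunsIn.cast {p : S.P} {s s' s'' : (Option (Sym S.G) × ScannerMem S) ×
    (ScannerStack → List (Sym S.G))} {T : ℕ} (h : RunsIn p s s' T) (e : s' = s'') :
    RunsIn p s s'' T := e ▸ h

theorem Does.cast {p : S.P} {s s' s'' : ScannerStack → List (Sym S.G)} {T : ℕ}
    (h : S.Does p s s' T) (e : s' = s'') : S.Does p s s'' T := e ▸ h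

/-! #### Encoding of lists of records -/

def enc (r : List S.G) : List (Sym S.G) := r.map Sym.tok ++ [Sym.sep]

def encList (L : List (List S.G)) : List (Sym S.G) := L.flatMap enc

@[simp] theorem encList_nil : encList ([] : List (List S.G)) = [] := rfl

@[simp] theorem encList_cons (r : List S.G) (L : List (List S.G)) :
    encList (r :: L) = r.map Sym.tok ++ Sym.sep :: encList L := by
  simp [encList, enc]

theorem encList_append (L L' : List (List S.G)) :
    encList (L ++ L') = encList L ++ encList L' := by
  simp [encList]

theorem length_encList {W : ℕ} : ∀ {L : List (List S.G)}, (∀ r ∈ L, r.length = W) →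
    (encList L).length = L.length * (W + 1)
  | [], _ => by simp
  | r :: L, h => by
    have ih := length_encList (L := L) (W := W) fun r hr => h r (List.mem_cons_of_mem _ hr)
    simp only [encList_cons, List.length_append, List.length_map, List.length_cons, ih,
      h r List.mem_cons_self]
    ring

/-- A loop over the records on the stack `a`. -/
def forRecords (p : S.P) : S.P :=
  .loop [popTo .a, .push .a fun s => s.1] (fun s => s.1.isSome) p

theorem runsIn_forRecords_nil (p : S.P) (s : ScannerStacks (Sym S.G)) (h : s.a = [])
    (m : Option (Sym S.G) × ScannerMem S) :
    RunsIn (forRecords p) (m, s.toFun) ((none, m.2), s.toFun) 1 := by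
  refine RunsIn.loop_exit ?_ rfl
  cases s
  subst h
  simp [evalOps, popTo, Op.eval, ScannerStacks.toFun]

theorem evalOps_peek (s : ScannerStacks (Sym S.G)) (c : Sym S.G) (l : List (Sym S.G))
    (h : s.a = c :: l) (m : Option (Sym S.G) × ScannerMem S) :
    evalOps [popTo .a, .push .a fun s => s.1] (m, s.toFun) = ((some c, m.2), s.toFun) := by
  cases s
  subst h
  simp [evalOps, popTo, Op.eval, ScannerStacks.toFun]

theorem runsIn_forRecords_cons {p : S.P} {s s₁ : ScannerStacks (Sym S.G)}
    {s₂ : ScannerStack → List (Sym S.G)} (r : List S.G)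
    (l : List (Sym S.G)) (h : s.a = r.map Sym.tok ++ Sym.sep :: l)
    {m : Option (Sym S.G) × ScannerMem S} {T₁ T₂ : ℕ}
    (h₁ : S.Does p s.toFun s₁.toFun T₁) (h₂ : S.Does (forRecords p) s₁.toFun s₂ T₂) :
    ∃ m₂, RunsIn (forRecords p) (m, s.toFun) (m₂, s₂) (1 + T₁ + T₂) := by
  obtain ⟨c, l', hc⟩ : ∃ c l', s.a = c :: l' := by
    rw [h]
    cases r <;> simp
  obtain ⟨m₁, hm₁⟩ := h₁ (some c, m.2)
  obtain ⟨m₂, hm₂⟩ := h₂ m₁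
  exact ⟨m₂, .loop_step (evalOps_peek s c l' hc m) rfl hm₁ hm₂⟩

/-! #### Distribution of the records to two stacks -/

variable (S) in
open Classical in
/-- Push the symbol `f s` to `b₁` if the remembered letter is `g`, and to `b₀` otherwise. -/
noncomputable def pushSel (g : S.G)
    (f : Option (Sym S.G) × ScannerMem S → Option (Sym S.G)) : List S.O :=
  [ .push .b₀ fun s => if s.2.c₁ = some (Sym.tok g) then none else f s,
    .push .b₁ fun s => if s.2.c₁ = some (Sym.tok g) then f s else none ]

noncomputable def distributeInner (g : S.G) : S.P :=
  .loop [popTo .a] (fun s => (Sym.asTok s.1).isSome) (.blk (S.pushSel g fun s => s.1))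

/-- Move the first record from `a` to `b₁` or `b₀`, according to whether the first letter is `g` or not;
the first letter is moved to the end. -/
noncomputable def distributeRecord (g : S.G) : S.P :=
  .seq (.blk [.pop .a fun s c => (s.1, { s.2 with c₁ := c })]) <|
    .seq (distributeInner g) (.blk (S.pushSel g (fun s => s.2.c₁) ++
      S.pushSel g (fun _ => some Sym.sep)))

/-- Distribute all records on `a`. -/
noncomputable def distribute (g : S.G) : S.P := forRecords (distributeRecord g)

open Classical in
theorem runsIn_distributeInner (g : S.G) (rest : List (Sym S.G)) :
    ∀ (r : List S.G) (s : ScannerStacks (Sym S.G)) (c : Option (Sym S.G)) (m : ScannerMem S),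
      s.a = r.map Sym.tok ++ Sym.sep :: rest →
      RunsIn (distributeInner g) ((c, m), s.toFun) ((some Sym.sep, m),
        { s with
          a := rest
          b₀ := if m.c₁ = some (Sym.tok g) then s.b₀ else (r.map Sym.tok).reverse ++ s.b₀
          b₁ := if m.c₁ = some (Sym.tok g) then (r.map Sym.tok).reverse ++ s.b₁ else s.b₁ }.toFun)
        (2 * r.length + 1)
  | [], s, c, m, h => by
    refine RunsIn.loop_exit ?_ rfl
    cases s
    subst h
    simp [evalOps, popTo, Op.eval, ScannerStacks.toFun]
  | h :: r, s, c, m, hs => by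
    have ih := runsIn_distributeInner g rest r
      { s with
        a := r.map Sym.tok ++ Sym.sep :: rest
        b₀ := if m.c₁ = some (Sym.tok g) then s.b₀ else Sym.tok h :: s.b₀
        b₁ := if m.c₁ = some (Sym.tok g) then Sym.tok h :: s.b₁ else s.b₁ } (some (Sym.tok h)) m rfl
    refine (RunsIn.loop_step (s' := ((some (Sym.tok h), m),
      { s with a := r.map Sym.tok ++ Sym.sep :: rest }.toFun)) ?_ rfl (.blk ?_) (ih.cast ?_)).mono ?_
    · cases s
      subst hs
      simp [evalOps, popTo, Op.eval, ScannerStacks.toFun]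
    · by_cases hc : m.c₁ = some (Sym.tok g) <;>
        simp [evalOps, pushSel, Op.eval, ScannerStacks.toFun, hc]
    · by_cases hc : m.c₁ = some (Sym.tok g) <;> simp [hc]
    · simp only [List.length_cons]; omega

open Classical in
-- Popping letters from `a` and pushing them reverses the order of everything, so each target stack
-- holds a reversed encoding. The first letter waits in memory and is pushed last, which rotates the
-- record.
theorem does_distribute (g : S.G) : ∀ (L : List (List S.G)) (s : ScannerStacks (Sym S.G)),
    (∀ r ∈ L, r ≠ []) → s.a = encList L →
    S.Does (distribute g) s.toFun
      { s with
        a := []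
        b₀ := (encList ((L.filter fun r : List S.G => r.head? ≠ some g).map fun r : List S.G => r.rotate 1)).reverse ++ s.b₀
        b₁ := (encList ((L.filter fun r : List S.G => r.head? = some g).map fun r : List S.G => r.rotate 1)).reverse ++
          s.b₁ }.toFun (4 * (encList L).length + 1)
  | [], s, _, h => fun m => ⟨(none, m.2),
    ((runsIn_forRecords_nil (distributeRecord g) s h m).mono (by simp)).cast (by
      obtain ⟨⟩ := s
      simp only [encList_nil] at h
      subst h
      simp)⟩
  | [] :: L, s, hL, h => absurd rfl (hL [] List.mem_cons_self)
  | (h :: r) :: L, s, hL, hs => fun m => by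
    let s₁ : ScannerStacks (Sym S.G) :=
      { s with
        a := encList L
        b₀ := if h = g then s.b₀ else Sym.sep :: Sym.tok h :: ((r.map Sym.tok).reverse ++ s.b₀)
        b₁ := if h = g then Sym.sep :: Sym.tok h :: ((r.map Sym.tok).reverse ++ s.b₁) else s.b₁ }
    have ih := does_distribute g L s₁ (fun r hr => hL r (List.mem_cons_of_mem _ hr)) rfl
    have hbody : S.Does (distributeRecord g) s.toFun s₁.toFun (1 + (2 * r.length + 1 + 1)) := by
      intro m
      refine ⟨(some .sep, { m.2 with c₁ := some (.tok h) }), RunsIn.seq (.blk (s' := ((m.1, { m.2 with c₁ := some (Sym.tok h) }),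
        { s with a := r.map Sym.tok ++ Sym.sep :: encList L }.toFun)) ?_) (RunsIn.seq
        (runsIn_distributeInner g (encList L) r _ _ _ rfl) (.blk ?_))⟩
      · cases s
        subst hs
        simp [evalOps, Op.eval, ScannerStacks.toFun]
      · by_cases hg : h = g <;> simp [evalOps, pushSel, Op.eval, ScannerStacks.toFun, s₁, hg]
    obtain ⟨m₂, h₂⟩ := runsIn_forRecords_cons (m := m) (h :: r) (encList L) (by simpa using hs)
      hbody ih
    refine ⟨m₂, (h₂.cast ?_).mono ?_⟩
    · by_cases hg : h = g <;> simp [s₁, hg]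
    · simp only [encList_cons, List.length_append, List.length_map, List.length_cons]
      omega

/-- Move the records from `b₀` and `b₁` to `a`. -/
def gather : S.P := .seq (transfer .b₁ .a) (transfer .b₀ .a)

/-- The transfer undoes the reversal, so the order within each class is kept. As `b₁` is moved
first, the records of `b₀` come to lie in front. -/
theorem does_gather (s : ScannerStacks (Sym S.G)) :
    S.Does gather s.toFun { s with a := s.b₀.reverse ++ (s.b₁.reverse ++ s.a), b₀ := [], b₁ := [] }.toFun
      (2 * (s.b₀.length + s.b₁.length) + 2) := by
  have h₁ := does_transfer (S := S) (k := .b₁) (k' := .a) (by decide) s.toFun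
  simp only [ScannerStacks.update_b₁, ScannerStacks.update_a, ScannerStacks.toFun] at h₁
  have h₂ := does_transfer (S := S) (k := .b₀) (k' := .a) (by decide)
    { s with b₁ := [], a := s.b₁.reverse ++ s.a }.toFun
  simp only [ScannerStacks.update_b₀, ScannerStacks.update_a, ScannerStacks.toFun] at h₂
  exact (h₁.seq h₂).mono (by omega)

end Scanner

end EPNL

/-! ### Rewriting of records in three passes, and radix sort -/

namespace EPNL

/-- Map a function over a list that also depends on the previous element. -/
def mapPrev {α β : Type} (f : Option α → α → β) : Option α → List α → List β
  | _, [] => []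
  | o, a :: l => f o a :: mapPrev f (some a) l

@[simp] theorem length_mapPrev {α β : Type} (f : Option α → α → β) (o : Option α) (l : List α) :
    (mapPrev f o l).length = l.length := by
  induction l generalizing o with
  | nil => rfl
  | cons a l ih => simp [mapPrev, ih]

open Classical in
/-- Delete the elements that equal their predecessor. -/
noncomputable def dropRepeated {α : Type} : α → List α → List α
  | _, [] => []
  | a, b :: l => if b = a then dropRepeated b l else b :: dropRepeated b l

namespace Scanner

variable {S : Scanner}

/-- The information that the first pass collects. -/
def info (S : Scanner) (r : List S.G) : S.A := r.foldl S.collect S.acc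

/-- The result of the second pass. -/
def middle (S : Scanner) (r : List S.G) : List S.G :=
  (mapPrev (S.back (S.info r)) none r.reverse).reverse

/-- The result of the third pass. -/
def image (S : Scanner) (b : Bool) (r : List S.G) : List S.G :=
  mapPrev (S.forth (S.info r) b) none (S.middle r)

@[simp] theorem length_image (b : Bool) (r : List S.G) : (S.image b r).length = r.length := by
  simp [image, middle]

open Classical in
/-- Collect information on the first record on `a`, move it to `t` and compare it with `prev`. -/
noncomputable def firstPass : S.P :=
  .loop [popTo .a, .pop .prev fun s c => (s.1, { s.2 with c₂ := c })]
    (fun s => (Sym.asTok s.1).isSome)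
    (.blk [.push .t fun s => s.1, .load fun s => (s.1, { s.2 with
      acc := (Sym.asTok s.1).elim s.2.acc (S.collect s.2.acc)
      flag := s.2.flag && decide (s.1 = s.2.c₂) })])

open Classical in
-- The record and `prev` are popped in parallel. As `prev` is not longer, it is exhausted when the
-- separator appears, and a shorter `prev` shows up as a mismatch with `none`.
theorem runsIn_firstPass (rest : List (Sym S.G)) :
    ∀ (r q : List S.G) (s : ScannerStacks (Sym S.G)) (c : Option (Sym S.G)) (m : ScannerMem S),
      q.length ≤ r.length → s.a = r.map Sym.tok ++ Sym.sep :: rest → s.prev = q.map Sym.tok →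
      RunsIn firstPass ((c, m), s.toFun) ((some Sym.sep,
        { m with acc := r.foldl S.collect m.acc, flag := m.flag && decide (r = q), c₂ := none }),
        { s with a := rest, prev := [], t := (r.map Sym.tok).reverse ++ s.t }.toFun)
        (2 * r.length + 1)
  | [], q, s, c, m, hq, ha, hp => by
    obtain rfl : q = [] := List.length_eq_zero_iff.mp (Nat.le_zero.mp hq)
    refine RunsIn.loop_exit ?_ rfl
    obtain ⟨⟩ := s
    subst ha hp
    simp [evalOps, popTo, Op.eval, ScannerStacks.toFun]
  | g :: r, q, s, c, m, hq, ha, hp => by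
    have ih := runsIn_firstPass rest r q.tail
      { s with a := r.map Sym.tok ++ Sym.sep :: rest, prev := q.tail.map Sym.tok,
               t := Sym.tok g :: s.t } (some (Sym.tok g))
      { m with acc := S.collect m.acc g, flag := m.flag && decide (some g = q.head?),
               c₂ := q.head?.map Sym.tok } (by simp at hq ⊢; omega) rfl rfl
    refine (RunsIn.loop_step (s' := ((some (Sym.tok g), { m with c₂ := q.head?.map Sym.tok }),
      { s with a := r.map Sym.tok ++ Sym.sep :: rest, prev := q.tail.map Sym.tok }.toFun)) ?_ rfl
      (.blk ?_) (ih.cast ?_)).mono ?_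
    · obtain ⟨⟩ := s
      subst ha hp
      cases q <;> simp [evalOps, popTo, Op.eval, ScannerStacks.toFun]
    · cases q <;> simp [evalOps, Op.eval, ScannerStacks.toFun]
    · cases q with
      | nil => simp
      | cons h q =>
        by_cases hg : g = h
        · simp [hg]
          congr!
        · simp [hg]
    · simp only [List.length_cons]
      omega

/-- Carry out the second pass on the record on `t`; a copy of the record is left on `prev`. -/
def secondPass : S.P :=
  forEach .t (.blk [.push .prev fun s => s.1,
    .push .u fun s => (Sym.asTok s.1).map fun g => Sym.tok (S.back s.2.acc s.2.prev g),
    .load fun s => (s.1, { s.2 with prev := Sym.asTok s.1 })])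

/-- The record on `t` is reversed, so popping it goes from right to left, and the letter popped
before is the next letter of the record. Both `prev` and `u` receive words in the original order. -/
theorem runsIn_secondPass : ∀ (l : List S.G) (s : ScannerStacks (Sym S.G))
    (c : Option (Sym S.G)) (m : ScannerMem S), s.t = l.map Sym.tok →
    ∃ o, RunsIn secondPass ((c, m), s.toFun) ((none, { m with prev := o }),
      { s with t := [], prev := (l.map Sym.tok).reverse ++ s.prev,
               u := ((mapPrev (S.back m.acc) m.prev l).map Sym.tok).reverse ++ s.u }.toFun)
      (2 * l.length + 1)
  | [], s, c, m, ht => by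
    refine ⟨m.prev, RunsIn.loop_exit ?_ rfl⟩
    obtain ⟨⟩ := s
    subst ht
    simp [evalOps, popTo, Op.eval, ScannerStacks.toFun, mapPrev]
  | g :: l, s, c, m, ht => by
    obtain ⟨o, ih⟩ := runsIn_secondPass l
      { s with t := l.map Sym.tok, prev := Sym.tok g :: s.prev,
               u := Sym.tok (S.back m.acc m.prev g) :: s.u } (some (Sym.tok g))
      { m with prev := some g } rfl
    refine ⟨o, (RunsIn.loop_step (s' := ((some (Sym.tok g), m),
      { s with t := l.map Sym.tok }.toFun)) ?_ rfl (.blk ?_) (ih.cast ?_)).mono ?_⟩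
    · obtain ⟨⟩ := s
      subst ht
      simp [evalOps, popTo, Op.eval, ScannerStacks.toFun]
    · simp [evalOps, Op.eval, ScannerStacks.toFun]
    · simp [mapPrev]
    · simp only [List.length_cons]
      omega

/-- Carry out the third pass on the record on `u`, unless the flag is set. -/
def thirdPass : S.P :=
  forEach .u (.blk [
    .push .b₀ fun s => if s.2.flag then none else
      (Sym.asTok s.1).map fun g => Sym.tok (S.forth s.2.acc false s.2.prev g),
    .push .b₁ fun s => if s.2.flag then none else
      (Sym.asTok s.1).map fun g => Sym.tok (S.forth s.2.acc true s.2.prev g),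
    .load fun s => (s.1, { s.2 with prev := Sym.asTok s.1 })])

/-- Both images are written in the same pass, so a record need not be copied for the two guesses.
The set flag, which marks a repeated record, suppresses all output. -/
theorem runsIn_thirdPass : ∀ (l : List S.G) (s : ScannerStacks (Sym S.G))
    (c : Option (Sym S.G)) (m : ScannerMem S), s.u = l.map Sym.tok →
    ∃ o, RunsIn thirdPass ((c, m), s.toFun) ((none, { m with prev := o }),
      { s with
        u := []
        b₀ := (if m.flag then [] else
          ((mapPrev (S.forth m.acc false) m.prev l).map Sym.tok).reverse) ++ s.b₀
        b₁ := (if m.flag then [] else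
          ((mapPrev (S.forth m.acc true) m.prev l).map Sym.tok).reverse) ++ s.b₁ }.toFun)
      (2 * l.length + 1)
  | [], s, c, m, ht => by
    refine ⟨m.prev, RunsIn.loop_exit ?_ rfl⟩
    obtain ⟨⟩ := s
    subst ht
    simp [evalOps, popTo, Op.eval, ScannerStacks.toFun, mapPrev]
  | g :: l, s, c, m, ht => by
    obtain ⟨o, ih⟩ := runsIn_thirdPass l
      { s with
        u := l.map Sym.tok
        b₀ := (if m.flag then [] else [Sym.tok (S.forth m.acc false m.prev g)]) ++ s.b₀
        b₁ := (if m.flag then [] else [Sym.tok (S.forth m.acc true m.prev g)]) ++ s.b₁ }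
      (some (Sym.tok g)) { m with prev := some g } rfl
    refine ⟨o, (RunsIn.loop_step (s' := ((some (Sym.tok g), m),
      { s with u := l.map Sym.tok }.toFun)) ?_ rfl (.blk ?_) (ih.cast ?_)).mono ?_⟩
    · obtain ⟨⟩ := s
      subst ht
      simp [evalOps, popTo, Op.eval, ScannerStacks.toFun]
    · cases hf : m.flag <;> simp [evalOps, Op.eval, ScannerStacks.toFun, hf]
    · cases hf : m.flag <;> simp [mapPrev]
    · simp only [List.length_cons]
      omega

/-- Replace the first record on `a` by its images on `b₀` and `b₁`, unless it equals `prev`. -/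
noncomputable def expandRecord : S.P :=
  .seq (.blk [.load fun s => (s.1, { s.2 with acc := S.acc, flag := true })]) <|
  .seq firstPass <| .seq (.blk [.load fun s => (s.1, { s.2 with prev := none })]) <|
  .seq secondPass <| .seq (.blk [.load fun s => (s.1, { s.2 with prev := none })]) <|
  .seq thirdPass <| .blk [.push .b₀ fun s => if s.2.flag then none else some Sym.sep,
    .push .b₁ fun s => if s.2.flag then none else some Sym.sep]

open Classical in
theorem does_expandRecord (rest : List (Sym S.G)) (r q : List S.G) (s : ScannerStacks (Sym S.G))
    (hq : q.length ≤ r.length) (ha : s.a = r.map Sym.tok ++ Sym.sep :: rest)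
    (hp : s.prev = q.map Sym.tok) (ht : s.t = []) (hu : s.u = []) :
    S.Does expandRecord s.toFun
      { s with
        a := rest
        prev := r.map Sym.tok
        b₀ := (if r = q then [] else (enc (S.image false r)).reverse) ++ s.b₀
        b₁ := (if r = q then [] else (enc (S.image true r)).reverse) ++ s.b₁ }.toFun
      (6 * r.length + 7) := fun m => by
  let M : ScannerMem S := { m.2 with acc := S.info r, flag := decide (r = q), c₂ := none }
  let s₁ : ScannerStacks (Sym S.G) :=
    { s with a := rest, prev := [], t := (r.map Sym.tok).reverse }
  let s₂ : ScannerStacks (Sym S.G) :=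
    { s with a := rest, prev := r.map Sym.tok, t := [], u := (S.middle r).map Sym.tok }
  let s₃ : ScannerStacks (Sym S.G) :=
    { s with
      a := rest
      prev := r.map Sym.tok
      u := []
      b₀ := (if r = q then [] else ((S.image false r).map Sym.tok).reverse) ++ s.b₀
      b₁ := (if r = q then [] else ((S.image true r).map Sym.tok).reverse) ++ s.b₁ }
  have hlen : (S.middle r).length = r.length := by simp [middle]
  have h₁ : RunsIn firstPass ((m.1, { m.2 with acc := S.acc, flag := true }), s.toFun)
      ((some Sym.sep, M), s₁.toFun) (2 * r.length + 1) :=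
    (runsIn_firstPass rest r q s m.1 { m.2 with acc := S.acc, flag := true } hq ha hp).cast
      (by simp [M, s₁, info, ht])
  obtain ⟨o₂, h₂⟩ := runsIn_secondPass r.reverse s₁ (some Sym.sep) { M with prev := none }
    (by simp [s₁])
  have h₂' : RunsIn secondPass ((some Sym.sep, { M with prev := none }), s₁.toFun)
      ((none, { M with prev := o₂ }), s₂.toFun) (2 * r.length + 1) :=
    (h₂.cast (by simp [M, s₁, s₂, middle, hu])).mono (by simp)
  obtain ⟨o₃, h₃⟩ := runsIn_thirdPass (S.middle r) s₂ none { M with prev := none } rfl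
  have h₃' : RunsIn thirdPass ((none, { M with prev := none }), s₂.toFun)
      ((none, { M with prev := o₃ }), s₃.toFun) (2 * r.length + 1) :=
    (h₃.cast (by by_cases h : r = q <;> simp [M, s₂, s₃, image, h, ht])).mono (by omega)
  refine ⟨(none, { M with prev := o₃ }), (RunsIn.seq (.blk rfl) (h₁.seq (RunsIn.seq (.blk rfl)
    (h₂'.seq (RunsIn.seq (.blk rfl) (h₃'.seq (.blk ?_))))))).mono (by omega)⟩
  by_cases h : r = q <;> simp [evalOps, Op.eval, ScannerStacks.toFun, M, s₃, h, enc, hu]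

noncomputable def expand : S.P := forRecords expandRecord

/-- Each record is compared with its predecessor in the list, a copy of which stays on `prev` even
if that record was itself dropped; this is the recursion of `dropRepeated`. -/
theorem does_expand {W : ℕ} : ∀ (L : List (List S.G)) (q : List S.G)
    (s : ScannerStacks (Sym S.G)), (∀ r ∈ L, r.length = W) → q.length ≤ W → s.a = encList L →
    s.prev = q.map Sym.tok → s.t = [] → s.u = [] →
    ∃ q' : List S.G, q'.length ≤ W ∧ S.Does expand s.toFun
      { s with
        a := []
        prev := q'.map Sym.tok
        b₀ := (encList ((dropRepeated q L).map (S.image false))).reverse ++ s.b₀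
        b₁ := (encList ((dropRepeated q L).map (S.image true))).reverse ++ s.b₁ }.toFun
      (8 * (encList L).length + 1)
  | [], q, s, _, hq, ha, hp, _, _ => ⟨q, hq, fun m => ⟨(none, m.2),
      ((runsIn_forRecords_nil expandRecord s ha m).mono (by simp)).cast (by
        obtain ⟨⟩ := s
        simp only [encList_nil] at ha
        subst ha hp
        simp [dropRepeated])⟩⟩
  | r :: L, q, s, hL, hq, ha, hp, ht, hu => by
    classical
    have hr := hL r List.mem_cons_self
    have h₁ := does_expandRecord (encList L) r q s (by omega) (by simpa using ha) hp ht hu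
    obtain ⟨q', hq', h₂⟩ := does_expand L r
      { s with
        a := encList L
        prev := r.map Sym.tok
        b₀ := (if r = q then [] else (enc (S.image false r)).reverse) ++ s.b₀
        b₁ := (if r = q then [] else (enc (S.image true r)).reverse) ++ s.b₁ }
      (fun r hr => hL r (List.mem_cons_of_mem _ hr)) hr.le rfl rfl ht hu
    refine ⟨q', hq', fun m => ?_⟩
    obtain ⟨m', hm⟩ := runsIn_forRecords_cons (m := m) r (encList L) (by simpa using ha) h₁ h₂
    refine ⟨m', (hm.cast ?_).mono ?_⟩
    · by_cases h : r = q <;> simp [dropRepeated, h, enc]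
    · simp only [encList_cons, List.length_append, List.length_map, List.length_cons]
      omega

/-! #### Sorting -/

/-- Move the elements with property `k` to the end, without changing the order otherwise. -/
def partitionBy {α : Type} (k : α → Bool) (L : List α) : List α :=
  L.filter (fun a => !k a) ++ L.filter k

open Classical in
/-- The effect of a distribution of the records. -/
noncomputable def rotatePass (g : S.G) (L : List (List S.G)) : List (List S.G) :=
  (partitionBy (fun r => decide (r.head? = some g)) L).map fun r => r.rotate 1

theorem length_rotatePass (g : S.G) (L : List (List S.G)) :
    (rotatePass g L).length = L.length := by
  classical
  have := L.length_eq_length_filter_add (fun r => decide (r.head? = some g))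
  simp only [rotatePass, partitionBy, List.length_map, List.length_append]
  omega

theorem length_of_mem_rotatePass {g : S.G} {W : ℕ} {L : List (List S.G)}
    (h : ∀ r ∈ L, r.length = W) : ∀ r ∈ rotatePass g L, r.length = W := by
  classical
  intro r hr
  simp only [rotatePass, partitionBy, List.mem_map, List.mem_append, List.mem_filter] at hr
  obtain ⟨r', hr' | hr', rfl⟩ := hr <;> simpa using h r' hr'.1

theorem evalOps_push (k : ScannerStack) (c : Sym S.G) (m : Option (Sym S.G) × ScannerMem S)
    (s : ScannerStack → List (Sym S.G)) :
    evalOps [.push k fun _ => some c] (m, s) = (m, Function.update s k (c :: s k)) := rfl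

/-- Execute `p` once for every symbol on `cnt`, which is not changed. -/
def forCnt (p : S.P) : S.P :=
  .seq (forEach .cnt (.seq (.blk [.push .cnt' fun _ => some Sym.sep]) p)) (transfer .cnt' .cnt)

/-- The counter is copied to `cnt'` while it is consumed, and restored at the end. The hypothesis
holds for all contents of the two stacks because they vary during the loop. -/
theorem does_forCnt {p : S.P} {T W : ℕ} (st : ℕ → ScannerStacks (Sym S.G))
    (h : ∀ i < W, ∀ c c', S.Does p { st i with cnt := c, cnt' := c' }.toFun
      { st (i + 1) with cnt := c, cnt' := c' }.toFun T) :
    S.Does (forCnt p) { st 0 with cnt := .replicate W Sym.sep, cnt' := [] }.toFun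
      { st W with cnt := .replicate W Sym.sep, cnt' := [] }.toFun (W * (T + 4) + 2) := by
  have h₁ := does_forEach (S := S) (k := .cnt)
    (p := .seq (.blk [.push .cnt' fun _ => some Sym.sep]) p) (T := 1 + T) W Sym.sep
    (fun i => { st i with cnt := .replicate (W - i) Sym.sep, cnt' := .replicate i Sym.sep }.toFun)
    (fun i _ => by simp [ScannerStacks.toFun]) (fun i hi m => by
      obtain ⟨m', hm⟩ := h i hi (.replicate (W - i - 1) Sym.sep) (.replicate (i + 1) Sym.sep) m
      refine ⟨m', (RunsIn.seq (.blk (evalOps_push _ _ _ _)) ?_)⟩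
      simpa [ScannerStacks.toFun, List.replicate_succ, Nat.sub_sub] using hm)
  have h₂ := does_transfer (S := S) (k := .cnt') (k' := .cnt) (by decide)
    { st W with cnt := .replicate (W - W) Sym.sep, cnt' := .replicate W Sym.sep }.toFun
  refine ((h₁.seq h₂).cast ?_).mono ?_
  · simp [ScannerStacks.toFun]
  · simp only [ScannerStacks.toFun, List.length_replicate]
    ring_nf
    omega

noncomputable def sortPass (g : S.G) : S.P := .seq (distribute g) gather

theorem does_sortPass {W : ℕ} (hW : 0 < W) (g : S.G) (L : List (List S.G))
    (s : ScannerStacks (Sym S.G)) (hL : ∀ r ∈ L, r.length = W) (hb₀ : s.b₀ = []) (hb₁ : s.b₁ = []) :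
    S.Does (sortPass g) { s with a := encList L }.toFun
      { s with a := encList (rotatePass g L) }.toFun (6 * (L.length * (W + 1)) + 3) := by
  classical
  have h₁ := does_distribute g L { s with a := encList L } (fun r hr h => by
    have := hL r hr
    rw [h, List.length_nil] at this
    omega) rfl
  have h₂ := does_gather (S := S) { s with
    a := []
    b₀ := (encList ((L.filter fun r : List S.G => r.head? ≠ some g).map
      fun r : List S.G => r.rotate 1)).reverse ++ s.b₀
    b₁ := (encList ((L.filter fun r : List S.G => r.head? = some g).map
      fun r : List S.G => r.rotate 1)).reverse ++ s.b₁ }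
  have h₃ : encList (rotatePass g L) = encList ((L.filter fun r : List S.G => r.head? ≠ some g).map
      fun r : List S.G => r.rotate 1) ++ encList ((L.filter fun r : List S.G =>
        r.head? = some g).map fun r : List S.G => r.rotate 1) := by
    rw [rotatePass, partitionBy, List.map_append, encList_append]
    congr! 5
    simp
  refine ((h₁.seq h₂).cast ?_).mono ?_
  · simp [h₃, hb₀, hb₁]
  · have e₁ := length_encList hL
    have e₂ := length_encList (length_of_mem_rotatePass (g := g) hL)
    rw [h₃, List.length_append, length_rotatePass] at e₂
    simp only [hb₀, hb₁, List.append_nil, List.length_reverse]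
    omega

/-- The list of records after `W` distributions for each letter in `gs`. -/
noncomputable def sortList (W : ℕ) (gs : List S.G) (L : List (List S.G)) : List (List S.G) :=
  gs.foldl (fun L g => (rotatePass g)^[W] L) L

/-- Radix sort with binary keys: for each letter `g`, one distribution per position. After `W`
rotations records of length `W` are back in their original form. -/
noncomputable def sort : List S.G → S.P
  | [] => .blk []
  | g :: gs => .seq (forCnt (sortPass g)) (sort gs)

theorem length_iterate_rotatePass (g : S.G) (L : List (List S.G)) (i : ℕ) :
    ((rotatePass g)^[i] L).length = L.length := by
  induction i with
  | zero => rfl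
  | succ i ih => rw [Function.iterate_succ_apply', length_rotatePass, ih]

theorem length_of_mem_iterate_rotatePass {g : S.G} {W : ℕ} {L : List (List S.G)}
    (h : ∀ r ∈ L, r.length = W) (i : ℕ) : ∀ r ∈ (rotatePass g)^[i] L, r.length = W := by
  induction i with
  | zero => exact h
  | succ i ih =>
    rw [Function.iterate_succ_apply']
    exact length_of_mem_rotatePass ih

theorem does_sort {W : ℕ} (hW : 0 < W) (s : ScannerStacks (Sym S.G)) (hb₀ : s.b₀ = [])
    (hb₁ : s.b₁ = []) (hc : s.cnt = .replicate W Sym.sep) (hc' : s.cnt' = []) :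
    ∀ (gs : List S.G) (L : List (List S.G)), (∀ r ∈ L, r.length = W) →
      S.Does (sort gs) { s with a := encList L }.toFun
        { s with a := encList (sortList W gs L) }.toFun
        (gs.length * (W * (6 * (L.length * (W + 1)) + 7) + 2) + 1)
  | [], L, _ => fun m => ⟨m, (RunsIn.blk rfl).mono (by omega)⟩
  | g :: gs, L, hL => by
    have h₁ := does_forCnt (S := S) (p := sortPass g) (T := 6 * (L.length * (W + 1)) + 3) (W := W)
      (fun i => { s with a := encList ((rotatePass g)^[i] L) }) (fun i _ c c' => by
        have := does_sortPass hW g ((rotatePass g)^[i] L) { s with cnt := c, cnt' := c' }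
          (length_of_mem_iterate_rotatePass hL i) hb₀ hb₁
        rw [length_iterate_rotatePass] at this
        rwa [Function.iterate_succ_apply'])
    have h₂ := does_sort hW s hb₀ hb₁ hc hc' gs ((rotatePass g)^[W] L)
      (length_of_mem_iterate_rotatePass hL W)
    rw [length_iterate_rotatePass] at h₂
    obtain ⟨⟩ := s
    subst hc hc'
    refine (h₁.seq h₂).mono (le_of_eq ?_)
    rw [List.length_cons]
    ring

end Scanner

end EPNL

/-! ### Layers of the search, the initial records and the final verdict -/

namespace EPNL

theorem length_dropRepeated_le {α : Type} (a : α) (l : List α) :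
    (dropRepeated a l).length ≤ l.length := by
  induction l generalizing a with
  | nil => simp [dropRepeated]
  | cons b l ih =>
    rw [dropRepeated]
    split_ifs
    · exact (ih b).trans (by simp)
    · simpa using ih b

theorem mem_of_mem_dropRepeated {α : Type} {a b : α} {l : List α} (h : b ∈ dropRepeated a l) :
    b ∈ l := by
  induction l generalizing a with
  | nil => simp [dropRepeated] at h
  | cons c l ih =>
    rw [dropRepeated] at h
    split_ifs at h
    · exact List.mem_cons_of_mem _ (ih h)
    · rcases List.mem_cons.mp h with rfl | h
      · exact List.mem_cons_self
      · exact List.mem_cons_of_mem _ (ih h)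

namespace Scanner

variable {S : Scanner}

/-! #### Layers -/

theorem length_sortList (W : ℕ) (gs : List S.G) (L : List (List S.G)) :
    (sortList W gs L).length = L.length := by
  induction gs generalizing L with
  | nil => rfl
  | cons g gs ih => exact (ih _).trans (length_iterate_rotatePass g L W)

theorem length_of_mem_sortList {W : ℕ} (gs : List S.G) {L : List (List S.G)}
    (h : ∀ r ∈ L, r.length = W) : ∀ r ∈ sortList W gs L, r.length = W := by
  induction gs generalizing L with
  | nil => exact h
  | cons g gs ih => exact ih (length_of_mem_iterate_rotatePass h W)

/-- The images of the records in a list, which is freed from repetitions before. -/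
noncomputable def layerList (W : ℕ) (gs : List S.G) (L : List (List S.G)) : List (List S.G) :=
  (dropRepeated [] (sortList W gs L)).map (S.image false) ++
    (dropRepeated [] (sortList W gs L)).map (S.image true)

theorem length_of_mem_layerList {W : ℕ} (gs : List S.G) {L : List (List S.G)}
    (h : ∀ r ∈ L, r.length = W) : ∀ r ∈ layerList W gs L, r.length = W := by
  intro r hr
  simp only [layerList, List.mem_append, List.mem_map] at hr
  obtain ⟨r', hr', rfl⟩ | ⟨r', hr', rfl⟩ := hr <;>
    exact (length_image _ _).trans
      (length_of_mem_sortList gs h r' (mem_of_mem_dropRepeated hr'))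

noncomputable def layer (gs : List S.G) : S.P :=
  .seq (sort gs) <| .seq expand <| .seq (drain .prev) gather

/-- The time for a layer with at most `N` records of length `W`. -/
def layerTime (k W N : ℕ) : ℕ :=
  k * (W * (6 * (N * (W + 1)) + 7) + 2) + 12 * (N * (W + 1)) + 2 * W + 5

/-- Sorting and expanding take time linear in the number `N` of records. The empty word can serve as
the first predecessor, since records have positive length. -/
theorem does_layer {W : ℕ} (hW : 0 < W) (gs : List S.G) (L : List (List S.G)) (N : ℕ)
    (hN : L.length ≤ N) (s : ScannerStacks (Sym S.G)) (hL : ∀ r ∈ L, r.length = W)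
    (hb₀ : s.b₀ = []) (hb₁ : s.b₁ = []) (hc : s.cnt = .replicate W Sym.sep) (hc' : s.cnt' = [])
    (hp : s.prev = []) (ht : s.t = []) (hu : s.u = []) :
    S.Does (layer gs) { s with a := encList L }.toFun
      { s with a := encList (layerList W gs L) }.toFun (layerTime gs.length W N) := by
  have h₁ := does_sort hW s hb₀ hb₁ hc hc' gs L hL
  obtain ⟨q, hq, h₂⟩ := does_expand (sortList W gs L) []
    { s with a := encList (sortList W gs L) } (length_of_mem_sortList gs hL) (Nat.zero_le W) rfl
    hp ht hu
  have h₃ := does_drain (S := S) .prev { s with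
    a := []
    prev := q.map Sym.tok
    b₀ := (encList ((dropRepeated [] (sortList W gs L)).map (S.image false))).reverse ++ s.b₀
    b₁ := (encList ((dropRepeated [] (sortList W gs L)).map (S.image true))).reverse ++
      s.b₁ }.toFun
  have h₄ := does_gather (S := S) { s with
    a := []
    prev := []
    b₀ := (encList ((dropRepeated [] (sortList W gs L)).map (S.image false))).reverse ++ s.b₀
    b₁ := (encList ((dropRepeated [] (sortList W gs L)).map (S.image true))).reverse ++ s.b₁ }
  rw [ScannerStacks.update_prev] at h₃
  refine ((h₁.seq (h₂.seq (h₃.seq h₄))).cast ?_).mono ?_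
  · obtain ⟨⟩ := s
    subst hb₀ hb₁ hp
    simp [layerList, encList_append]
  · have e : ∀ b, (encList ((dropRepeated [] (sortList W gs L)).map (S.image b))).length ≤
        N * (W + 1) := by
      intro b
      rw [length_encList (W := W)]
      · refine Nat.mul_le_mul_right _ (le_trans ?_ hN)
        rw [List.length_map, ← length_sortList W gs L]
        exact length_dropRepeated_le _ _
      · intro r hr
        obtain ⟨r', hr', rfl⟩ := List.mem_map.mp hr
        exact (length_image _ _).trans
          (length_of_mem_sortList gs hL r' (mem_of_mem_dropRepeated hr'))
    have e₁ : (encList (sortList W gs L)).length ≤ N * (W + 1) := by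
      rw [length_encList (length_of_mem_sortList gs hL), length_sortList]
      exact Nat.mul_le_mul_right _ hN
    have e₂ : gs.length * (W * (6 * (L.length * (W + 1)) + 7) + 2) ≤
        gs.length * (W * (6 * (N * (W + 1)) + 7) + 2) := by gcongr
    have e₃ := e false
    have e₄ := e true
    simp only [hb₀, hb₁, List.append_nil, List.length_reverse, ScannerStacks.toFun,
      List.length_map, layerTime]
    omega

theorem length_of_mem_iterate_layerList {W : ℕ} (gs : List S.G) {L : List (List S.G)}
    (h : ∀ r ∈ L, r.length = W) (i : ℕ) : ∀ r ∈ (layerList W gs)^[i] L, r.length = W := by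
  induction i with
  | zero => exact h
  | succ i ih =>
    rw [Function.iterate_succ_apply']
    exact length_of_mem_layerList gs ih

theorem does_layers {W : ℕ} (hW : 0 < W) (gs : List S.G) (L : List (List S.G)) (N M : ℕ)
    (hN : ∀ i < M, ((layerList W gs)^[i] L).length ≤ N) (hL : ∀ r ∈ L, r.length = W) :
    S.Does (forEach .rounds (layer gs))
      (ScannerStacks.toFun { a := encList L, cnt := .replicate W Sym.sep,
                             rounds := .replicate M Sym.sep })
      (ScannerStacks.toFun { a := encList ((layerList W gs)^[M] L), cnt := .replicate W Sym.sep })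
      (M * (layerTime gs.length W N + 1) + 1) := by
  have h := does_forEach (S := S) (k := .rounds) (p := layer gs) (T := layerTime gs.length W N) M
    Sym.sep (fun i => ScannerStacks.toFun {
      a := encList ((layerList W gs)^[i] L), cnt := .replicate W Sym.sep,
      rounds := .replicate (M - i) Sym.sep })
    (fun i _ => by simp [ScannerStacks.toFun]) (fun i hi => by
      have := does_layer hW gs ((layerList W gs)^[i] L) N (hN i hi)
        { cnt := .replicate W Sym.sep, rounds := .replicate (M - i - 1) Sym.sep }
        (length_of_mem_iterate_layerList gs hL i) rfl rfl rfl rfl rfl rfl rfl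
      simpa [Function.iterate_succ_apply', Nat.sub_sub] using this)
  simpa using h

/-! #### The last layer -/

def verdict : S.P :=
  .seq (.blk [.load fun s => (s.1, { s.2 with flag := false })]) <|
  .seq (forEach .a (.blk [.load fun s => (s.1, { s.2 with
    flag := s.2.flag || (Sym.asTok s.1).any S.good })])) <|
  .blk [.push .t fun s => some (Sym.bit s.2.flag)]

theorem runsIn_verdictLoop : ∀ (l : List (Sym S.G)) (s : ScannerStacks (Sym S.G))
    (c : Option (Sym S.G)) (m : ScannerMem S), s.a = l →
    RunsIn (forEach .a (.blk [.load fun s => (s.1, { s.2 with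
      flag := s.2.flag || (Sym.asTok s.1).any S.good })])) ((c, m), s.toFun)
      ((none, { m with flag := m.flag || l.any fun c => (Sym.asTok (some c)).any S.good }),
        { s with a := [] }.toFun) (2 * l.length + 1)
  | [], s, c, m, h => by
    refine RunsIn.loop_exit ?_ rfl
    obtain ⟨⟩ := s
    subst h
    simp [evalOps, popTo, Op.eval, ScannerStacks.toFun]
  | g :: l, s, c, m, h => by
    have ih := runsIn_verdictLoop l { s with a := l } (some g)
      { m with flag := m.flag || (Sym.asTok (some g)).any S.good } rfl
    refine (RunsIn.loop_step (s' := ((some g, m), { s with a := l }.toFun)) ?_ rfl (.blk ?_)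
      (ih.cast ?_)).mono ?_
    · obtain ⟨⟩ := s
      subst h
      simp [evalOps, popTo, Op.eval, ScannerStacks.toFun]
    · rfl
    · simp [Bool.or_assoc]
    · simp only [List.length_cons]
      omega

theorem any_encList (L : List (List S.G)) :
    ((encList L).any fun c => (Sym.asTok (some c)).any S.good) = L.any fun r => r.any S.good := by
  induction L with
  | nil => rfl
  | cons r L ih =>
    rw [encList_cons, List.any_append, List.any_cons, ih, List.any_cons, List.any_map]
    simp [Function.comp_def]

theorem does_verdict (L : List (List S.G)) (s : ScannerStacks (Sym S.G)) (h : s.a = encList L) :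
    S.Does verdict s.toFun
      { s with a := [], t := Sym.bit (L.any fun r => r.any S.good) :: s.t }.toFun
      (2 * (encList L).length + 3) := fun m => by
  have h₁ := runsIn_verdictLoop (encList L) s m.1 { m.2 with flag := false } h
  rw [any_encList] at h₁
  refine ⟨(none, { m.2 with flag := L.any fun r => r.any S.good }),
    (RunsIn.seq (.blk rfl) (h₁.seq (.blk ?_))).mono (by omega)⟩
  simp [evalOps, Op.eval, ScannerStacks.toFun]

/-! #### The first layer -/

/-- The initial records. -/
def iniRecord (S : Scanner) (b : Bool) (x : List Bool) (P W : ℕ) : List S.G :=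
  (List.range W).map fun i => S.ini b (i == 0) x[i]? (decide (i < P))

/-- Appends one letter to each of the two initial records. The first cell is recognised by `b₀`
being empty, the cells below the certificate length by a unary counter on `cert`. -/
def iniStep : S.P :=
  .blk [.pop .b₀ fun s c => (s.1, { s.2 with c₁ := c }), .push .b₀ fun s => s.2.c₁,
    popTo .inp, .pop .cert fun s c => (s.1, { s.2 with c₂ := c }),
    .push .b₀ fun s => some (Sym.tok (S.ini false s.2.c₁.isNone (Sym.asBit s.1) s.2.c₂.isSome)),
    .push .b₁ fun s => some (Sym.tok (S.ini true s.2.c₁.isNone (Sym.asBit s.1) s.2.c₂.isSome))]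

def start : S.P := .seq (forCnt iniStep) <| .seq (.blk [.push .b₀ fun _ => some Sym.sep]) <|
  .seq (.blk [.push .b₁ fun _ => some Sym.sep]) gather

theorem does_start (x : List Bool) (P W : ℕ) (hx : x.length ≤ W) (hP : P ≤ W)
    (rounds : List (Sym S.G)) :
    S.Does start (ScannerStacks.toFun { inp := x.map Sym.bit, cert := .replicate P Sym.sep,
                                        cnt := .replicate W Sym.sep, rounds := rounds })
      (ScannerStacks.toFun { a := encList [S.iniRecord false x P W, S.iniRecord true x P W],
                             cnt := .replicate W Sym.sep, rounds := rounds })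
      (9 * W + 10) := by
  have h₁ := does_forCnt (S := S) (p := iniStep) (T := 1) (W := W)
    (fun i => { inp := (x.drop i).map Sym.bit, cert := .replicate (P - i) Sym.sep,
                b₀ := ((S.iniRecord false x P i).map Sym.tok).reverse,
                b₁ := ((S.iniRecord true x P i).map Sym.tok).reverse,
                rounds := rounds }) (fun i _ c c' m => by
      refine ⟨(((x.drop i).map Sym.bit).head?,
          { m.2 with c₁ := ((S.iniRecord false x P i).map Sym.tok).reverse.head?,
                     c₂ := (List.replicate (P - i) Sym.sep).head? }), .blk ?_⟩
      have e₁ : ((S.iniRecord false x P i).map Sym.tok).reverse.head?.toList ++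
          ((S.iniRecord false x P i).map Sym.tok).reverse.tail =
            ((S.iniRecord false x P i).map Sym.tok).reverse := by
        cases ((S.iniRecord false x P i).map Sym.tok).reverse <;> rfl
      have e₂ : (((S.iniRecord false x P i).map Sym.tok).reverse.head?).isNone = (i == 0) := by
        cases i with
        | zero => rfl
        | succ i => simp [iniRecord, List.range_succ]
      have e₃ : Sym.asBit (((x.drop i).map (Sym.bit (G := S.G))).head?) = x[i]? := by
        rw [List.head?_map, List.head?_drop]
        cases x[i]? <;> rfl
      have e₄ : ((List.replicate (P - i) (Sym.sep (G := S.G))).head?).isSome = decide (i < P) := by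
        rcases Nat.lt_or_ge i P with h | h
        · obtain ⟨d, rfl⟩ := Nat.exists_eq_add_of_lt h
          have : i + d + 1 - i = d + 1 := by omega
          simp [this, List.replicate_succ, h]
        · simp [Nat.sub_eq_zero_of_le h, h]
      have e₅ : (x.drop i).tail = x.drop (i + 1) := by simp
      have e₆ : (List.replicate (P - i) (Sym.sep (G := S.G))).tail =
          List.replicate (P - (i + 1)) Sym.sep := by simp [Nat.sub_sub]
      have e₇ : ∀ b, ((S.iniRecord b x P (i + 1)).map Sym.tok).reverse =
          Sym.tok (S.ini b (i == 0) x[i]? (decide (i < P))) ::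
            ((S.iniRecord b x P i).map Sym.tok).reverse := by
        intro b
        simp [iniRecord, List.range_succ]
      simp only [evalOps, popTo, Op.eval, ScannerStacks.toFun, ScannerStacks.update_inp,
        ScannerStacks.update_cert, ScannerStacks.update_b₀, ScannerStacks.update_b₁, e₁, e₂, e₃, e₄,
        e₆, e₇, ← List.map_tail, e₅, Option.toList_some, List.singleton_append])
  have h₂ := does_gather (S := S) {
    cnt := .replicate W Sym.sep, rounds := rounds,
    b₀ := (enc (S.iniRecord false x P W)).reverse, b₁ := (enc (S.iniRecord true x P W)).reverse }
  have hd : x.drop W = [] := List.drop_eq_nil_of_le hx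
  have hP' : P - W = 0 := Nat.sub_eq_zero_of_le hP
  have hc : ∀ k (c : Sym S.G) (s : ScannerStack → List (Sym S.G)),
      S.Does (.blk [.push k fun _ => some c]) s (Function.update s k (c :: s k)) 1 :=
    fun k c s m => ⟨m, .blk rfl⟩
  have h₁' := h₁.cast (s'' := ScannerStacks.toFun {
                cnt := .replicate W Sym.sep, rounds := rounds,
                b₀ := ((S.iniRecord false x P W).map Sym.tok).reverse,
                b₁ := ((S.iniRecord true x P W).map Sym.tok).reverse }) (by simp [hd, hP'])
  have h₃ := (h₁'.seq ((hc .b₀ Sym.sep _).seq ((hc .b₁ Sym.sep _).seq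
    (show S.Does gather _ _ _ by
      simpa [enc, ScannerStacks.toFun] using h₂))))
  refine (Does.mono (h₃.cast ?_) ?_)
  · simp
  · simp [iniRecord]
    omega

end Scanner

end EPNL

namespace EPNL

namespace Scanner

variable {S : Scanner}

/-! #### Polynomials in unary -/

/-- Add the length of the input to the unary number on `k`. -/
def addInput (k : ScannerStack) : S.P :=
  .seq (forEach .inp (.blk [.push .tmp fun s => s.1, .push k fun _ => some Sym.sep]))
    (transfer .tmp .inp)

theorem runsIn_copyInput {k : ScannerStack} (hk : k ≠ .inp) (hk' : k ≠ .tmp) :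
    ∀ (l : List (Sym S.G)) (s : ScannerStack → List (Sym S.G)) (c : Option (Sym S.G))
      (m : ScannerMem S), s .inp = l →
      RunsIn (forEach .inp (.blk [.push .tmp fun s => s.1, .push k fun _ => some Sym.sep]))
        ((c, m), s) ((none, m), Function.update (Function.update (Function.update s .inp [])
          .tmp (l.reverse ++ s .tmp)) k (.replicate l.length Sym.sep ++ s k)) (2 * l.length + 1)
  | [], s, c, m, h => by
    refine RunsIn.loop_exit ?_ rfl
    simp only [evalOps, popTo, Op.eval, h, List.head?_nil, List.tail_nil, List.reverse_nil,
      List.nil_append, List.length_nil, List.replicate_zero]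
    congr 1
    funext j
    simp only [Function.update_apply]
    split_ifs <;> simp_all
  | a :: l, s, c, m, h => by
    have ih := runsIn_copyInput hk hk' l (Function.update (Function.update (Function.update s .inp l)
      .tmp (a :: s .tmp)) k (Sym.sep :: s k)) (some a) m
      (by simp [hk.symm])
    refine (RunsIn.loop_step (s' := ((some a, m), Function.update s .inp l))
      (by simp [evalOps, popTo, Op.eval, h]) rfl (.blk ?_) (ih.cast ?_)).mono ?_
    · simp [evalOps, Op.eval, hk, hk']
    · congr 1
      funext j
      simp only [Function.update_apply, List.length_cons, List.replicate_succ']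
      split_ifs <;> simp_all
    · simp only [List.length_cons]
      omega

theorem does_addInput {k : ScannerStack} (hk : k ≠ .inp) (hk' : k ≠ .tmp)
    (s : ScannerStack → List (Sym S.G)) (ht : s .tmp = []) :
    S.Does (addInput k) s (Function.update s k (.replicate (s .inp).length Sym.sep ++ s k))
      (4 * (s .inp).length + 2) := fun m => by
  have h₁ := runsIn_copyInput hk hk' (s .inp) s m.1 m.2 rfl
  obtain ⟨m', h₂⟩ := does_transfer (S := S) (k := .tmp) (k' := .inp) (by decide) _ (none, m.2)
  refine ⟨m', ((h₁.seq h₂).cast ?_).mono ?_⟩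
  · congr 1
    funext j
    simp only [Function.update_apply]
    split_ifs <;> simp_all
  · simp [hk'.symm, ht]
    omega

theorem evalOps_pushMany (k : ScannerStack) (a : ℕ) (m : Option (Sym S.G) × ScannerMem S)
    (s : ScannerStack → List (Sym S.G)) :
    evalOps (.replicate a (.push k fun _ => some Sym.sep)) (m, s) =
      (m, Function.update s k (.replicate a Sym.sep ++ s k)) := by
  induction a generalizing s with
  | zero => simp [evalOps]
  | succ a ih =>
    rw [List.replicate_succ, evalOps]
    simp [Op.eval, ih, List.replicate_succ']

/-- Horner's scheme: adding a constant is a block of pushes, and multiplying by the input length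
moves the unary number to `t` and adds the input length once for each of its symbols. -/
theorem exists_polyProg (S : Scanner) {k : ScannerStack} (hk : k ≠ .inp) (hk' : k ≠ .tmp)
    (hk'' : k ≠ .t) (p : Polynomial ℕ) : ∃ (q : S.P) (T : ℕ → ℕ), PolyBdd T ∧
      ∀ s : ScannerStack → List (Sym S.G), s .tmp = [] → s .t = [] → s k = [] →
        S.Does q s (Function.update s k (.replicate (p.eval (s .inp).length) Sym.sep))
          (T (s .inp).length) := by
  induction p using Polynomial.recOnHorner with
  | M0 =>
    refine ⟨.blk [], fun _ => 1, .const 1, fun s _ _ h m => ⟨m, .blk ?_⟩⟩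
    simp [evalOps, ← h]
  | MC p a _ _ ih =>
    obtain ⟨q, T, hT, h⟩ := ih
    refine ⟨.seq q (.blk (.replicate a (.push k fun _ => some Sym.sep))), fun n => T n + 1,
      hT.add (.const 1), fun s h₁ h₂ h₃ => (h s h₁ h₂ h₃).seq fun m => ⟨m, .blk ?_⟩⟩
    rw [evalOps_pushMany]
    simp [add_comm]
  | MX p _ ih =>
    obtain ⟨q, T, hT, h⟩ := ih
    refine ⟨.seq q (.seq (transfer k .t) (forEach .t (addInput k))),
      fun n => T n + ((2 * p.eval n + 1) + (p.eval n * (4 * n + 2 + 1) + 1)),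
      hT.add ((((PolyBdd.const 2).mul (.eval p)).add (.const 1)).add
        (((PolyBdd.eval p).mul ((((PolyBdd.const 4).mul .id).add (.const 2)).add (.const 1))).add
          (.const 1))), fun s h₁ h₂ h₃ => ?_⟩
    have hq := h s h₁ h₂ h₃
    have ht := does_transfer hk'' (Function.update s k
      (.replicate (p.eval (s .inp).length) (Sym.sep (G := S.G))))
    have hf := does_forEach (k := .t) (p := addInput k) (T := 4 * (s .inp).length + 2)
      (p.eval (s .inp).length) (Sym.sep (G := S.G))
      (fun i => Function.update (Function.update s .t
        (.replicate (p.eval (s .inp).length - i) (Sym.sep (G := S.G)))) k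
          (.replicate (i * (s .inp).length) Sym.sep))
      (fun i _ => by simp [Function.update_of_ne hk''.symm]) (fun i hi => by
        have := does_addInput (S := S) hk hk' (Function.update (Function.update s .t
          (.replicate (p.eval (s .inp).length - i - 1) (Sym.sep (G := S.G)))) k
          (.replicate (i * (s .inp).length) Sym.sep))
          (by simp [hk'.symm, h₁])
        have hn : Function.update (Function.update s .t (.replicate
          (p.eval (s .inp).length - i - 1) (Sym.sep (G := S.G)))) k
          (.replicate (i * (s .inp).length) Sym.sep) .inp = s .inp := by
          simp [hk.symm]
        rw [hn] at this
        simp only [Function.update_self, Function.update_idem, ← List.replicate_add] at this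
        rw [Function.update_comm hk'', Function.update_idem, Function.update_comm hk''.symm,
          Nat.sub_sub] at *
        rwa [Nat.succ_mul, add_comm (i * _)])
    refine (hq.seq ((ht.cast ?_).seq (hf.cast ?_))).mono ?_
    · funext j
      simp only [Function.update_apply]
      split_ifs <;> simp_all
    · funext j
      simp only [Function.update_apply]
      split_ifs <;> simp_all
    · simp

/-! #### The whole computation -/

/-- The number `N` bounds the sizes of the layers and is the only quantity that may be exponential,
so the time is stated as `N` times a polynomially bounded function. -/
theorem exists_mainProg (S : Scanner) (p w r : Polynomial ℕ) (gs : List S.G) :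
    ∃ (q : S.P) (T : ℕ → ℕ), PolyBdd T ∧ ∀ (x : List Bool) (N : ℕ),
      x.length ≤ w.eval x.length → p.eval x.length ≤ w.eval x.length → 0 < w.eval x.length →
      2 ≤ N →
      (∀ i ≤ r.eval x.length, ((layerList (w.eval x.length) gs)^[i]
        [S.iniRecord false x (p.eval x.length) (w.eval x.length),
         S.iniRecord true x (p.eval x.length) (w.eval x.length)]).length ≤ N) →
      S.Does q (Function.update (fun _ => []) .tmp (x.map Sym.bit).reverse)
        (Function.update (fun _ => []) .t
          [Sym.bit (((layerList (w.eval x.length) gs)^[r.eval x.length]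
            [S.iniRecord false x (p.eval x.length) (w.eval x.length),
             S.iniRecord true x (p.eval x.length) (w.eval x.length)]).any fun r => r.any S.good)])
        (N * T x.length) := by
  obtain ⟨qp, Tp, hTp, hqp⟩ := S.exists_polyProg (k := .cert) (by decide) (by decide) (by decide) p
  obtain ⟨qw, Tw, hTw, hqw⟩ := S.exists_polyProg (k := .cnt) (by decide) (by decide) (by decide) w
  obtain ⟨qr, Tr, hTr, hqr⟩ := S.exists_polyProg (k := .rounds) (by decide) (by decide) (by decide) r
  have hw := PolyBdd.eval w
  have hr := PolyBdd.eval r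
  have hl : PolyBdd fun n => layerTime gs.length (w.eval n) 1 :=
    ((((PolyBdd.const gs.length).mul ((hw.mul (((PolyBdd.const 6).mul ((PolyBdd.const 1).mul
      (hw.add (.const 1)))).add (.const 7))).add (.const 2))).add
        ((PolyBdd.const 12).mul ((PolyBdd.const 1).mul (hw.add (.const 1))))).add
          ((PolyBdd.const 2).mul hw)).add (.const 5)
  refine ⟨.seq (transfer .tmp .inp) <| .seq qp <| .seq qw <| .seq qr <| .seq start <|
    .seq (forEach .rounds (layer gs)) <| .seq verdict (drain .cnt),
    fun n => (2 * n + 1) + (Tp n + (Tw n + (Tr n + ((9 * w.eval n + 10) +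
      ((r.eval n * (layerTime gs.length (w.eval n) 1 + 1) + 1) + ((2 * (w.eval n + 1) + 3) +
        (2 * w.eval n + 1))))))), ?_, fun x N hx hp hW hN hlen => ?_⟩
  · exact (((PolyBdd.const 2).mul .id).add (.const 1)).add (hTp.add (hTw.add (hTr.add
      ((((PolyBdd.const 9).mul hw).add (.const 10)).add (((hr.mul (hl.add (.const 1))).add
        (.const 1)).add ((((PolyBdd.const 2).mul (hw.add (.const 1))).add (.const 3)).add
          (((PolyBdd.const 2).mul hw).add (.const 1))))))))
  have h₀ : (fun _ => [] : ScannerStack → List (Sym S.G)) = ScannerStacks.toFun {} := by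
    funext k; cases k <;> rfl
  have h₁ := does_transfer (S := S) (k := .tmp) (k' := .inp) (by decide)
    (ScannerStacks.toFun { tmp := (x.map Sym.bit).reverse })
  have h₂ := hqp (ScannerStacks.toFun { inp := x.map Sym.bit }) rfl rfl rfl
  have h₃ := hqw (ScannerStacks.toFun { inp := x.map Sym.bit, cert := .replicate (p.eval x.length) Sym.sep }) rfl rfl rfl
  have h₄ := hqr (ScannerStacks.toFun { inp := x.map Sym.bit, cert := .replicate (p.eval x.length) Sym.sep, cnt := .replicate (w.eval x.length) Sym.sep }) rfl rfl rfl
  have h₅ := does_start (S := S) x _ _ hx hp (.replicate (r.eval x.length) Sym.sep)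
  have hL : ∀ r ∈ [S.iniRecord false x (p.eval x.length) (w.eval x.length),
      S.iniRecord true x (p.eval x.length) (w.eval x.length)], r.length = w.eval x.length := by
    intro r hr
    simp only [List.mem_cons, List.not_mem_nil, or_false] at hr
    rcases hr with rfl | rfl <;> simp [iniRecord]
  have h₆ := does_layers hW gs _ N (r.eval x.length) (fun i hi => hlen i hi.le) hL
  have h₇ := does_verdict (S := S) ((layerList (w.eval x.length) gs)^[r.eval x.length]
    [S.iniRecord false x (p.eval x.length) (w.eval x.length),
     S.iniRecord true x (p.eval x.length) (w.eval x.length)])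
    { a := encList ((layerList (w.eval x.length) gs)^[r.eval x.length]
        [S.iniRecord false x (p.eval x.length) (w.eval x.length),
         S.iniRecord true x (p.eval x.length) (w.eval x.length)]),
      cnt := .replicate (w.eval x.length) Sym.sep } rfl
  have h₈ := does_drain (S := S) .cnt (ScannerStacks.toFun { cnt := .replicate (w.eval x.length) Sym.sep, t := [Sym.bit (((layerList (w.eval x.length) gs)^[r.eval x.length]
            [S.iniRecord false x (p.eval x.length) (w.eval x.length),
             S.iniRecord true x (p.eval x.length) (w.eval x.length)]).any fun r => r.any S.good)] })
  have hfin := length_encList (length_of_mem_iterate_layerList gs hL (r.eval x.length))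
  simp only [ScannerStacks.update_cert, ScannerStacks.update_cnt, ScannerStacks.update_rounds,
    ScannerStacks.update_tmp, ScannerStacks.update_inp, ScannerStacks.toFun, List.length_map,
    List.reverse_reverse, List.append_nil, List.length_reverse, List.length_replicate]
    at h₁ h₂ h₃ h₄ h₈
  rw [h₀, ScannerStacks.update_tmp, ScannerStacks.update_t]
  refine (h₁.seq (h₂.seq (h₃.seq (h₄.seq (h₅.seq (h₆.seq (h₇.seq h₈))))))).mono ?_
  -- `layerTime` is affine in the number of records, so for `1 ≤ N` the time for `N` records is at
  -- most `N` times the time for one.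
  have e₁ : layerTime gs.length (w.eval x.length) N ≤
      N * layerTime gs.length (w.eval x.length) 1 := by
    simp only [layerTime, one_mul]
    generalize w.eval x.length = W
    generalize gs.length = g
    have : 1 ≤ N := by omega
    have a₁ : W ≤ N * W := Nat.le_mul_of_pos_left _ this
    have a₂ : g * W ≤ N * (g * W) := Nat.le_mul_of_pos_left _ this
    have a₃ : g ≤ N * g := Nat.le_mul_of_pos_left _ this
    nlinarith
  have e₂ := hlen _ le_rfl
  have e₃ : (encList ((layerList (w.eval x.length) gs)^[r.eval x.length]
    [S.iniRecord false x (p.eval x.length) (w.eval x.length),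
     S.iniRecord true x (p.eval x.length) (w.eval x.length)])).length ≤
      N * (w.eval x.length + 1) := by
    rw [hfin]; exact Nat.mul_le_mul_right _ e₂
  have e₄ : r.eval x.length * (layerTime gs.length (w.eval x.length) N + 1) ≤
      N * (r.eval x.length * (layerTime gs.length (w.eval x.length) 1 + 1)) := by
    rw [Nat.mul_left_comm]
    refine Nat.mul_le_mul_left _ ?_
    rw [mul_add]
    omega
  have key : ∀ a : ℕ, a ≤ N * a := fun a => Nat.le_mul_of_pos_left _ (by omega)
  have k₁ := key x.length
  have k₂ := key (Tp x.length)
  have k₃ := key (Tw x.length)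
  have k₄ := key (Tr x.length)
  have k₅ := key (w.eval x.length)
  simp only [mul_add, mul_one] at *
  have k₆ : ∀ a : ℕ, N * (9 * a) = 9 * (N * a) := fun a => Nat.mul_left_comm _ _ _
  have k₇ : ∀ a : ℕ, N * (2 * a) = 2 * (N * a) := fun a => Nat.mul_left_comm _ _ _
  rw [k₆, k₇, k₇]
  omega

end Scanner

end EPNL

/-! ### Correctness of the sort and of the removal of repetitions -/

namespace EPNL

/-! ### Sorting by keys -/

section Keys

variable {α : Type}

open Scanner (partitionBy)

/-- Successive partitions by the keys `ks`. -/
def sortKeys (ks : List (α → Bool)) (L : List α) : List α := ks.foldl (fun L k => partitionBy k L) L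

/-- Lexicographic refinement of `R` by the keys `ks`, the last of which is the most significant. -/
def lexKeys (R : α → α → Prop) (ks : List (α → Bool)) : α → α → Prop :=
  ks.foldl (fun R k a b => (k a = false ∧ k b = true) ∨ (k a = k b ∧ R a b)) R

theorem partitionBy_perm (k : α → Bool) (L : List α) : (partitionBy k L).Perm L :=
  List.perm_append_comm.trans (List.filter_append_perm k L)

theorem sortKeys_perm (ks : List (α → Bool)) (L : List α) : (sortKeys ks L).Perm L := by
  induction ks generalizing L with
  | nil => exact .refl _
  | cons k ks ih => exact (ih _).trans (partitionBy_perm k L)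

theorem sortKeys_append (ks : List (α → Bool)) (k : α → Bool) (L : List α) :
    sortKeys (ks ++ [k]) L = partitionBy k (sortKeys ks L) := by
  rw [sortKeys, List.foldl_append]
  rfl

/-- The invariant of radix sort: a stable partition orders by the new key and keeps the earlier
order among elements with equal key. -/
theorem pairwise_sortKeys (ks : List (α → Bool)) {R : α → α → Prop} {L : List α}
    (h : L.Pairwise R) : (sortKeys ks L).Pairwise (lexKeys R ks) := by
  induction ks generalizing R L with
  | nil => exact h
  | cons k ks ih =>
    refine ih (R := fun a b => (k a = false ∧ k b = true) ∨ (k a = k b ∧ R a b)) ?_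
    change (L.filter (fun a => !k a) ++ L.filter k).Pairwise _
    rw [List.pairwise_append]
    refine ⟨?_, ?_, ?_⟩
    · refine (List.Pairwise.filter (fun a => !k a) h).imp_of_mem fun {a b} ha hb hab => .inr ⟨?_, hab⟩
      have ha := (List.mem_filter.mp ha).2
      have hb := (List.mem_filter.mp hb).2
      simp_all
    · refine (List.Pairwise.filter k h).imp_of_mem fun {a b} ha hb hab => .inr ⟨?_, hab⟩
      have ha := (List.mem_filter.mp ha).2
      have hb := (List.mem_filter.mp hb).2
      simp_all
    · intro a ha b hb
      have ha := (List.mem_filter.mp ha).2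
      have hb := (List.mem_filter.mp hb).2
      exact .inl ⟨by simpa using ha, hb⟩

theorem lexKeys_antisymm (ks : List (α → Bool)) {R : α → α → Prop} {a b : α}
    (h : lexKeys R ks a b) (h' : lexKeys R ks b a) :
    (∀ k ∈ ks, k a = k b) ∧ R a b ∧ R b a := by
  induction ks generalizing R with
  | nil => exact ⟨by simp, h, h'⟩
  | cons k ks ih =>
    obtain ⟨h₁, h₂, h₃⟩ := ih h h'
    have hk : k a = k b := by
      rcases h₂ with h₂ | h₂
      · rcases h₃ with h₃ | h₃
        · simp_all
        · exact h₃.1.symm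
      · exact h₂.1
    refine ⟨?_, ?_, ?_⟩
    · intro k' hk'
      rcases List.mem_cons.mp hk' with rfl | hk'
      · exact hk
      · exact h₁ k' hk'
    · simpa [hk] using h₂
    · simpa [hk] using h₃

theorem mem_dropRepeated {a b : α} {L : List α} (h : b ∈ L) (hb : b ≠ a) :
    b ∈ dropRepeated a L := by
  induction L generalizing a with
  | nil => simp at h
  | cons c L ih =>
    rw [dropRepeated]
    by_cases hc : b = c
    · subst hc
      rw [if_neg hb]
      exact List.mem_cons_self
    · have hL : b ∈ L := (List.mem_cons.mp h).resolve_left hc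
      split_ifs
      · exact ih hL hc
      · exact List.mem_cons_of_mem _ (ih hL hc)

/-- In a list sorted by a relation that is antisymmetric on its elements, equal elements are
adjacent: whatever lies between two copies of `a` is related to `a` in both directions. -/
theorem nodup_dropRepeated {R : α → α → Prop} (a : α) (L : List α) (h : (a :: L).Pairwise R)
    (hR : ∀ b c, b ∈ a :: L → c ∈ a :: L → R b c → R c b → b = c) :
    (dropRepeated a L).Nodup ∧ a ∉ dropRepeated a L := by
  induction L generalizing a with
  | nil => simp [dropRepeated]
  | cons b L ih =>
    obtain ⟨h₁, h₂⟩ := ih b (List.pairwise_cons.mp h).2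
      fun c d hc hd => hR c d (List.mem_cons_of_mem _ hc) (List.mem_cons_of_mem _ hd)
    rw [dropRepeated]
    split_ifs with hab
    · exact ⟨h₁, hab ▸ h₂⟩
    · refine ⟨List.nodup_cons.mpr ⟨h₂, h₁⟩, ?_⟩
      rw [List.mem_cons, not_or]
      refine ⟨fun e => hab e.symm, fun ha => ?_⟩
      have hmem := mem_of_mem_dropRepeated ha
      have hab' : R a b := (List.pairwise_cons.mp h).1 b List.mem_cons_self
      have hba : R b a := (List.pairwise_cons.mp (List.pairwise_cons.mp h).2).1 a hmem
      exact hab (hR b a (List.mem_cons_of_mem _ List.mem_cons_self) List.mem_cons_self hba hab')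

end Keys

namespace Scanner

variable {S : Scanner}

open Classical in
/-- Whether the letter in position `i` is `g`. -/
noncomputable def letterKey (g : S.G) (i : ℕ) (r : List S.G) : Bool :=
  decide ((r.rotate i).head? = some g)

/-- After `j` rotations the head of a record is its original letter in position `j`, so the next
pass sorts the unrotated records by `letterKey g j`. -/
theorem iterate_rotatePass (g : S.G) (L : List (List S.G)) (j : ℕ) :
    (rotatePass g)^[j] L =
      (sortKeys ((List.range j).map (letterKey g)) L).map fun r => r.rotate j := by
  induction j with
  | zero => simp [sortKeys]
  | succ j ih =>
    rw [Function.iterate_succ_apply', ih, rotatePass, List.range_succ, List.map_append,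
      List.map_singleton, sortKeys_append]
    simp only [partitionBy, List.filter_map, List.map_append, List.map_map]
    congr 2 <;> (funext r; simp [List.rotate_rotate])

theorem iterate_rotatePass_length {W : ℕ} (g : S.G) (L : List (List S.G))
    (h : ∀ r ∈ L, r.length = W) :
    (rotatePass g)^[W] L = sortKeys ((List.range W).map (letterKey g)) L := by
  rw [iterate_rotatePass]
  refine (List.map_congr_left fun r hr => ?_).trans (List.map_id _)
  have := h r ((sortKeys_perm _ _).mem_iff.mp hr)
  rw [← this, List.rotate_length, id]

theorem sortList_eq {W : ℕ} (gs : List S.G) (L : List (List S.G)) (h : ∀ r ∈ L, r.length = W) :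
    sortList W gs L = sortKeys (gs.flatMap fun g => (List.range W).map (letterKey g)) L := by
  induction gs generalizing L with
  | nil => rfl
  | cons g gs ih =>
    have := ih ((rotatePass g)^[W] L) (length_of_mem_iterate_rotatePass h W)
    rw [iterate_rotatePass_length g L h] at this
    rw [List.flatMap_cons, sortKeys, List.foldl_append]
    refine Eq.trans ?_ this
    rw [← iterate_rotatePass_length g L h]
    rfl

theorem mem_sortList {W : ℕ} (gs : List S.G) {L : List (List S.G)} (h : ∀ r ∈ L, r.length = W)
    {r : List S.G} : r ∈ sortList W gs L ↔ r ∈ L := by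
  rw [sortList_eq gs L h]
  exact (sortKeys_perm _ _).mem_iff

/-- The order of the letters is irrelevant; it is enough that the keys, one per letter and position,
together determine a record of length `W`. This makes the lexicographic relation antisymmetric. -/
theorem nodup_dropRepeated_sortList {W : ℕ} (hW : 0 < W) (gs : List S.G) (hgs : ∀ g, g ∈ gs)
    (L : List (List S.G)) (h : ∀ r ∈ L, r.length = W) :
    (dropRepeated [] (sortList W gs L)).Nodup := by
  have hlen := length_of_mem_sortList gs h
  have hp : (sortList W gs L).Pairwise
      (lexKeys (fun _ _ => True) (gs.flatMap fun g => (List.range W).map (letterKey g))) := by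
    rw [sortList_eq gs L h]
    exact pairwise_sortKeys _ (List.pairwise_of_forall fun _ _ => trivial)
  generalize sortList W gs L = L' at hlen hp
  cases L' with
  | nil => simp [dropRepeated]
  | cons r L' =>
    have hr : r ≠ [] := fun e => by
      have := hlen r List.mem_cons_self
      rw [e, List.length_nil] at this
      omega
    rw [dropRepeated, if_neg hr]
    have := nodup_dropRepeated r L' hp fun b d hb hd hbd hdb => by
      have hk := (lexKeys_antisymm _ hbd hdb).1
      refine List.ext_getElem? fun i => ?_
      rcases Nat.lt_or_ge i W with hi | hi
      · have hb' : i < b.length := by rw [hlen b hb]; exact hi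
        have hd' : i < d.length := by rw [hlen d hd]; exact hi
        -- The key for the letter of `b` in position `i` is true for `b`, hence for `d`.
        have := hk (letterKey b[i] i) (List.mem_flatMap.mpr ⟨_, hgs _, List.mem_map.mpr
          ⟨i, List.mem_range.mpr hi, rfl⟩⟩)
        rw [letterKey, letterKey, List.head?_rotate hb', List.head?_rotate hd'] at this
        have h' : d[i]? = some b[i] := by simpa using this.symm
        rw [h', List.getElem?_eq_getElem hb']
      · rw [List.getElem?_eq_none (by rw [hlen b hb]; exact hi),
          List.getElem?_eq_none (by rw [hlen d hd]; exact hi)]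
    exact List.nodup_cons.mpr ⟨this.2, this.1⟩

theorem mem_layerList {W : ℕ} (hW : 0 < W) (gs : List S.G) {L : List (List S.G)}
    (h : ∀ r ∈ L, r.length = W) {r : List S.G} :
    r ∈ layerList W gs L ↔ ∃ r' ∈ L, ∃ b, r = S.image b r' := by
  have hd : ∀ r', r' ∈ dropRepeated [] (sortList W gs L) ↔ r' ∈ L := fun r' =>
    ⟨fun hr => (mem_sortList gs h).mp (mem_of_mem_dropRepeated hr), fun hr =>
      mem_dropRepeated ((mem_sortList gs h).mpr hr) fun e => by
        have := h r' hr
        rw [e, List.length_nil] at this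
        omega⟩
  simp only [layerList, List.mem_append, List.mem_map, hd]
  constructor
  · rintro (⟨r', hr', rfl⟩ | ⟨r', hr', rfl⟩)
    exacts [⟨r', hr', _, rfl⟩, ⟨r', hr', _, rfl⟩]
  · rintro ⟨r', hr', b, rfl⟩
    cases b
    exacts [.inl ⟨r', hr', rfl⟩, .inr ⟨r', hr', rfl⟩]

/-- Without the removal of repetitions the layers could double in each step. Here the bound is two
images for each element of a set that contains the records, whatever the length of `L`. -/
theorem length_layerList_le {W : ℕ} (hW : 0 < W) (gs : List S.G) (hgs : ∀ g, g ∈ gs)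
    {L : List (List S.G)} (h : ∀ r ∈ L, r.length = W) (F : Finset (List S.G))
    (hF : ∀ r ∈ L, r ∈ F) : (layerList W gs L).length ≤ 2 * F.card := by
  classical
  have hn := nodup_dropRepeated_sortList hW gs hgs L h
  have : (dropRepeated [] (sortList W gs L)).length ≤ F.card := by
    rw [← List.toFinset_card_of_nodup hn]
    refine Finset.card_le_card fun r hr => hF r ?_
    exact (mem_sortList gs h).mp (mem_of_mem_dropRepeated (List.mem_toFinset.mp hr))
  rw [layerList, List.length_append, List.length_map, List.length_map]
  omega

end Scanner

end EPNL

/-! ### A step of the verifier as a rewriting of records -/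

namespace EPNL

/-! ### The scanner that simulates a verifier -/

theorem getElem?_mapPrev {α β : Type} (f : Option α → α → β) (o : Option α) (l : List α) (i : ℕ) :
    (mapPrev f o l)[i]? = l[i]?.map (f (if i = 0 then o else l[i - 1]?)) := by
  induction l generalizing o i with
  | nil => rfl
  | cons a l ih =>
    cases i with
    | zero => rfl
    | succ i =>
      rw [mapPrev, List.getElem?_cons_succ, ih, List.getElem?_cons_succ]
      cases i <;> rfl

theorem Scanner.getElem?_middle (S : Scanner) (r : List S.G) (i : ℕ) :
    (S.middle r)[i]? = r[i]?.map (S.back (S.info r) r[i + 1]?) := by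
  rcases Nat.lt_or_ge i r.length with hi | hi
  · rw [middle, List.getElem?_reverse (by simpa using hi), getElem?_mapPrev,
      List.getElem?_reverse (by simp; omega)]
    simp only [length_mapPrev, List.length_reverse]
    rw [List.getElem?_reverse (by omega), show r.length - 1 - (r.length - 1 - i) = i by omega]
    split_ifs with h
    · rw [List.getElem?_eq_none (show r.length ≤ i + 1 by omega)]
    · rw [show r.length - 1 - (r.length - 1 - i - 1) = i + 1 by omega]
  · rw [List.getElem?_eq_none (by simpa [middle] using hi), List.getElem?_eq_none hi]
    rfl

/-- Describes the three passes position by position: a new letter depends on the collected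
information and on the old letters in positions `i - 1`, `i` and `i + 1`. -/
theorem Scanner.image_map_range (S : Scanner) (b : Bool) {W : ℕ} (f f' : ℕ → S.G)
    (h : ∀ i < W, f' i = S.forth (S.info ((List.range W).map f)) b
      (if i = 0 then none else some (S.back (S.info ((List.range W).map f))
        (if i - 1 + 1 < W then some (f (i - 1 + 1)) else none) (f (i - 1))))
      (S.back (S.info ((List.range W).map f)) (if i + 1 < W then some (f (i + 1)) else none) (f i))) :
    S.image b ((List.range W).map f) = (List.range W).map f' := by
  have hf : ∀ i, ((List.range W).map f)[i]? = if i < W then some (f i) else none := by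
    intro i
    split_ifs with hi
    · simp [List.getElem?_range hi]
    · simpa using hi
  have hm : ∀ i < W, (S.middle ((List.range W).map f))[i]? =
      some (S.back (S.info ((List.range W).map f))
        (if i + 1 < W then some (f (i + 1)) else none) (f i)) := by
    intro i hi
    rw [getElem?_middle, hf, hf, if_pos hi]
    rfl
  refine List.ext_getElem? fun i => ?_
  rcases Nat.lt_or_ge i W with hi | hi
  · rw [image, getElem?_mapPrev, hm i hi, List.getElem?_map, List.getElem?_range hi, Option.map_some,
      Option.map_some, h i hi]
    by_cases h0 : i = 0
    · rw [if_pos h0, if_pos h0]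
    · rw [if_neg h0, if_neg h0, hm (i - 1) (by omega)]
  · rw [List.getElem?_eq_none (by simpa using hi), List.getElem?_eq_none (by simpa using hi)]

namespace Move

def isLeft : Move → Bool
  | left => true
  | _ => false

def isRight : Move → Bool
  | right => true
  | _ => false

end Move

/-- The presence of a head after a left move; the arguments tell whether the move takes place,
whether the head was in the next cell, whether the cell is the first one, and whether the head was
in the cell. -/
def headLeft (b next first here : Bool) : Bool := if b then next || (first && here) else here

/-- A head is moved in two stages: left moves in the pass that knows the next cell, right moves in
the pass that knows the previous one. At most one stage is active, and the marker of the first cell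
keeps a head from leaving on the left. -/
theorem headLeft_shift (d : Move) {l b : Bool} {W h i : ℕ} (hh : h < W) (hi : i < W)
    (hl : l = d.isLeft) (hb : b = d.isRight) (m : ℕ → Bool)
    (hm : ∀ j, m j = headLeft l (if j + 1 < W then decide (h = j + 1) else false)
      (decide (j = 0)) (decide (h = j))) :
    (if b then (if i = 0 then false else m (i - 1)) else m i) = true ↔ d.shift h = i := by
  subst hl hb
  cases d with
  | left =>
    simp only [Move.isRight, hm, headLeft, Move.isLeft, Move.shift, if_true, Bool.false_eq_true,
      if_false]
    split_ifs <;> simp <;> omega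
  | stay => simp [Move.isRight, hm, headLeft, Move.isLeft, Move.shift]
  | right =>
    simp only [Move.isRight, hm, headLeft, Move.isLeft, Move.shift, if_true, Bool.false_eq_true,
      if_false]
    split_ifs <;> simp <;> omega

namespace Verifier

/-- What a machine sees in one step; `guess` is the scanned certificate symbol, which counts only if
`live` holds. -/
structure View (Q : Type) where
  q : Q
  guess : Bool
  inp : Option Bool
  kBit : Bool
  lBit : Bool
  live : Bool

/-- The contents of one cell of each of the tapes and the presence of the heads. -/
structure Letter (Q : Type) where
  view : View Q
  inHere : Bool
  kHere : Bool
  lHere : Bool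
  certHere : Bool
  first : Bool

instance {Q : Type} [Finite Q] : Finite (View Q) :=
  Finite.of_injective (fun v : View Q => (v.q, v.guess, v.inp, v.kBit, v.lBit, v.live)) (by
    rintro ⟨⟩ ⟨⟩ h
    simpa using h)

instance {Q : Type} [Finite Q] : Finite (Letter Q) :=
  Finite.of_injective
    (fun v : Letter Q => (v.view, v.inHere, v.kHere, v.lHere, v.certHere, v.first)) (by
      rintro ⟨⟩ ⟨⟩ h
      simpa using h)

variable (M : Verifier)

/-- The action in a situation; a halted machine leaves everything as it is. -/
def act (v : View M.Q) : VerifierAction M.Q :=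
  match M.output v.q with
  | some _ => ⟨v.q, v.kBit, v.lBit, .stay, .stay, .stay, false⟩
  | none => M.δ v.q v.inp (if v.live then some v.guess else none) v.kBit v.lBit

/-- Configurations in which the scanned certificate symbol is a guess. -/
structure GuessCfg (M : Verifier) where
  q : M.Q
  guess : Bool
  inHead : ℕ
  kTape : WorkTape
  lTape : WorkTape
  certHead : ℕ

variable {M} in
def GuessCfg.view (x : List Bool) (P : ℕ) (c : M.GuessCfg) : View M.Q :=
  ⟨c.q, c.guess, x[c.inHead]?, c.kTape.read, c.lTape.read, decide (c.certHead < P)⟩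

/-- The successor of a configuration when `g` is the next guess. -/
def guessStep (x : List Bool) (P : ℕ) (g : Bool) (c : M.GuessCfg) : M.GuessCfg where
  q := (M.act (c.view x P)).next
  guess := if (M.act (c.view x P)).certAdvance then g else c.guess
  inHead := inputShift x (M.act (c.view x P)).inMove c.inHead
  kTape := c.kTape.act (M.act (c.view x P)).kWrite (M.act (c.view x P)).kMove
  lTape := c.lTape.act (M.act (c.view x P)).lWrite (M.act (c.view x P)).lMove
  certHead := if (M.act (c.view x P)).certAdvance && decide (c.certHead < P) then c.certHead + 1
    else c.certHead

variable {M} in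
def GuessCfg.letter (x : List Bool) (P : ℕ) (c : M.GuessCfg) (i : ℕ) : Letter M.Q where
  view := ⟨c.q, c.guess, x[i]?, c.kTape.cells i, c.lTape.cells i, decide (i < P)⟩
  inHere := decide (c.inHead = i)
  kHere := decide (c.kTape.head = i)
  lHere := decide (c.lTape.head = i)
  certHere := decide (c.certHead = i)
  first := decide (i = 0)

variable {M} in
/-- The record of the first `W` cells of all tapes. -/
def GuessCfg.record (x : List Bool) (P W : ℕ) (c : M.GuessCfg) : List (Letter M.Q) :=
  (List.range W).map (c.letter x P)

def guessInit (b : Bool) : M.GuessCfg := ⟨M.start, b, 0, .blank, .blank, 0⟩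

/-- State and guess are repeated in every letter. The first pass picks up the symbols under the
heads, which determine the action; the second pass writes and moves heads left, the third moves
heads right and installs the new state and guess. The input head moves right only if it is not on
the end marker, and the certificate head only while it is inside the certificate. -/
def scanner : Scanner where
  G := Letter M.Q
  A := View M.Q
  finiteG := have := M.finite; inferInstance
  finiteA := have := M.finite; inferInstance
  acc := ⟨M.start, false, none, false, false, false⟩
  collect v τ :=
    { q := τ.view.q
      guess := τ.view.guess
      inp := if τ.inHere then τ.view.inp else v.inp
      kBit := if τ.kHere then τ.view.kBit else v.kBit
      lBit := if τ.lHere then τ.view.lBit else v.lBit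
      live := if τ.certHere then τ.view.live else v.live }
  back v next τ :=
    { view :=
        { τ.view with
          kBit := if τ.kHere then (M.act v).kWrite else τ.view.kBit
          lBit := if τ.lHere then (M.act v).lWrite else τ.view.lBit }
      inHere := headLeft (M.act v).inMove.isLeft (next.elim false Letter.inHere) τ.first τ.inHere
      kHere := headLeft (M.act v).kMove.isLeft (next.elim false Letter.kHere) τ.first τ.kHere
      lHere := headLeft (M.act v).lMove.isLeft (next.elim false Letter.lHere) τ.first τ.lHere
      certHere := τ.certHere
      first := τ.first }
  forth v g prev τ :=
    { view :=
        { τ.view with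
          q := (M.act v).next
          guess := if (M.act v).certAdvance then g else τ.view.guess }
      inHere := if (M.act v).inMove.isRight && v.inp.isSome then prev.elim false Letter.inHere
        else τ.inHere
      kHere := if (M.act v).kMove.isRight then prev.elim false Letter.kHere else τ.kHere
      lHere := if (M.act v).lMove.isRight then prev.elim false Letter.lHere else τ.lHere
      certHere := if (M.act v).certAdvance && v.live then prev.elim false Letter.certHere
        else τ.certHere
      first := τ.first }
  ini b first a live := ⟨⟨M.start, b, a, false, false, live⟩, first, first, first, first, first⟩
  good τ := decide (M.output τ.view.q = some true)

variable {M}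

theorem iniRecord_eq (b : Bool) (x : List Bool) (P W : ℕ) :
    M.scanner.iniRecord b x P W = (M.guessInit b).record x P W := by
  refine List.map_congr_left fun i _ => ?_
  have : (i == 0) = decide (0 = i) := by rw [Bool.eq_iff_iff, beq_iff_eq, decide_eq_true_iff, eq_comm]
  exact (Letter.mk.injEq ..).mpr ⟨rfl, this, this, this, this, rfl⟩

theorem any_record {x : List Bool} {P W : ℕ} (hW : 0 < W) (c : M.GuessCfg) :
    (c.record x P W).any M.scanner.good = decide (M.output c.q = some true) := by
  rw [Bool.eq_iff_iff]
  refine List.any_eq_true.trans ?_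
  simp only [GuessCfg.record, List.mem_map, List.mem_range]
  constructor
  · rintro ⟨_, ⟨i, _, rfl⟩, h⟩
    exact h
  · exact fun h => ⟨_, ⟨0, hW, rfl⟩, h⟩

/-- Each component of the collected information is overwritten exactly in the cell of the
corresponding head, so after cells `0, …, n` it is correct iff the head has been met; otherwise it
is the default. -/
theorem info_record {x : List Bool} {P W : ℕ} {c : M.GuessCfg} (h₁ : c.inHead < W)
    (h₂ : c.kTape.head < W) (h₃ : c.lTape.head < W) (h₄ : c.certHead < W) :
    M.scanner.info (c.record x P W) = c.view x P := by
  have key : ∀ n, M.scanner.info (c.record x P (n + 1)) =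
      ⟨c.q, c.guess, if c.inHead ≤ n then x[c.inHead]? else none,
        if c.kTape.head ≤ n then c.kTape.read else false,
        if c.lTape.head ≤ n then c.lTape.read else false,
        if c.certHead ≤ n then decide (c.certHead < P) else false⟩ := by
    have step : ∀ n, M.scanner.info (c.record x P (n + 1)) =
        M.scanner.collect (M.scanner.info (c.record x P n)) (c.letter x P n) := by
      intro n
      change List.foldl _ _ ((List.range (n + 1)).map (c.letter x P)) = _
      rw [List.range_succ, List.map_append]
      exact List.foldl_append
    have aux : ∀ {α : Type} (f : ℕ → α) (a : α) (h n : ℕ),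
        (if decide (h = n + 1) = true then f (n + 1) else if h ≤ n then f h else a) =
          if h ≤ n + 1 then f h else a := by
      intro α f a h n
      rcases lt_trichotomy h (n + 1) with hn | rfl | hn
      · rw [if_neg (by simp; omega), if_pos (by omega), if_pos (by omega)]
      · simp
      · rw [if_neg (by simp; omega), if_neg (by omega), if_neg (by omega)]
    have aux₀ : ∀ {α : Type} (f : ℕ → α) (a : α) (h : ℕ),
        (if decide (h = 0) = true then f 0 else a) = if h ≤ 0 then f h else a := by
      intro α f a h
      cases h <;> simp
    intro n
    induction n with
    | zero =>
      rw [step]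
      simp only [scanner, GuessCfg.letter, View.mk.injEq, true_and]
      exact ⟨aux₀ (fun i => x[i]?) _ _, aux₀ c.kTape.cells _ _, aux₀ c.lTape.cells _ _,
        aux₀ (fun i => decide (i < P)) _ _⟩
    | succ n ih =>
      rw [step, ih]
      simp only [scanner, GuessCfg.letter, View.mk.injEq, true_and]
      exact ⟨aux (fun i => x[i]?) _ _ _, aux c.kTape.cells _ _ _, aux c.lTape.cells _ _ _,
        aux (fun i => decide (i < P)) _ _ _⟩
  obtain ⟨n, rfl⟩ : ∃ n, W = n + 1 := ⟨W - 1, by omega⟩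
  rw [key n, if_pos (by omega), if_pos (by omega), if_pos (by omega), if_pos (by omega)]
  rfl

theorem image_record {x : List Bool} {P W : ℕ} {c : M.GuessCfg} (g : Bool) (h₁ : c.inHead < W)
    (h₂ : c.kTape.head < W) (h₃ : c.lTape.head < W) (h₄ : c.certHead < W)
    (h₅ : c.inHead ≤ x.length) :
    M.scanner.image g (c.record x P W) = (M.guessStep x P g c).record x P W := by
  refine M.scanner.image_map_range g _ _ fun i hi => ?_
  have hinfo : M.scanner.info ((List.range W).map (c.letter x P)) = c.view x P :=
    info_record h₁ h₂ h₃ h₄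
  have key : ∀ (d : Move) {l b : Bool} (h : ℕ), h < W → l = d.isLeft → b = d.isRight →
      ((if b then (if i = 0 then false else headLeft l (if i - 1 + 1 < W then
          decide (h = i - 1 + 1) else false) (decide (i - 1 = 0)) (decide (h = i - 1)))
        else headLeft l (if i + 1 < W then decide (h = i + 1) else false) (decide (i = 0))
          (decide (h = i))) = true ↔ d.shift h = i) := fun d l b h hh hl hb =>
    headLeft_shift d hh hi hl hb (fun j => headLeft l (if j + 1 < W then decide (h = j + 1) else false)
      (decide (j = 0)) (decide (h = j))) fun _ => rfl
  rw [hinfo]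
  simp only [scanner, GuessCfg.letter, guessStep, WorkTape.act, Letter.mk.injEq, View.mk.injEq,
    true_and, and_true]
  have e₁ : ∀ (p : Prop) [Decidable p] (a : Letter M.Q) (f : Letter M.Q → Bool),
      (if p then none else some a).elim false f = if p then false else f a := by
    intro p _ a f
    split_ifs <;> rfl
  have e₂ : ∀ (p : Prop) [Decidable p] (a : Letter M.Q) (f : Letter M.Q → Bool),
      (if p then some a else none).elim false f = if p then f a else false := by
    intro p _ a f
    split_ifs <;> rfl
  simp only [e₁, e₂]
  refine ⟨⟨?_, ?_⟩, ?_, ?_, ?_, ?_⟩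
  · simp [Function.update_apply, eq_comm]
  · simp [Function.update_apply, eq_comm]
  · refine Bool.eq_iff_iff.mpr (decide_eq_true_iff.trans ?_)
    -- On the end marker a right move has no effect, both by the truncation in `inputShift` and by
    -- the test in `forth`; elsewhere the truncation is not active.
    rcases hx : x[c.inHead]? with _ | a
    · have hx' : c.inHead = x.length := le_antisymm h₅ (List.getElem?_eq_none_iff.mp hx)
      have hv : (c.view x P).inp = none := hx
      rw [hv]
      cases hd : (M.act (c.view x P)).inMove
      · refine Iff.trans ?_ (key .left c.inHead h₁ rfl rfl).symm
        simp [inputShift, Move.shift, hx']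
      · refine Iff.trans ?_ (key .stay c.inHead h₁ rfl rfl).symm
        simp [inputShift, Move.shift, hx']
      · refine Iff.trans ?_ (key .stay c.inHead h₁ rfl rfl).symm
        simp [inputShift, Move.shift, hx']
    · have hv : (c.view x P).inp = some a := hx
      rw [hv]
      refine Iff.trans ?_ (key _ c.inHead h₁ rfl (by simp)).symm
      obtain ⟨hlt, _⟩ := List.getElem?_eq_some_iff.mp hx
      have : (M.act (c.view x P)).inMove.shift c.inHead ≤ x.length := by
        cases (M.act (c.view x P)).inMove <;> simp only [Move.shift] <;> omega
      rw [inputShift, min_eq_left this]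
  · refine Bool.eq_iff_iff.mpr (decide_eq_true_iff.trans ?_)
    exact (key _ _ h₂ rfl rfl).symm
  · refine Bool.eq_iff_iff.mpr (decide_eq_true_iff.trans ?_)
    exact (key _ _ h₃ rfl rfl).symm
  · have hv : (c.view x P).live = decide (c.certHead < P) := rfl
    rw [hv]
    refine Bool.eq_iff_iff.mpr (decide_eq_true_iff.trans ?_)
    cases (M.act (c.view x P)).certAdvance && decide (c.certHead < P)
    · simp
    · simp only [if_true]
      split_ifs <;> simp <;> omega

/-- The configurations that can be reached in `t` steps. -/
inductive Guessed (M : Verifier) (x : List Bool) (P : ℕ) : ℕ → M.GuessCfg → Prop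
  | init (b : Bool) : Guessed M x P 0 (M.guessInit b)
  | step {t : ℕ} {c : M.GuessCfg} (g : Bool) :
      Guessed M x P t c → Guessed M x P (t + 1) (M.guessStep x P g c)

/-- The configuration `d` is `c` where the guess comes from the certificate `y`. -/
structure Agrees (y : List Bool) (P : ℕ) (d : M.Cfg) (c : M.GuessCfg) : Prop where
  state : d.state = c.q
  inHead : d.inHead = c.inHead
  kTape : d.kTape = c.kTape
  lTape : d.lTape = c.lTape
  cert : d.cert = y.drop c.certHead
  guess : c.certHead < P → y[c.certHead]? = some c.guess

/-- A halted machine rewrites the scanned bits and keeps its heads in place, which changes nothing;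
so halted and running configurations can be treated alike. -/
theorem step_eq (x : List Bool) (d : M.Cfg) (c : M.GuessCfg) {y : List Bool} {P : ℕ}
    (hy : y.length = P) (h : Agrees y P d c) (hx : c.inHead ≤ x.length) :
    M.step x d = M.perform x d (M.act (c.view x P)) := by
  have hc : d.cert.head? = if decide (c.certHead < P) then some c.guess else none := by
    rw [h.cert, List.head?_drop]
    by_cases hP : c.certHead < P
    · simp [hP, h.guess hP]
    · simp only [hP, decide_false, Bool.false_eq_true, if_false]
      exact List.getElem?_eq_none (by omega)
  rw [step, act, show (c.view x P).q = d.state from h.state.symm]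
  cases M.output d.state with
  | none =>
    simp only [GuessCfg.view, hc, h.inHead, h.kTape, h.lTape]
    rfl
  | some b =>
    obtain ⟨h₁, h₂, h₃, h₄, h₅, h₆⟩ := h
    cases d
    simp only at h₁ h₂ h₃ h₄ h₅
    subst h₁ h₂ h₃ h₄ h₅
    simp only [perform, GuessCfg.view, inputShift, Move.shift, WorkTape.act, WorkTape.read,
      Function.update_eq_self, min_eq_left hx, Bool.false_eq_true, if_false]

theorem Agrees.step {x y : List Bool} {P : ℕ} {d : M.Cfg} {c : M.GuessCfg} (h : Agrees y P d c)
    (hy : y.length = P) (hx : c.inHead ≤ x.length) (hP : c.certHead ≤ P) {g : Bool}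
    (hg : (M.act (c.view x P)).certAdvance = true → c.certHead + 1 < P → y[c.certHead + 1]? = some g) :
    Agrees y P (M.step x d) (M.guessStep x P g c) := by
  rw [step_eq x d c hy h hx]
  refine ⟨rfl, ?_, ?_, ?_, ?_, ?_⟩
  · simp [perform, guessStep, h.inHead]
  · simp [perform, guessStep, h.kTape]
  · simp [perform, guessStep, h.lTape]
  · simp only [perform, guessStep, h.cert]
    cases (M.act (c.view x P)).certAdvance
    · rfl
    · by_cases hc : c.certHead < P
      · simp [hc]
      · simp only [if_true, hc, decide_false, Bool.and_false, Bool.false_eq_true, if_false]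
        rw [List.drop_eq_nil_of_le (by omega)]
        rfl
  · simp only [guessStep]
    cases ha : (M.act (c.view x P)).certAdvance
    · exact h.guess
    · by_cases hc : c.certHead < P
      · simpa [hc] using hg ha
      · simp [hc]

theorem Guessed.inHead_le {x : List Bool} {P t : ℕ} {c : M.GuessCfg} (h : M.Guessed x P t c) :
    c.inHead ≤ x.length := by
  cases h with
  | init b => exact Nat.zero_le _
  | step g h => exact min_le_right _ _

theorem Guessed.certHead_le {x : List Bool} {P t : ℕ} {c : M.GuessCfg} (h : M.Guessed x P t c) :
    c.certHead ≤ P := by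
  induction h with
  | init b => exact Nat.zero_le _
  | step g h ih =>
    simp only [guessStep]
    split_ifs with hc
    · simp only [Bool.and_eq_true, decide_eq_true_iff] at hc
      omega
    · exact ih

theorem shift_le (d : Move) (h : ℕ) : d.shift h ≤ h + 1 := by
  cases d <;> simp only [Move.shift] <;> omega

theorem Guessed.kHead_le {x : List Bool} {P t : ℕ} {c : M.GuessCfg} (h : M.Guessed x P t c) :
    c.kTape.head ≤ t := by
  induction h with
  | init b => exact Nat.zero_le _
  | step g h ih => exact (shift_le _ _).trans (Nat.succ_le_succ ih)

theorem Guessed.lHead_le {x : List Bool} {P t : ℕ} {c : M.GuessCfg} (h : M.Guessed x P t c) :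
    c.lTape.head ≤ t := by
  induction h with
  | init b => exact Nat.zero_le _
  | step g h ih => exact (shift_le _ _).trans (Nat.succ_le_succ ih)

theorem cfgAt_succ (x y : List Bool) (t : ℕ) :
    M.cfgAt x y (t + 1) = M.step x (M.cfgAt x y t) := Function.iterate_succ_apply' _ _ _

theorem exists_guessed (x : List Bool) {y : List Bool} {P : ℕ} (hy : y.length = P) (t : ℕ) :
    ∃ c, M.Guessed x P t c ∧ Agrees y P (M.cfgAt x y t) c := by
  induction t with
  | zero =>
    refine ⟨_, .init (y[0]?.getD false), rfl, rfl, rfl, rfl, rfl, fun h => ?_⟩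
    have : 0 < y.length := hy ▸ h
    simp [guessInit, List.getElem?_eq_getElem this]
  | succ t ih =>
    obtain ⟨c, hc, h⟩ := ih
    refine ⟨_, .step (y[c.certHead + 1]?.getD false) hc, ?_⟩
    rw [cfgAt_succ]
    refine h.step hy hc.inHead_le hc.certHead_le fun _ h => ?_
    rw [List.getElem?_eq_getElem (hy ▸ h)]
    rfl

/-- The guesses made so far form a prefix `z` of the certificate, up to and including the scanned
cell. A new guess concerns a cell never seen before, because the head does not move back, so it
extends `z` without affecting the past. -/
theorem Guessed.exists_certificate {x : List Bool} {P t : ℕ} {c : M.GuessCfg}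
    (h : M.Guessed x P t c) :
    ∃ z : List Bool, z.length = min (c.certHead + 1) P ∧
      ∀ y, y.length = P → z <+: y → Agrees y P (M.cfgAt x y t) c := by
  induction h with
  | init b =>
    refine ⟨[b].take P, by simp [guessInit, min_comm], fun y hy hz => ⟨rfl, rfl, rfl, rfl, rfl, fun hP => ?_⟩⟩
    obtain ⟨y', rfl⟩ := hz
    obtain ⟨P, rfl⟩ : ∃ Q, P = Q + 1 := ⟨P - 1, by simp only [guessInit] at hP; omega⟩
    simp [guessInit]
  | @step t c g h ih =>
    obtain ⟨z, hz, ih⟩ := ih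
    have hle := h.certHead_le
    -- A guess counts only if the head advances to another cell of the certificate; in all other
    -- cases it is discarded or stands for the end marker.
    by_cases hg : (M.act (c.view x P)).certAdvance = true ∧ c.certHead + 1 < P
    · have hc : (M.guessStep x P g c).certHead = c.certHead + 1 := by
        simp only [guessStep, hg.1]
        rw [if_pos (by simp; omega)]
      refine ⟨z ++ [g], ?_, fun y hy hzy => ?_⟩
      · rw [hc, List.length_append, hz, List.length_singleton]
        omega
      · rw [cfgAt_succ]
        refine (ih y hy ((List.prefix_append z [g]).trans hzy)).step hy h.inHead_le hle fun _ _ => ?_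
        obtain ⟨y', rfl⟩ := hzy
        rw [List.append_assoc, List.getElem?_append_right (by omega)]
        simp [hz, min_eq_left hg.2.le]
    · refine ⟨z, ?_, fun y hy hzy => ?_⟩
      · rw [hz]
        simp only [guessStep]
        split_ifs with hc
        · simp only [Bool.and_eq_true, decide_eq_true_iff] at hc
          have : ¬ c.certHead + 1 < P := fun h => hg ⟨hc.1, h⟩
          omega
        · rfl
      · rw [cfgAt_succ]
        exact (ih y hy hzy).step hy h.inHead_le hle fun h₁ h₂ => absurd ⟨h₁, h₂⟩ hg

end Verifier

end EPNL

/-! ### The number of configurations and the algorithm in time `2 ^ k` -/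

namespace EPNL

namespace Verifier

variable {M : Verifier}

theorem OutputsWithin.mono {x y : List Bool} {b : Bool} {t t' : ℕ} (h : M.OutputsWithin x y b t)
    (ht : t ≤ t') : M.OutputsWithin x y b t' := by
  induction t', ht using Nat.le_induction with
  | base => exact h
  | succ n _ ih =>
    rw [OutputsWithin] at ih ⊢
    rw [cfgAt_succ, step, ih]
    exact ih

theorem Accepts.outputsWithin {x y : List Bool} {b : Bool} {t : ℕ} (h : M.Accepts x y)
    (hb : M.OutputsWithin x y b t) : M.OutputsWithin x y true t := by
  obtain ⟨t', ht'⟩ := h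
  have h₁ := ht'.mono (le_max_right t t')
  have h₂ := hb.mono (le_max_left t t')
  rw [OutputsWithin] at h₁ h₂
  rw [h₁] at h₂
  rwa [← Option.some.inj h₂] at hb

theorem Guessed.exists_agrees {x : List Bool} {P t : ℕ} {c : M.GuessCfg}
    (h : M.Guessed x P t c) : ∃ y, y.length = P ∧ Agrees y P (M.cfgAt x y t) c := by
  obtain ⟨z, hz, hy⟩ := h.exists_certificate
  have : (z ++ List.replicate (P - z.length) false).length = P := by
    rw [List.length_append, List.length_replicate]
    omega
  exact ⟨_, this, hy _ this (List.prefix_append _ _)⟩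

theorem kTape_cells_eq_false {x y : List Bool} {s : ℕ} (h : ∀ t, (M.cfgAt x y t).kTape.Within s)
    (t i : ℕ) (hi : s ≤ i) : (M.cfgAt x y t).kTape.cells i = false := by
  refine WorkTape.cells_eq_false (T := fun t => (M.cfgAt x y t).kTape) rfl (fun t => ?_) h t i hi
  simp only [cfgAt_succ, step]
  cases M.output (M.cfgAt x y t).state with
  | some _ => exact .inl rfl
  | none => exact .inr ⟨_, _, rfl⟩

theorem lTape_cells_eq_false {x y : List Bool} {s : ℕ} (h : ∀ t, (M.cfgAt x y t).lTape.Within s)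
    (t i : ℕ) (hi : s ≤ i) : (M.cfgAt x y t).lTape.cells i = false := by
  refine WorkTape.cells_eq_false (T := fun t => (M.cfgAt x y t).lTape) rfl (fun t => ?_) h t i hi
  simp only [cfgAt_succ, step]
  cases M.output (M.cfgAt x y t).state with
  | some _ => exact .inl rfl
  | none => exact .inr ⟨_, _, rfl⟩

open Classical in
/-- The records of the reachable configurations belong to a set whose size is bounded in terms of
the space that the machine uses. -/
theorem exists_records (M : Verifier) {x : List Bool} {P k l : ℕ} (W T : ℕ)
    (hk : ∀ y, y.length = P → ∀ t, (M.cfgAt x y t).kTape.Within k)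
    (hl : ∀ y, y.length = P → ∀ t, (M.cfgAt x y t).lTape.Within l) :
    ∃ F : Finset (List (Letter M.Q)),
      F.card ≤ Nat.card M.Q * (2 * ((x.length + 1) *
        (((T + 1) * 2 ^ k) * (((T + 1) * 2 ^ l) * (P + 1))))) ∧
      ∀ t ≤ T, ∀ c, M.Guessed x P t c → c.record x P W ∈ F := by
  have := M.finite
  have := Fintype.ofFinite M.Q
  refine ⟨((Finset.univ : Finset M.Q) ×ˢ ((Finset.univ : Finset Bool) ×ˢ
    (Finset.range (x.length + 1) ×ˢ (tapes (T + 1) k ×ˢ (tapes (T + 1) l ×ˢ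
      Finset.range (P + 1)))))).image fun a => GuessCfg.record x P W
        (⟨a.1, a.2.1, a.2.2.1, a.2.2.2.1, a.2.2.2.2.1, a.2.2.2.2.2⟩ : M.GuessCfg), ?_, ?_⟩
  · refine Finset.card_image_le.trans ?_
    simp only [Finset.card_product, Finset.card_univ, Finset.card_range, Fintype.card_bool,
      Nat.card_eq_fintype_card]
    gcongr
    · exact card_tapes_le _ _
    · exact card_tapes_le _ _
  · intro t ht c hc
    -- The space bounds are only known for genuine runs, so the configuration is first identified
    -- with one on an actual certificate of length `P`.
    obtain ⟨y, hy, h⟩ := hc.exists_agrees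
    refine Finset.mem_image.mpr ⟨⟨c.q, c.guess, c.inHead, c.kTape, c.lTape, c.certHead⟩, ?_, rfl⟩
    have h₁ := hc.inHead_le
    have h₂ := hc.kHead_le
    have h₃ := hc.lHead_le
    have h₄ := hc.certHead_le
    simp only [Finset.mem_product, Finset.mem_univ, Finset.mem_range, true_and]
    refine ⟨by omega, mem_tapes (by omega) fun i hi => ?_, mem_tapes (by omega) fun i hi => ?_,
      by omega⟩
    · rw [← h.kTape]
      exact kTape_cells_eq_false (hk y hy) t i hi
    · rw [← h.lTape]
      exact lTape_cells_eq_false (hl y hy) t i hi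

/-- The records of the configurations in which the machine can be after `t` steps. -/
noncomputable def layer (M : Verifier) (x : List Bool) (P W : ℕ) (gs : List (Letter M.Q)) (t : ℕ) :
    List (List M.scanner.G) :=
  (Scanner.layerList W gs)^[t] [M.scanner.iniRecord false x P W, M.scanner.iniRecord true x P W]

theorem length_of_mem_layer {x : List Bool} {P W t : ℕ} {gs : List (Letter M.Q)}
    {r : List M.scanner.G} (h : r ∈ M.layer x P W gs t) : r.length = W := by
  refine Scanner.length_of_mem_iterate_layerList (S := M.scanner) gs
    (L := [M.scanner.iniRecord false x P W, M.scanner.iniRecord true x P W]) (fun r hr => ?_) t r h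
  rcases List.mem_pair.mp hr with rfl | rfl <;> simp [Scanner.iniRecord]

/-- The width `W` exceeds every head position up to time `T`, so the records contain all heads and
`image_record` applies in each step. -/
theorem mem_layer {x : List Bool} {P W T t : ℕ} {gs : List (Letter M.Q)} (hW : P + T + x.length < W)
    (ht : t ≤ T) {r : List M.scanner.G} :
    r ∈ M.layer x P W gs t ↔ ∃ c, M.Guessed x P t c ∧ r = c.record x P W := by
  induction t generalizing r with
  | zero =>
    rw [layer, Function.iterate_zero, id, List.mem_pair, iniRecord_eq, iniRecord_eq]
    constructor
    · rintro (rfl | rfl)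
      exacts [⟨_, .init _, rfl⟩, ⟨_, .init _, rfl⟩]
    · rintro ⟨_, ⟨b⟩, rfl⟩
      cases b
      exacts [.inl rfl, .inr rfl]
  | succ t ih =>
    rw [layer, Function.iterate_succ_apply', ← layer, Scanner.mem_layerList (by omega) gs
      fun r hr => length_of_mem_layer hr]
    have himg : ∀ c, M.Guessed x P t c → ∀ g, M.scanner.image g (c.record x P W) =
        (M.guessStep x P g c).record x P W := fun c hc g =>
      image_record g (hc.inHead_le.trans_lt (by omega)) (hc.kHead_le.trans_lt (by omega))
        (hc.lHead_le.trans_lt (by omega)) (hc.certHead_le.trans_lt (by omega)) hc.inHead_le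
    constructor
    · rintro ⟨r', hr', g, rfl⟩
      obtain ⟨c, hc, rfl⟩ := (ih (by omega)).mp hr'
      exact ⟨_, .step g hc, himg c hc g⟩
    · rintro ⟨_, hc, rfl⟩
      obtain _ | ⟨g, hc⟩ := hc
      exact ⟨_, (ih (by omega)).mpr ⟨_, hc, rfl⟩, g, (himg _ hc g).symm⟩

/-- By time `T` every run has halted and keeps its state, so acceptance can be read off from this
one layer. -/
theorem any_layer {x : List Bool} {P W T : ℕ} (gs : List (Letter M.Q)) (hW : P + T + x.length < W)
    (hT : ∀ y, y.length = P → ∃ b, M.OutputsWithin x y b T) :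
    ((M.layer x P W gs T).any fun r => r.any M.scanner.good) = true ↔
      ∃ y : List Bool, y.length = P ∧ M.Accepts x y := by
  rw [List.any_eq_true]
  constructor
  · rintro ⟨r, hr, hgood⟩
    obtain ⟨c, hc, rfl⟩ := (mem_layer hW le_rfl).mp hr
    obtain ⟨y, hy, h⟩ := hc.exists_agrees
    refine ⟨y, hy, T, ?_⟩
    have := (any_record (by omega) c).symm.trans hgood
    rw [OutputsWithin, h.state]
    simpa using this
  · rintro ⟨y, hy, hacc⟩
    obtain ⟨c, hc, h⟩ := exists_guessed x hy T
    obtain ⟨b, hb⟩ := hT y hy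
    refine ⟨_, (mem_layer hW le_rfl).mpr ⟨c, hc, rfl⟩, ?_⟩
    refine (any_record (by omega) c).trans ?_
    have := hacc.outputsWithin hb
    rw [OutputsWithin, h.state] at this
    simpa using this

end Verifier

theorem SolvableInOStar.of_inEPNL {A : ParamProblem} (h : InEPNL A) : SolvableInOStar A 2 := by
  classical
  obtain ⟨p, M, hL, ⟨q, hq⟩, hk, C, hl⟩ := h
  have := M.finite
  have := Fintype.ofFinite (Verifier.Letter M.Q)
  have := M.scanner.finiteG
  have := M.scanner.finiteA
  obtain ⟨prog, T, hT, hprog⟩ := M.scanner.exists_mainProg p (p + q + .X + 1) q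
    (Finset.univ : Finset (Verifier.Letter M.Q)).toList
  -- The program already produces the answer bit, so the machine after it is the identity.
  let D : Turing.TM2ComputableAux Bool Bool := ⟨Turing.idComputer Bool, Equiv.refl _, Equiv.refl _⟩
  obtain ⟨E, hE⟩ := exists_glue D prog .tmp .t Sym.bit (fun a => (Sym.asBit (some a)).getD false)
    (none, ⟨M.scanner.acc, none, false, none, none⟩)
  -- Twice the bound of `exists_records` without its factor `2 ^ κ x`; the summand `2` takes care of
  -- the initial layer.
  let B : ℕ → ℕ := fun n => 2 * (Nat.card M.Q * (2 * ((n + 1) * ((q.eval n + 1) *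
    (((q.eval n + 1) * 2 ^ (C * logBound n)) * (p.eval n + 1)))))) + 2
  have hB : PolyBdd B :=
    ((PolyBdd.const 2).mul ((PolyBdd.const _).mul ((PolyBdd.const 2).mul ((PolyBdd.id.add (.const 1)).mul
      (((PolyBdd.eval q).add (.const 1)).mul ((((PolyBdd.eval q).add (.const 1)).mul
        (.two_pow_mul_logBound C)).mul ((PolyBdd.eval p).add (.const 1)))))))).add (.const 2)
  obtain ⟨R, hR⟩ : PolyBdd fun n => n + B n * T n + 1 + 1 + 2 :=
    (((PolyBdd.id.add (hB.mul hT)).add (.const 1)).add (.const 1)).add (.const 2)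
  refine ⟨E, R, fun x => ?_⟩
  specialize hprog x (2 ^ A.κ x * B x.length)
  have hW : (p + q + .X + 1 : Polynomial ℕ).eval x.length =
      p.eval x.length + q.eval x.length + x.length + 1 := by simp
  generalize (p + q + .X + 1 : Polynomial ℕ).eval x.length = W at hprog hW
  have hWlt : p.eval x.length + q.eval x.length + x.length < W := by omega
  obtain ⟨F, hF, hmem⟩ := M.exists_records W (q.eval x.length)
    (hk x) (hl x)
  have hN : 2 * F.card + 2 ≤ 2 ^ A.κ x * B x.length := by
    have h1 : 1 ≤ 2 ^ A.κ x := Nat.one_le_two_pow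
    calc 2 * F.card + 2 ≤ 2 * (Nat.card M.Q * (2 * ((x.length + 1) *
        (((q.eval x.length + 1) * 2 ^ A.κ x) * (((q.eval x.length + 1) * 2 ^ (C * logBound x.length)) *
          (p.eval x.length + 1)))))) + 2 * 2 ^ A.κ x := by
            refine add_le_add (Nat.mul_le_mul_left 2 hF) (by omega)
      _ = 2 ^ A.κ x * B x.length := by simp only [B]; ring
  have hdoes := hprog (by omega) (by omega) (by omega) (by omega) (by
    intro i hi
    cases i with
    | zero =>
      refine le_trans ?_ hN
      simp
    | succ i =>
      rw [Function.iterate_succ_apply']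
      refine le_trans (Scanner.length_layerList_le (by omega) _ (fun g => Finset.mem_toList.mpr (Finset.mem_univ (α := Verifier.Letter M.Q) g))
        (fun r hr => Verifier.length_of_mem_layer hr) F fun r hr => ?_) (le_trans (Nat.le_add_right _ 2) hN)
      obtain ⟨c, hc, rfl⟩ := (Verifier.mem_layer hWlt (by omega)).mp hr
      exact hmem i (by omega) c hc)
  obtain ⟨m', hrun⟩ := hdoes (none, ⟨M.scanner.acc, none, false, none, none⟩)
  have hbit := (Verifier.any_layer (Finset.univ : Finset (Verifier.Letter M.Q)).toList hWlt
    fun y hy => hq x y hy).trans (hL x).symm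
  have hdec : ((M.layer x (p.eval x.length) W
      (Finset.univ : Finset (Verifier.Letter M.Q)).toList (q.eval x.length)).any
        fun r => r.any M.scanner.good) = decide (x ∈ A.L) := by
    rw [Bool.eq_iff_iff, hbit, decide_eq_true_iff]
  have hfin := hE x _ (decide (x ∈ A.L)) _ _ 1 hrun (by
    refine ⟨⟨⟨1, ?_⟩, le_rfl⟩⟩
    rw [← hdec]
    rfl)
  refine ⟨_, ?_, hfin⟩
  have h1 : 1 ≤ 2 ^ A.κ x := Nat.one_le_two_pow
  have hle : x.length + 2 ^ A.κ x * B x.length * T x.length + 1 + 1 + 2 ≤ 2 ^ A.κ x * R.eval x.length := by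
    calc x.length + 2 ^ A.κ x * B x.length * T x.length + 1 + 1 + 2 = (x.length + 4) + 2 ^ A.κ x * (B x.length * T x.length) := by ring
      _ ≤ 2 ^ A.κ x * (x.length + 4) + 2 ^ A.κ x * (B x.length * T x.length) :=
        Nat.add_le_add_right (Nat.le_mul_of_pos_left _ h1) _
      _ = 2 ^ A.κ x * (x.length + B x.length * T x.length + 1 + 1 + 2) := by ring
      _ ≤ 2 ^ A.κ x * R.eval x.length := Nat.mul_le_mul_left _ (hR x.length)
  exact_mod_cast hle

end EPNL

theorem mainTheorem5 :
    (∀ A : EPNL.ParamProblem, EPNL.InEPNL A → EPNL.SolvableInOStar A 2) ∧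
    (∀ c : ℝ, 1 ≤ c →
      (∃ H : EPNL.ParamProblem, EPNL.IsHard H ∧ EPNL.SolvableInOStar H c) →
      ∀ A : EPNL.ParamProblem, EPNL.InEPNL A → EPNL.SolvableInOStar A c) :=
  ⟨fun _ => EPNL.SolvableInOStar.of_inEPNL, fun _ hc ⟨_, hH, hs⟩ A hA => .of_reducible hc (hH A hA) hs⟩
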